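/- Let $(M,\langle\cdot,\cdot\rangle)$ be a connected complete smooth Riemannian manifold without boundary, of dimension $m$; "a.e.", $|\cdot|$ of sets and unspecified integrals refer to its Riemannian volume, and $B_R(x_0)$ is the geodesic ball. Let $p\in(1,+\infty)$, $p'=\frac{p}{p-1}$, and let $A$ assign to $x\in M$, $s\in\mathbb R$, $\xi\in T_xM$ a vector $A(x,s,\xi)\in T_xM$, so that in every smooth chart $\psi:U\to\mathbb R^m$ the local representation $\tilde A(y,s,v)$ of $A$ is continuous in $(s,v)$ for a.e. $y\in\psi(U)$ and measurable in $y$ for all $(s,v)$. Assume that $Lu=\operatorname{div}A(x,u,\nabla u)$ is weakly-$p$-coercive with constant $k>0$, that is, for all $x\in M$, $s\in\mathbb R$, $\xi\in T_xM$, $$\langle A(x,s,\xi),\xi\rangle\ge 0,\qquad |A(x,s,\xi)|\le k\,\langle A(x,s,\xi),\xi\rangle^{\frac{p-1}{p}}.$$ Let $\lambda>0$, $\mu\in[0,p]$ and let $V:M\to(0,+\infty)$ be continuous with $$V\ge\lambda\ \text{ on } M\ \text{ if }\mu=0,\qquad \liminf_{x\to\infty}\,\bigl[\operatorname{dist}(x,o)^\mu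 V(x)\bigr]\ge\lambda\ \text{ for some } o\in M\ \text{ if }\mu\in(0,p].$$ Let $u\in W^{1,p}_{\rm loc}(M)$ and $0\le s_0<\operatorname{ess\,sup}_M u$ be such that $Lu\ge Vu^{p-1}$ weakly on $\Omega_{s_0}:=\{x\in M: u(x)>s_0\}$, that is, $$-\int_M\langle A(x,u,\nabla u),\nabla\varphi\rangle\ \ge\ \int_M V u^{p-1}\varphi$$ for every compactly supported $\varphi\in W^{1,p}_{\rm loc}(M)$ with $\varphi\ge 0$ on $M$ and $\varphi=0$, $\nabla\varphi=0$ a.e. on $M\setminus\Omega_{s_0}$. Let $x_0\in M$, $q\in(p-1,+\infty)$ and $$C_0:=\frac{p\,(q-p+1)^{1/p'}\lambda^{1/p}}{(p-1)^{1/p'}k}>0 .$$ Then the following hold, where $(\cdot)_+$ is the positive part, integrals may be $+\infty$, and $\log(+\infty)=+\infty$. 1. If $\mu\in[0,p)$, then $$\liminf_{R\to+\infty}\frac{1-\frac{\mu}{p}}{R^{1-\frac{\mu}{p}}}\log\int_{B_R(x_0)}(u-s_0)_+^q\ \ge\ C_0 .$$ 2. If $\mu=p$, there is a unique $C_1>p$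 with $C_1^{1/p}(C_1-p)^{1/p'}=C_0$, and $$\liminf_{R\to+\infty}\frac{1}{\log R}\log\int_{B_R(x_0)}(u-s_0)_+^q\ \ge\ C_1 .$$ 3. If $\mu=p$ and the limit $\displaystyle\lim_{R\to+\infty}\frac{1}{\log R}\log\int_{B_R(x_0)}(u-s_0)_+^q$ exists in $[-\infty,+\infty]$, then it is at least $C_0+p$. -/

import Mathlib

open MeasureTheory Filter Set Bundle
open scoped Manifold ContDiff Topology ENNReal RealInnerProductSpace

noncomputable section

namespace RiemannianGrowth

variable {m : ℕ} {M : Type*} [MetricSpace M] [ChartedSpace (EuclideanSpace ℝ (Fin m)) M]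

/-- The smooth charts of `M` (the maximal smooth atlas). -/
def smoothCharts (m : ℕ) (M : Type*) [MetricSpace M]
    [ChartedSpace (EuclideanSpace ℝ (Fin m)) M] :
    Set (OpenPartialHomeomorph M (EuclideanSpace ℝ (Fin m))) :=
  IsManifold.maximalAtlas (𝓡 m) ∞ M

/-- The vector `∑ vⁱ ∂/∂yⁱ` at the point `ψ⁻¹ y`, for a chart `ψ` and `v ∈ ℝᵐ`. -/
def chartVector (ψ : OpenPartialHomeomorph M (EuclideanSpace ℝ (Fin m)))
    (y v : EuclideanSpace ℝ (Fin m)) : TangentSpace (𝓡 m) (ψ.symm y) :=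
  mfderiv (𝓡 m) (𝓡 m) ψ.symm y v

/-- The components in the chart `ψ` of a tangent vector at the point `ψ⁻¹ y`. -/
def chartComponents (ψ : OpenPartialHomeomorph M (EuclideanSpace ℝ (Fin m)))
    (y : EuclideanSpace ℝ (Fin m)) (ξ : TangentSpace (𝓡 m) (ψ.symm y)) :
    EuclideanSpace ℝ (Fin m) :=
  mfderiv (𝓡 m) (𝓡 m) ψ (ψ.symm y) ξ

/-- The coordinate field `∂/∂yⁱ` at the point `ψ⁻¹ y`. -/
def coordField (ψ : OpenPartialHomeomorph M (EuclideanSpace ℝ (Fin m)))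
    (y : EuclideanSpace ℝ (Fin m)) (i : Fin m) : TangentSpace (𝓡 m) (ψ.symm y) :=
  chartVector ψ y (EuclideanSpace.single i 1)

variable [RiemannianBundle (fun x : M ↦ TangentSpace (𝓡 m) x)]

/-- The Riemannian density `√(det gᵢⱼ)` in the chart `ψ`. -/
def chartDensity (ψ : OpenPartialHomeomorph M (EuclideanSpace ℝ (Fin m)))
    (y : EuclideanSpace ℝ (Fin m)) : ℝ :=
  Real.sqrt (Matrix.of fun i j : Fin m ↦ ⟪coordField ψ y i, coordField ψ y j⟫).det

/-- The Riemannian volume on the domain of the chart `ψ` (extended by zero to `M`). -/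
def chartVolume [MeasurableSpace M]
    (ψ : OpenPartialHomeomorph M (EuclideanSpace ℝ (Fin m))) : Measure M :=
  ((volume.restrict ψ.target).withDensity
    fun y ↦ ENNReal.ofReal (chartDensity ψ y)).map ψ.symm

/-- The Riemannian volume measure. The chart volumes agree on overlaps, so their least upper
bound is the measure whose restriction to each chart domain is the chart volume. -/
def vol (m : ℕ) (M : Type*) [MetricSpace M] [ChartedSpace (EuclideanSpace ℝ (Fin m)) M]
    [RiemannianBundle (fun x : M ↦ TangentSpace (𝓡 m) x)] [MeasurableSpace M] : Measure M :=
  ⨆ ψ ∈ smoothCharts m M, chartVolume ψ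

/-- On an open set `U ⊆ ℝᵐ`: `f ∈ W^{1,p}_loc(U)` with weak partial derivatives `g i`. -/
structure IsEuclideanSobolevLoc (p : ℝ) (U : Set (EuclideanSpace ℝ (Fin m)))
    (f : EuclideanSpace ℝ (Fin m) → ℝ) (g : Fin m → EuclideanSpace ℝ (Fin m) → ℝ) : Prop where
  memLp : ∀ K ⊆ U, IsCompact K → MemLp f (ENNReal.ofReal p) (volume.restrict K)
  memLp_deriv : ∀ i, ∀ K ⊆ U, IsCompact K → MemLp (g i) (ENNReal.ofReal p) (volume.restrict K)
  weakDeriv : ∀ i, ∀ φ : EuclideanSpace ℝ (Fin m) → ℝ, ContDiff ℝ ∞ φ → HasCompactSupport φ →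
    tsupport φ ⊆ U →
    ∫ y, f y * fderiv ℝ φ y (EuclideanSpace.single i 1) = - ∫ y, g i y * φ y

/-- `u ∈ W^{1,p}_loc(M)` with weak gradient `X`: in each smooth chart `ψ` the function `u ∘ ψ⁻¹`
is in `W^{1,p}_loc`, with weak partial derivatives `⟨X, ∂/∂yⁱ⟩`. -/
def IsSobolevLoc (p : ℝ) (u : M → ℝ) (X : (x : M) → TangentSpace (𝓡 m) x) : Prop :=
  ∀ ψ ∈ smoothCharts m M, IsEuclideanSobolevLoc p ψ.target (fun y ↦ u (ψ.symm y))
    (fun i y ↦ ⟪X (ψ.symm y), coordField ψ y i⟫)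

/-- The Carathéodory conditions on the local representations of `A` in all smooth charts. -/
def IsCaratheodory
    (A : (x : M) → ℝ → TangentSpace (𝓡 m) x → TangentSpace (𝓡 m) x) : Prop :=
  ∀ ψ ∈ smoothCharts m M,
    (∀ᵐ y ∂(volume.restrict ψ.target), Continuous fun sv : ℝ × EuclideanSpace ℝ (Fin m) ↦
      chartComponents ψ y (A (ψ.symm y) sv.1 (chartVector ψ y sv.2))) ∧
    ∀ (s : ℝ) (v : EuclideanSpace ℝ (Fin m)),
      AEMeasurable (fun y ↦ chartComponents ψ y (A (ψ.symm y) s (chartVector ψ y v)))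
        (volume.restrict ψ.target)

/-- `A`, and the operator `u ↦ div A(x, u, ∇u)`, are weakly-`p`-coercive with constant `k`. -/
structure IsWeaklyCoercive (p k : ℝ)
    (A : (x : M) → ℝ → TangentSpace (𝓡 m) x → TangentSpace (𝓡 m) x) : Prop where
  caratheodory : IsCaratheodory A
  nonneg : ∀ (x : M) (s : ℝ) (ξ : TangentSpace (𝓡 m) x), 0 ≤ ⟪A x s ξ, ξ⟫
  norm_le : ∀ (x : M) (s : ℝ) (ξ : TangentSpace (𝓡 m) x),
    ‖A x s ξ‖ ≤ k * ⟪A x s ξ, ξ⟫ ^ ((p - 1) / p)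

/-- `φ ∈ D⁺(Ω)`, with weak gradient `Y`: `φ ∈ W^{1,p}_c(M)`, `φ ≥ 0`, and `φ = 0`, `∇φ = 0`
a.e. on the complement of `Ω`. -/
structure IsTestFunction [MeasurableSpace M] (p : ℝ) (Ω : Set M) (φ : M → ℝ)
    (Y : (x : M) → TangentSpace (𝓡 m) x) : Prop where
  sobolev : IsSobolevLoc p φ Y
  compactSupport : HasCompactSupport φ
  nonneg : ∀ x, 0 ≤ φ x
  eq_zero : ∀ᵐ x ∂(vol m M), x ∉ Ω → φ x = 0 ∧ Y x = 0

/-- `div A(x, u, ∇u) ≥ f` weakly on `{u > s₀}`, where `X` is the weak gradient of `u` and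
`f : M → [0, ∞]`. -/
def WeakIneq [MeasurableSpace M] (p : ℝ)
    (A : (x : M) → ℝ → TangentSpace (𝓡 m) x → TangentSpace (𝓡 m) x)
    (u : M → ℝ) (X : (x : M) → TangentSpace (𝓡 m) x) (f : M → ℝ≥0∞) (s₀ : ℝ) : Prop :=
  ∀ (φ : M → ℝ) (Y : (x : M) → TangentSpace (𝓡 m) x),
    IsTestFunction p {x | s₀ < u x} φ Y →
    ((∫⁻ x, f x * ENNReal.ofReal (φ x) ∂(vol m M) : ℝ≥0∞) : EReal) ≤
      ((- ∫ x, ⟪A x (u x) (X x), Y x⟫ ∂(vol m M) : ℝ) : EReal)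

/-- The lower bound on the potential: `V ≥ lam` if `μ = 0`, and
`liminf_{x → ∞} dist(x, o) ^ μ * V x ≥ lam` for some `o` if `μ > 0`. -/
def PotentialBound {M : Type*} [MetricSpace M] (V : M → ℝ) (lam μ : ℝ) : Prop :=
  (μ = 0 → ∀ x, lam ≤ V x) ∧
  (0 < μ → ∃ o : M,
    (lam : EReal) ≤ liminf (fun x ↦ ((dist x o ^ μ * V x : ℝ) : EReal)) (cocompact M))

/-- `log ∫_{B_R(x₀)} (u - s₀)₊ ^ q`, as an extended real number. -/
def logBallIntegral (m : ℕ) {M : Type*} [MetricSpace M]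
    [ChartedSpace (EuclideanSpace ℝ (Fin m)) M]
    [RiemannianBundle (fun x : M ↦ TangentSpace (𝓡 m) x)] [MeasurableSpace M]
    (u : M → ℝ) (s₀ q : ℝ) (x₀ : M) (R : ℝ) : EReal :=
  ENNReal.log (∫⁻ x in Metric.ball x₀ R, ENNReal.ofReal (max (u x - s₀) 0 ^ q) ∂(vol m M))

/-- `C₀ = p (q - p + 1)^{1/p'} lam^{1/p} / ((p - 1)^{1/p'} k)`, with `p' = p / (p - 1)`. -/
def growthConst (p q lam k : ℝ) : ℝ :=
  p * (q - p + 1) ^ (1 / p.conjExponent) * lam ^ (1 / p) / ((p - 1) ^ (1 / p.conjExponent) * k)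

end RiemannianGrowth

end

open RiemannianGrowth

section

open MeasureTheory Filter Set Bundle
open scoped Manifold ContDiff Topology ENNReal RealInnerProductSpace
open scoped Convolution NNReal
open Manifold

namespace RiemannianGrowth

/-! Write w = (u - s₀)₊, r = dist(x, x₀), β = q - p + 1. The weak inequality is tested with w^β
h(r)^p for a compactly supported Lipschitz profile h with local slope g. The term of ∇φ containing
∇u contributes -β w^(β-1) h^p ⟨A, ∇u⟩. Weak coercivity bounds the term containing ∇h by a multiple
of ⟨A, ∇u⟩^((p-1)/p), and Young's inequality absorbs it into the former. No gradient survives, and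
since w^(βp) / (w^(β-1))^(p-1) = w^q, what remains is the Hardy-type inequality of
`lintegral_rpow_le`: ∫ V w^q h^p ≤ K ∫ w^q g^p, with K = (p-1)^(p-1) k^p β^(1-p).

Let σ = μ/p and let Φ be a primitive of t^(-σ). The profile is h = exp(-cΦ(r)), frozen below a
radius R₀ and cut off linearly on S ≤ r ≤ S + d. Before the cutoff g ≤ c r^(-σ) h, so K g^p is
strictly below V h^p as soon as K c^p < λ and R₀ is large. The identity K (C₀/p)^p = λ makes C₀/p
the threshold for c. Subtracting the inner part of the right side leaves a positive quantity on the
left, bounded below independently of S and d because u exceeds s₀ on a set of positive measure. The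
annulus contributes at most K (exp(-cΦ(S)) (c S^(-σ) + 1/d))^p ∫ w^q. This is
`exists_le_mul_lintegral_ball`.

Taking logarithms, the choice d = 1 gives C₀ when μ < p. When μ = p, Φ = log and d is comparable to
R, so the factor in the annulus decays like R^(-c-1), and its p-th power gives a lower limit of at
least C₀ + p. This holds whether or not the limit exists, and C₁ ≤ C₀ + p, so it yields both
assertions for μ = p.

Since u is only Sobolev, w^β is first replaced by a C¹ truncation with bounded derivative. The chain
and product rules come from mollification in charts, compactness of closed balls from Hopf–Rinow,
and |∇h(r)| ≤ g from comparing the distance with lengths of chart segments. -/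

section

/-! ### Dominated convergence with a moving majorant -/

/-- A dominated convergence theorem where the dominating function varies. -/
theorem tendsto_integral_of_le_of_tendsto_integral {α : Type*} [MeasurableSpace α] {μ : Measure α}
    {F : ℕ → α → ℝ} {f : α → ℝ} {H : ℕ → α → ℝ} {h : α → ℝ}
    (hF : ∀ n, AEStronglyMeasurable (F n) μ) (hHi : ∀ n, Integrable (H n) μ)
    (hhi : Integrable h μ) (hFH : ∀ n, ∀ᵐ x ∂μ, |F n x| ≤ H n x)
    (hFf : ∀ᵐ x ∂μ, Tendsto (fun n ↦ F n x) atTop (𝓝 (f x)))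
    (hHh : ∀ᵐ x ∂μ, Tendsto (fun n ↦ H n x) atTop (𝓝 (h x)))
    (hint : Tendsto (fun n ↦ ∫ x, H n x ∂μ) atTop (𝓝 (∫ x, h x ∂μ))) :
    Tendsto (fun n ↦ ∫ x, F n x ∂μ) atTop (𝓝 (∫ x, f x ∂μ)) := by
  have hFi : ∀ n, Integrable (F n) μ := fun n ↦ (hHi n).mono' (hF n) (hFH n)
  have hfm : AEStronglyMeasurable f μ := aestronglyMeasurable_of_tendsto_ae _ hF hFf
  have hFHall : ∀ᵐ x ∂μ, ∀ n, |F n x| ≤ H n x := ae_all_iff.2 hFH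
  have hfh : ∀ᵐ x ∂μ, |f x| ≤ h x := by
    filter_upwards [hFHall, hFf, hHh] with x h1 h2 h3
    exact le_of_tendsto_of_tendsto' h2.abs h3 h1
  have hfi : Integrable f μ := hhi.mono' hfm hfh
  have h0 : ∀ᵐ x ∂μ, 0 ≤ h x := hfh.mono fun x hx ↦ (abs_nonneg _).trans hx
  have hpi : ∀ n, Integrable (fun x ↦ max (H n x - h x) 0) μ := fun n ↦ ((hHi n).sub hhi).pos_part
  have hni : ∀ n, Integrable (fun x ↦ max (h x - H n x) 0) μ := fun n ↦ (hhi.sub (hHi n)).pos_part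
  have hdi : ∀ n, Integrable (fun x ↦ H n x - h x) μ := fun n ↦ (hHi n).sub hhi
  have hmi : ∀ n, Integrable (fun x ↦ min |F n x - f x| (2 * h x)) μ :=
    fun n ↦ ((hFi n).sub hfi).abs.inf (hhi.const_mul 2)
  -- the negative part of `H n - h` is dominated by `h`
  have hneg : Tendsto (fun n ↦ ∫ x, max (h x - H n x) 0 ∂μ) atTop (𝓝 (∫ _, (0 : ℝ) ∂μ)) := by
    refine tendsto_integral_of_dominated_convergence h
      (fun n ↦ (hni n).aestronglyMeasurable) hhi ?_ ?_
    · intro n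
      filter_upwards [hFH n, h0] with x h1 h2
      rw [Real.norm_of_nonneg (le_max_right _ _)]
      exact max_le (by linarith [(abs_nonneg _).trans h1]) h2
    · filter_upwards [hHh] with x hx
      have : Tendsto (fun n ↦ max (h x - H n x) 0) atTop (𝓝 (max (h x - h x) 0)) :=
        (tendsto_const_nhds.sub hx).max tendsto_const_nhds
      simpa using this
  have hpos : Tendsto (fun n ↦ ∫ x, max (H n x - h x) 0 ∂μ) atTop (𝓝 0) := by
    have : ∀ n, ∫ x, max (H n x - h x) 0 ∂μ
        = (∫ x, H n x ∂μ) - (∫ x, h x ∂μ) + ∫ x, max (h x - H n x) 0 ∂μ := by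
      intro n
      rw [← integral_sub (hHi n) hhi,
        ← integral_add (hdi n) (hni n)]
      congr 1 with x
      rcases le_total (H n x) (h x) with hx | hx
      · rw [max_eq_right (by linarith), max_eq_left (by linarith)]; simp
      · rw [max_eq_left (by linarith), max_eq_right (by linarith)]; simp
    simp_rw [this]
    have := (hint.sub_const (∫ x, h x ∂μ)).add hneg
    simpa using this
  -- Since |F n - f| ≤ H n + h = 2h + (H n - h), the error splits into its truncation at the fixed
  -- integrable function 2h and the positive part of H n - h, already known to vanish in L¹.
  have hmin : Tendsto (fun n ↦ ∫ x, min |F n x - f x| (2 * h x) ∂μ) atTop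
      (𝓝 (∫ _, (0 : ℝ) ∂μ)) := by
    refine tendsto_integral_of_dominated_convergence (fun x ↦ 2 * h x)
      (fun n ↦ (hmi n).aestronglyMeasurable)
      (hhi.const_mul 2) ?_ ?_
    · intro n
      filter_upwards [h0] with x h2
      rw [Real.norm_of_nonneg (le_min (abs_nonneg _) (by linarith))]
      exact min_le_right _ _
    · filter_upwards [hFf, h0] with x hx h2
      have h3 : Tendsto (fun n ↦ |F n x - f x|) atTop (𝓝 0) := by
        have := (hx.sub_const (f x)).abs
        simpa using this
      exact squeeze_zero (fun n ↦ le_min (abs_nonneg _) (by linarith))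
        (fun n ↦ min_le_left _ _) h3
  rw [tendsto_iff_norm_sub_tendsto_zero]
  have hsum := hmin.add hpos
  simp only [integral_zero, add_zero] at hsum
  refine squeeze_zero (fun _ ↦ norm_nonneg _) (fun n ↦ ?_) hsum
  rw [← integral_sub (hFi n) hfi, ← integral_add (hmi n) (hpi n)]
  refine (norm_integral_le_integral_norm _).trans (integral_mono_ae ((hFi n).sub hfi).norm
    ((hmi n).add (hpi n)) ?_)
  filter_upwards [hFH n, hfh] with x h1 h2
  have h3 : |F n x - f x| ≤ H n x + h x := (abs_sub _ _).trans (by linarith)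
  change |F n x - f x| ≤ min |F n x - f x| (2 * h x) + max (H n x - h x) 0
  rcases le_total |F n x - f x| (2 * h x) with h4 | h4
  · rw [min_eq_left h4]; linarith [le_max_right (H n x - h x) 0]
  · rw [min_eq_right h4]; linarith [le_max_left (H n x - h x) 0]

/-! ### Mollification -/

section Mollifier

variable {m : ℕ}

/-- A sequence of bump functions shrinking to the origin. -/
noncomputable def shrinkingBump (m n : ℕ) : ContDiffBump (0 : EuclideanSpace ℝ (Fin m)) :=
  ⟨1 / (n + 1), 2 / (n + 1), by positivity, by gcongr; norm_num⟩

/-- The mollifications of `f`. -/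
noncomputable def mollify (f : EuclideanSpace ℝ (Fin m) → ℝ) (n : ℕ) :
    EuclideanSpace ℝ (Fin m) → ℝ :=
  ((shrinkingBump m n).normed volume ⋆[ContinuousLinearMap.lsmul ℝ ℝ, volume] f)

theorem tendsto_rOut_shrinkingBump :
    Tendsto (fun n ↦ (shrinkingBump m n).rOut) atTop (𝓝 0) := by
  have : Tendsto (fun n : ℕ ↦ (2 : ℝ) * (1 / ((n : ℝ) + 1))) atTop (𝓝 (2 * 0)) :=
    tendsto_one_div_add_atTop_nhds_zero_nat.const_mul 2
  simpa [shrinkingBump, div_eq_mul_inv] using this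

variable {f : EuclideanSpace ℝ (Fin m) → ℝ}

theorem integrable_mollify (hf : Integrable f) (n : ℕ) : Integrable (mollify f n) :=
  (ContDiffBump.integrable_normed _).integrable_convolution _ hf

theorem integral_mollify (hf : Integrable f) (n : ℕ) : ∫ x, mollify f n x = ∫ x, f x := by
  rw [mollify, integral_convolution _ (ContDiffBump.integrable_normed _) hf,
    ContDiffBump.integral_normed]
  simp

theorem ae_tendsto_mollify (hf : Integrable f) :
    ∀ᵐ x, Tendsto (fun n ↦ mollify f n x) atTop (𝓝 (f x)) := by
  refine ContDiffBump.ae_convolution_tendsto_right_of_locallyIntegrable (K := 2)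
    tendsto_rOut_shrinkingBump (Eventually.of_forall fun n ↦ ?_) hf.locallyIntegrable
  simp [shrinkingBump, div_eq_mul_inv]

/-- The kernel is nonnegative. The mollifications of |f| are thus a majorant that converges a.e. and
has constant integral, which is what the moving dominated convergence theorem asks for. -/
theorem abs_mollify_le (n : ℕ) (x : EuclideanSpace ℝ (Fin m)) :
    |mollify f n x| ≤ mollify (fun y ↦ |f y|) n x := by
  rw [mollify, mollify, convolution_def, convolution_def, ← Real.norm_eq_abs]
  refine (norm_integral_le_integral_norm _).trans_eq ?_
  congr 1 with y
  simp [abs_of_nonneg (ContDiffBump.nonneg_normed (shrinkingBump m n) (μ := volume) y)]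

theorem contDiff_mollify (hf : Integrable f) (n : ℕ) : ContDiff ℝ 1 (mollify f n) :=
  HasCompactSupport.contDiff_convolution_left (n := 1) _ (ContDiffBump.hasCompactSupport_normed _)
    (ContDiffBump.contDiff_normed _) hf.locallyIntegrable

theorem hasCompactSupport_mollify (hf : HasCompactSupport f) (n : ℕ) :
    HasCompactSupport (mollify f n) :=
  HasCompactSupport.convolution _ (ContDiffBump.hasCompactSupport_normed _) hf

theorem mollify_apply (n : ℕ) (x : EuclideanSpace ℝ (Fin m)) :
    mollify f n x = ∫ z, f z * (shrinkingBump m n).normed volume (x - z) := by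
  rw [mollify, convolution_eq_swap]
  simp [mul_comm]

theorem fderiv_mollify (hf : Integrable f) (n : ℕ) (x v : EuclideanSpace ℝ (Fin m)) :
    fderiv ℝ (mollify f n) x v =
      ∫ z, f z * fderiv ℝ ((shrinkingBump m n).normed volume) (x - z) v := by
  have h1 : mollify f n = (f ⋆[(ContinuousLinearMap.lsmul ℝ ℝ).flip, volume]
      (shrinkingBump m n).normed volume) := by
    rw [mollify, ← convolution_flip]
  have hcs := ContDiffBump.hasCompactSupport_normed (shrinkingBump m n) (μ := volume)
  have hcd : ContDiff ℝ 1 ((shrinkingBump m n).normed volume) :=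
    ContDiffBump.contDiff_normed (shrinkingBump m n) (n := 1)
  rw [h1, (hcs.hasFDerivAt_convolution_right _ hf.locallyIntegrable hcd x).fderiv,
    convolution_precompR_apply _ hf.locallyIntegrable (hcs.fderiv ℝ)
      (hcd.continuous_fderiv one_ne_zero), convolution_def]
  simp [mul_comm]

end Mollifier

end

/-! ### Chain and product rules for Euclidean Sobolev functions -/

section

variable {m : ℕ} {p : ℝ} {U : Set (EuclideanSpace ℝ (Fin m))}
  {f : EuclideanSpace ℝ (Fin m) → ℝ} {g : Fin m → EuclideanSpace ℝ (Fin m) → ℝ}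

theorem integrableOn_of_memLp_restrict (hp : 1 ≤ p) {K : Set (EuclideanSpace ℝ (Fin m))}
    (hK : IsCompact K) {f : EuclideanSpace ℝ (Fin m) → ℝ}
    (hf : MemLp f (ENNReal.ofReal p) (volume.restrict K)) : IntegrableOn f K := by
  have : IsFiniteMeasure (volume.restrict K) := ⟨by
    rw [Measure.restrict_apply_univ]; exact hK.measure_lt_top⟩
  rw [IntegrableOn, ← memLp_one_iff_integrable]
  exact hf.mono_exponent (by simpa using ENNReal.ofReal_le_ofReal hp)

/-- The mollification of a Sobolev function has as gradient the mollification of the weak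
gradient, away from the boundary. -/
theorem IsEuclideanSobolevLoc.fderiv_mollify_indicator (hp : 1 ≤ p)
    (hf : IsEuclideanSobolevLoc p U f g) {K : Set (EuclideanSpace ℝ (Fin m))} (hK : IsCompact K)
    (hKU : K ⊆ U) (i : Fin m) (n : ℕ) {y : EuclideanSpace ℝ (Fin m)}
    (hy : Metric.closedBall y (shrinkingBump m n).rOut ⊆ K) :
    fderiv ℝ (mollify (K.indicator f) n) y (EuclideanSpace.single i 1) =
      mollify (K.indicator (g i)) n y := by
  have hfi : Integrable (K.indicator f) :=
    (integrableOn_of_memLp_restrict hp hK (hf.memLp K hKU hK)).integrable_indicator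
      hK.measurableSet
  set ρ := (shrinkingBump m n).normed (volume : Measure (EuclideanSpace ℝ (Fin m))) with hρ
  have hρs : ContDiff ℝ ∞ ρ := ContDiffBump.contDiff_normed (shrinkingBump m n) (n := ⊤)
  have hts : tsupport ρ = Metric.closedBall 0 (shrinkingBump m n).rOut :=
    ContDiffBump.tsupport_normed_eq _
  -- The reflected kernel centred at y is the test function: the sign from the reflection cancels
  -- the one in the definition of the weak derivative.
  set φ : EuclideanSpace ℝ (Fin m) → ℝ := fun z ↦ ρ (y - z) with hφ
  have hφz : ∀ z, z ∉ Metric.closedBall y (shrinkingBump m n).rOut → φ z = 0 := by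
    intro z hz
    refine image_eq_zero_of_notMem_tsupport (f := ρ) ?_
    rw [hts]
    simpa [dist_eq_norm, norm_sub_rev, Metric.mem_closedBall] using hz
  have hφt : tsupport φ ⊆ Metric.closedBall y (shrinkingBump m n).rOut :=
    closure_minimal (fun z hz ↦ by
      by_contra h
      exact hz (hφz z h)) Metric.isClosed_closedBall
  have hφc : HasCompactSupport φ :=
    HasCompactSupport.intro (isCompact_closedBall y _) hφz
  have hφs : ContDiff ℝ ∞ φ := hρs.comp (contDiff_const.sub contDiff_id)
  have hφd : ∀ z v, fderiv ℝ φ z v = - fderiv ℝ ρ (y - z) v := by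
    intro z v
    have h1 : HasFDerivAt ρ (fderiv ℝ ρ (y - z)) (y - z) :=
      ((hρs.differentiable (by simp)) _).hasFDerivAt
    have h2 := h1.comp z ((hasFDerivAt_id z).const_sub y)
    rw [show φ = ρ ∘ HSub.hSub y from rfl, h2.fderiv]
    simp
  have hw := hf.weakDeriv i φ hφs hφc (hφt.trans (hy.trans hKU))
  rw [fderiv_mollify hfi, mollify_apply]
  have h1 : ∫ z, K.indicator f z * fderiv ℝ ρ (y - z) (EuclideanSpace.single i 1)
      = - ∫ z, f z * fderiv ℝ φ z (EuclideanSpace.single i 1) := by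
    rw [← integral_neg]
    congr 1 with z
    rw [hφd]
    by_cases hz : z ∈ K
    · simp [hz]
    · have : fderiv ℝ φ z = 0 :=
        image_eq_zero_of_notMem_tsupport
          (fun h ↦ hz (hy (hφt (tsupport_fderiv_subset ℝ h))))
      have h3 := hφd z (EuclideanSpace.single i 1)
      rw [this] at h3
      simp only [zero_apply] at h3
      rw [← h3]; simp [hz]
  rw [h1, hw, neg_neg]
  congr 1 with z
  by_cases hz : z ∈ K
  · simp [hz, hφ, hρ]
  · rw [hφz z (fun h ↦ hz (hy h))]
    simp [hz]

/-- The chain rule for Sobolev functions, tested against a Lipschitz function. -/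
theorem IsEuclideanSobolevLoc.integral_comp_mul_lineDeriv (hp : 1 ≤ p) (hU : IsOpen U)
    (hf : IsEuclideanSobolevLoc p U f g) {F F' : ℝ → ℝ} (hF : ∀ t, HasDerivAt F (F' t) t)
    (hF' : Continuous F') {C : ℝ≥0} (hC : ∀ t, |F' t| ≤ C)
    {θ : EuclideanSpace ℝ (Fin m) → ℝ} {D : ℝ≥0} (hθ : LipschitzWith D θ)
    (hθc : HasCompactSupport θ) (hθU : tsupport θ ⊆ U) (i : Fin m) :
    ∫ y, F (f y) * lineDeriv ℝ θ y (EuclideanSpace.single i 1) =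
      - ∫ y, F' (f y) * g i y * θ y := by
  set e : EuclideanSpace ℝ (Fin m) := EuclideanSpace.single i 1 with he
  -- The margin δ keeps the mollification at points of the support of θ, for radii below δ, from
  -- seeing the truncation of f to K.
  obtain ⟨δ, hδ, hδU⟩ := hθc.isCompact.exists_cthickening_subset_open hU hθU
  set K := Metric.cthickening δ (tsupport θ) with hKdef
  have hK : IsCompact K := hθc.isCompact.cthickening
  have hFL : LipschitzWith C F := by
    refine lipschitzWith_of_nnnorm_deriv_le (fun t ↦ (hF t).differentiableAt) (fun t ↦ ?_)
    rw [(hF t).deriv, ← NNReal.coe_le_coe]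
    simpa using hC t
  have hfi : Integrable (K.indicator f) :=
    (integrableOn_of_memLp_restrict hp hK (hf.memLp K hδU hK)).integrable_indicator
      hK.measurableSet
  have hgi : Integrable (K.indicator (g i)) :=
    (integrableOn_of_memLp_restrict hp hK (hf.memLp_deriv i K hδU hK)).integrable_indicator
      hK.measurableSet
  have hfc : HasCompactSupport (K.indicator f) :=
    HasCompactSupport.intro hK fun z hz ↦ indicator_of_notMem hz f
  have hθK : tsupport θ ⊆ K := Metric.self_subset_cthickening _
  have hld0 : ∀ y v, y ∉ tsupport θ → lineDeriv ℝ θ y v = 0 := by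
    intro y v hy
    have : θ =ᶠ[𝓝 y] fun _ ↦ (0 : ℝ) := notMem_tsupport_iff_eventuallyEq.1 hy
    rw [this.lineDeriv_eq]
    simp [lineDeriv]
  have hldneg : ∀ᵐ y, lineDeriv ℝ θ y (-e) = - lineDeriv ℝ θ y e := by
    filter_upwards with y
    exact lineDeriv_neg
  have hldb : ∀ y, |lineDeriv ℝ θ y e| ≤ D * ‖e‖ := fun y ↦
    norm_lineDeriv_le_of_lipschitz ℝ hθ
  have hldm : Measurable fun y ↦ lineDeriv ℝ θ y e := measurable_lineDeriv hθ.continuous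
  obtain ⟨B, hB⟩ := hθc.exists_bound_of_continuous hθ.continuous
  have hB0 : 0 ≤ B := (norm_nonneg _).trans (hB 0)
  have hrad : ∀ᶠ n in atTop, (shrinkingBump m n).rOut < δ :=
    (tendsto_order.1 tendsto_rOut_shrinkingBump).2 _ hδ
  -- integration by parts for the mollified functions
  have key : ∀ᶠ n in atTop, ∫ y, F (mollify (K.indicator f) n y) * lineDeriv ℝ θ y e =
      -∫ y, F' (mollify (K.indicator f) n y) * mollify (K.indicator (g i)) n y * θ y := by
    filter_upwards [hrad] with n hn
    set fn := mollify (K.indicator f) n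
    have hfn : ContDiff ℝ 1 fn := contDiff_mollify hfi n
    obtain ⟨L, hL⟩ := hfn.lipschitzWith_of_hasCompactSupport
      (hasCompactSupport_mollify hfc n) one_ne_zero
    -- Integration by parts for two Lipschitz functions, one of them compactly supported; it rests
    -- on Rademacher's theorem.
    have hip := (hFL.comp hL).integral_lineDeriv_mul_eq (μ := volume) hθ hθc e
    have h1 : ∫ y, lineDeriv ℝ θ y (-e) * (F ∘ fn) y = - ∫ y, F (fn y) * lineDeriv ℝ θ y e := by
      rw [← integral_neg]
      refine integral_congr_ae ?_
      filter_upwards [hldneg] with y hy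
      rw [hy]; simp [mul_comm]
    rw [h1] at hip
    rw [← neg_eq_iff_eq_neg, ← hip]
    congr 1 with y
    by_cases hy : y ∈ tsupport θ
    · have hd : HasFDerivAt (F ∘ fn) ((F' (fn y)) • fderiv ℝ fn y) y :=
        (hF (fn y)).comp_hasFDerivAt y ((hfn.differentiable one_ne_zero) y).hasFDerivAt
      rw [hd.differentiableAt.lineDeriv_eq_fderiv, hd.fderiv]
      have hb : Metric.closedBall y (shrinkingBump m n).rOut ⊆ K := by
        refine (Metric.closedBall_subset_cthickening hy _).trans ?_
        exact Metric.cthickening_mono hn.le _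
      rw [← hf.fderiv_mollify_indicator hp hK hδU i n hb]
      simp [fn, he]
    · simp [image_eq_zero_of_notMem_tsupport hy]
  have hL : Tendsto (fun n ↦ ∫ y, F (mollify (K.indicator f) n y) * lineDeriv ℝ θ y e) atTop
      (𝓝 (∫ y, F (K.indicator f y) * lineDeriv ℝ θ y e)) := by
    -- F need not vanish at 0, so the majorant carries |F 0| on the support of θ; the Lipschitz
    -- bound of F supplies the moving part.
    set Z : EuclideanSpace ℝ (Fin m) → ℝ := (tsupport θ).indicator fun _ ↦ |F 0| * (D * ‖e‖)
    have hZ : Integrable Z :=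
      (integrableOn_const hθc.isCompact.measure_lt_top.ne).integrable_indicator
        (isClosed_tsupport θ).measurableSet
    refine tendsto_integral_of_le_of_tendsto_integral
      (H := fun n y ↦ Z y + C * (D * ‖e‖) * mollify (fun z ↦ |K.indicator f z|) n y)
      (h := fun y ↦ Z y + C * (D * ‖e‖) * |K.indicator f y|) ?_ ?_ ?_ ?_ ?_ ?_ ?_
    · exact fun n ↦ ((hFL.continuous.comp (contDiff_mollify hfi n).continuous).aestronglyMeasurable).mul
        hldm.aestronglyMeasurable
    · exact fun n ↦ hZ.add ((integrable_mollify hfi.abs n).const_mul _)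
    · exact hZ.add (hfi.abs.const_mul _)
    · intro n
      filter_upwards with y
      have h1 := abs_mollify_le (f := K.indicator f) n y
      have h0 : 0 ≤ mollify (fun z ↦ |K.indicator f z|) n y := (abs_nonneg _).trans h1
      by_cases hy : y ∈ tsupport θ
      · have h2 : |F (mollify (K.indicator f) n y)|
            ≤ |F 0| + C * |mollify (K.indicator f) n y| := by
          have h3 := hFL.dist_le_mul (mollify (K.indicator f) n y) 0
          rw [Real.dist_eq, Real.dist_eq, sub_zero] at h3
          have := abs_sub_abs_le_abs_sub (F (mollify (K.indicator f) n y)) (F 0)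
          linarith
        have h3 : Z y = |F 0| * (D * ‖e‖) := indicator_of_mem hy _
        rw [abs_mul, h3]
        calc _ ≤ (|F 0| + C * mollify (fun z ↦ |K.indicator f z|) n y) * (D * ‖e‖) := by
              gcongr
              · exact h2.trans (by gcongr)
              · exact hldb y
          _ = _ := by ring
      · rw [hld0 y e hy]
        have h3 : Z y = 0 := indicator_of_notMem hy _
        rw [h3]; simp only [mul_zero, abs_zero, zero_add]; positivity
    · filter_upwards [ae_tendsto_mollify hfi] with y hy
      exact ((hFL.continuous.tendsto _).comp hy).mul_const _
    · filter_upwards [ae_tendsto_mollify hfi.abs] with y hy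
      exact (hy.const_mul _).const_add _
    · simp_rw [integral_add hZ ((integrable_mollify hfi.abs _).const_mul _),
        integral_add hZ (hfi.abs.const_mul _), integral_const_mul, integral_mollify hfi.abs]
      exact tendsto_const_nhds
  have hR : Tendsto (fun n ↦ ∫ y, F' (mollify (K.indicator f) n y) *
      mollify (K.indicator (g i)) n y * θ y) atTop
      (𝓝 (∫ y, F' (K.indicator f y) * K.indicator (g i) y * θ y)) := by
    refine tendsto_integral_of_le_of_tendsto_integral
      (H := fun n y ↦ C * B * mollify (fun z ↦ |K.indicator (g i) z|) n y)
      (h := fun y ↦ C * B * |K.indicator (g i) y|) ?_ ?_ ?_ ?_ ?_ ?_ ?_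
    · exact fun n ↦ (((hF'.comp (contDiff_mollify hfi n).continuous).mul
        (contDiff_mollify hgi n).continuous).mul hθ.continuous).aestronglyMeasurable
    · exact fun n ↦ (integrable_mollify hgi.abs n).const_mul _
    · exact hgi.abs.const_mul _
    · intro n
      filter_upwards with y
      have h1 := abs_mollify_le (f := K.indicator (g i)) n y
      rw [abs_mul, abs_mul]
      calc _ ≤ C * mollify (fun z ↦ |K.indicator (g i) z|) n y * B := by
            refine mul_le_mul (mul_le_mul (hC _) h1 (abs_nonneg _) C.2) (hB y) (abs_nonneg _) ?_
            exact mul_nonneg C.2 ((abs_nonneg _).trans h1)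
        _ = _ := by ring
    · filter_upwards [ae_tendsto_mollify hfi, ae_tendsto_mollify hgi] with y hy hy'
      exact (((hF'.tendsto _).comp hy).mul hy').mul_const _
    · filter_upwards [ae_tendsto_mollify hgi.abs] with y hy
      exact hy.const_mul _
    · simp_rw [integral_const_mul, integral_mollify hgi.abs]
      exact tendsto_const_nhds
  have hlim := tendsto_nhds_unique_of_eventuallyEq hL hR.neg key
  have e1 : ∫ y, F (K.indicator f y) * lineDeriv ℝ θ y e = ∫ y, F (f y) * lineDeriv ℝ θ y e := by
    congr 1 with y
    by_cases hy : y ∈ tsupport θ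
    · rw [indicator_of_mem (hθK hy)]
    · simp [hld0 y e hy]
  have e2 : ∫ y, F' (K.indicator f y) * K.indicator (g i) y * θ y
      = ∫ y, F' (f y) * g i y * θ y := by
    congr 1 with y
    by_cases hy : y ∈ tsupport θ
    · rw [indicator_of_mem (hθK hy), indicator_of_mem (hθK hy)]
    · simp [image_eq_zero_of_notMem_tsupport hy]
  rw [← e1, hlim, e2]

/-- A locally Lipschitz function with compact support is Lipschitz. -/
theorem exists_lipschitzWith_of_hasCompactSupport {θ : EuclideanSpace ℝ (Fin m) → ℝ}
    (hθ : LocallyLipschitz θ) (hθc : HasCompactSupport θ) : ∃ D, LipschitzWith D θ := by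
  obtain ⟨B, hB⟩ := hθc.exists_bound_of_continuous hθ.continuous
  have hB0 : 0 ≤ B := (norm_nonneg _).trans (hB 0)
  obtain ⟨D, hD⟩ := hθ.locallyLipschitzOn.exists_lipschitzOnWith_of_compact
    (s := Metric.cthickening 1 (tsupport θ)) hθc.isCompact.cthickening
  have key : ∀ x ∈ tsupport θ, ∀ y,
      dist (θ x) (θ y) ≤ (max D ⟨2 * B, by positivity⟩ : ℝ≥0) * dist x y := by
    -- Nearby points are handled by the Lipschitz constant on the compact 1-thickening; at distance
    -- more than 1 the oscillation 2B is at most 2B times the distance.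
    intro x hx y
    by_cases hxy : dist y x ≤ 1
    · have h1 : y ∈ Metric.cthickening 1 (tsupport θ) :=
        Metric.mem_cthickening_of_dist_le y x 1 _ hx hxy
      refine (hD.dist_le_mul x (Metric.self_subset_cthickening _ hx) y h1).trans ?_
      gcongr
      exact le_max_left _ _
    · have h1 : dist (θ x) (θ y) ≤ 2 * B * dist x y := by
        have h2 : dist (θ x) (θ y) ≤ B + B :=
          (dist_le_norm_add_norm _ _).trans (add_le_add (hB x) (hB y))
        rw [dist_comm x y]
        nlinarith
      refine h1.trans ?_
      gcongr
      exact NNReal.coe_le_coe.2 (le_max_right D (⟨2 * B, by positivity⟩ : ℝ≥0))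
  refine ⟨max D ⟨2 * B, by positivity⟩, LipschitzWith.of_dist_le_mul fun x y ↦ ?_⟩
  by_cases hx : x ∈ tsupport θ
  · exact key x hx y
  by_cases hy : y ∈ tsupport θ
  · rw [dist_comm, dist_comm x]; exact key y hy x
  · rw [image_eq_zero_of_notMem_tsupport hx, image_eq_zero_of_notMem_tsupport hy, dist_self]
    positivity

theorem integrable_mul_of_eq_zero_of_notMem {K : Set (EuclideanSpace ℝ (Fin m))}
    {a b : EuclideanSpace ℝ (Fin m) → ℝ} {B : ℝ} (hK : MeasurableSet K)
    (ha : IntegrableOn a K) (hb : AEStronglyMeasurable b (volume.restrict K))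
    (hB : ∀ y ∈ K, |b y| ≤ B) (h0 : ∀ y, y ∉ K → b y = 0) :
    Integrable fun y ↦ a y * b y := by
  rw [← integrableOn_iff_integrable_of_support_subset (s := K)]
  · refine (Integrable.mul_bdd (c := B) ha hb ?_ : Integrable _ _)
    exact (ae_restrict_iff' hK).2 (Eventually.of_forall hB)
  · intro y hy
    by_contra h
    exact hy (by simp [h0 y h])

/-- A compact thickening of K inside U gives one Lipschitz constant near every point of K. It bounds
the derivative everywhere, the value 0 at non-differentiable points included, and Rademacher's
theorem gives differentiability a.e. -/
theorem LocallyLipschitzOn.exists_forall_norm_fderiv_le {ζ : EuclideanSpace ℝ (Fin m) → ℝ}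
    (hU : IsOpen U) (hζ : LocallyLipschitzOn U ζ) {K : Set (EuclideanSpace ℝ (Fin m))}
    (hK : IsCompact K) (hKU : K ⊆ U) :
    (∃ D, ∀ y ∈ K, ‖fderiv ℝ ζ y‖ ≤ D) ∧ ∀ᵐ y, y ∈ K → DifferentiableAt ℝ ζ y := by
  obtain ⟨δ, hδ, hδU⟩ := hK.exists_cthickening_subset_open hU hKU
  obtain ⟨D, hD⟩ := (hζ.mono hδU).exists_lipschitzOnWith_of_compact hK.cthickening
  have hnhds : ∀ y ∈ K, Metric.cthickening δ K ∈ 𝓝 y := fun y hy ↦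
    mem_of_superset (Metric.closedBall_mem_nhds y hδ) (Metric.closedBall_subset_cthickening hy δ)
  refine ⟨⟨D, fun y hy ↦ norm_fderiv_le_of_lipschitzOn ℝ (hnhds y hy) hD⟩, ?_⟩
  filter_upwards [hD.ae_differentiableWithinAt_of_mem] with y hy hyK
  exact (hy (Metric.self_subset_cthickening _ hyK)).differentiableAt (hnhds y hyK)

/-- Off the support of φ the product vanishes near the point, so the behaviour of ζ outside U is
irrelevant. -/
theorem LocallyLipschitzOn.locallyLipschitz_mul {α : Type*} [PseudoMetricSpace α] {ζ φ : α → ℝ}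
    {U : Set α} (hU : IsOpen U) (hζ : LocallyLipschitzOn U ζ) {L : ℝ≥0} (hφ : LipschitzWith L φ)
    (hφU : tsupport φ ⊆ U) : LocallyLipschitz fun y ↦ ζ y * φ y := by
  intro x
  by_cases hx : x ∈ tsupport φ
  · obtain ⟨D, t, ht, hD⟩ := hζ (hφU hx)
    rw [hU.nhdsWithin_eq (hφU hx)] at ht
    have hb : ∀ᶠ y in 𝓝 x, |ζ y| < |ζ x| + 1 := by
      have : ContinuousAt ζ x := hζ.continuousOn.continuousAt (hU.mem_nhds (hφU hx))
      exact (tendsto_order.1 this.abs).2 _ (by linarith)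
    have hb' : ∀ᶠ y in 𝓝 x, |φ y| < |φ x| + 1 :=
      (tendsto_order.1 (hφ.continuous.continuousAt (x := x)).abs).2 _ (by linarith)
    refine ⟨⟨(|ζ x| + 1) * L + D * (|φ x| + 1), by positivity⟩,
      t ∩ {y | |ζ y| < |ζ x| + 1 ∧ |φ y| < |φ x| + 1}, inter_mem ht (hb.and hb'), ?_⟩
    refine LipschitzOnWith.of_dist_le_mul fun y hy z hz ↦ ?_
    have h1 := hD.dist_le_mul y hy.1 z hz.1
    have h2 := hφ.dist_le_mul y z
    rw [Real.dist_eq] at h1 h2 ⊢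
    rw [show ζ y * φ y - ζ z * φ z = ζ y * (φ y - φ z) + (ζ y - ζ z) * φ z by ring]
    refine (abs_add_le _ _).trans ?_
    rw [abs_mul, abs_mul]
    calc _ ≤ (|ζ x| + 1) * (L * dist y z) + D * dist y z * (|φ x| + 1) := by
          gcongr
          · exact hy.2.1.le
          · exact hz.2.2.le
      _ = ((|ζ x| + 1) * L + D * (|φ x| + 1)) * dist y z := by ring
  · have h0 : φ =ᶠ[𝓝 x] 0 := notMem_tsupport_iff_eventuallyEq.1 hx
    refine ⟨0, {y | φ y = 0}, h0, LipschitzOnWith.of_dist_le_mul fun y hy z hz ↦ ?_⟩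
    have hy' : φ y = 0 := hy
    have hz' : φ z = 0 := hz
    simp [hy', hz']

/-- If `f` is in `W^{1,p}_loc`, `F` is `C¹` with bounded derivative and `ζ` is locally Lipschitz,
then `F(f) ζ` is in `W^{1,p}_loc`. -/
theorem IsEuclideanSobolevLoc.comp_mul (hp : 1 ≤ p) (hU : IsOpen U)
    (hf : IsEuclideanSobolevLoc p U f g) {F F' : ℝ → ℝ} (hF : ∀ t, HasDerivAt F (F' t) t)
    (hF' : Continuous F') {C : ℝ≥0} (hC : ∀ t, |F' t| ≤ C)
    {ζ : EuclideanSpace ℝ (Fin m) → ℝ} (hζ : LocallyLipschitzOn U ζ)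
    {f' : EuclideanSpace ℝ (Fin m) → ℝ} {g' : Fin m → EuclideanSpace ℝ (Fin m) → ℝ}
    (hf' : ∀ y ∈ U, f' y = F (f y) * ζ y)
    (hg' : ∀ i, ∀ y ∈ U, g' i y = F' (f y) * ζ y * g i y +
      F (f y) * fderiv ℝ ζ y (EuclideanSpace.single i 1)) :
    IsEuclideanSobolevLoc p U f' g' := by
  have hFL : LipschitzWith C F := by
    refine lipschitzWith_of_nnnorm_deriv_le (fun t ↦ (hF t).differentiableAt) (fun t ↦ ?_)
    rw [(hF t).deriv, ← NNReal.coe_le_coe]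
    simpa using hC t
  have hFf : ∀ K ⊆ U, IsCompact K →
      MemLp (fun y ↦ F (f y)) (ENNReal.ofReal p) (volume.restrict K) := by
    intro K hKU hK
    have : IsFiniteMeasure (volume.restrict K) := ⟨by
      rw [Measure.restrict_apply_univ]; exact hK.measure_lt_top⟩
    have h1 := hf.memLp K hKU hK
    refine ((memLp_const |F 0|).add (h1.norm.const_mul (C : ℝ))).mono'
      (hFL.continuous.comp_aestronglyMeasurable h1.aestronglyMeasurable)
      (Eventually.of_forall fun y ↦ ?_)
    have h3 := hFL.dist_le_mul (f y) 0
    rw [Real.dist_eq, Real.dist_eq, sub_zero] at h3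
    have := abs_sub_abs_le_abs_sub (F (f y)) (F 0)
    simp only [Pi.add_apply, Real.norm_eq_abs]
    linarith
  have hζm : ∀ K ⊆ U, IsCompact K → AEStronglyMeasurable ζ (volume.restrict K) :=
    fun K hKU hK ↦ (hζ.continuousOn.mono hKU).aestronglyMeasurable hK.measurableSet
  have hζb : ∀ K ⊆ U, IsCompact K → ∃ B, ∀ y ∈ K, |ζ y| ≤ B :=
    fun K hKU hK ↦ hK.exists_bound_of_continuousOn (hζ.continuousOn.mono hKU)
  have hdm : ∀ v, Measurable fun y ↦ fderiv ℝ ζ y v := fun v ↦ measurable_fderiv_apply_const ℝ ζ v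
  have hF'm : ∀ K ⊆ U, IsCompact K → AEStronglyMeasurable (fun y ↦ F' (f y))
      (volume.restrict K) :=
    fun K hKU hK ↦ hF'.comp_aestronglyMeasurable (hf.memLp K hKU hK).aestronglyMeasurable
  refine ⟨fun K hKU hK ↦ ?_, fun i K hKU hK ↦ ?_, fun i φ hφ hφc hφU ↦ ?_⟩
  · obtain ⟨B, hB⟩ := hζb K hKU hK
    refine MemLp.ae_eq (f := fun y ↦ F (f y) * ζ y) ?_ ?_
    · exact (ae_restrict_iff' hK.measurableSet).2
        (Eventually.of_forall fun y hy ↦ (hf' y (hKU hy)).symm)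
    · refine ((hFf K hKU hK).norm.const_mul B).mono'
        ((hFf K hKU hK).aestronglyMeasurable.mul (hζm K hKU hK)) ?_
      refine (ae_restrict_iff' hK.measurableSet).2 (Eventually.of_forall fun y hy ↦ ?_)
      rw [norm_mul, mul_comm]
      gcongr
      exact hB y hy
  · obtain ⟨B, hB⟩ := hζb K hKU hK
    obtain ⟨⟨D, hD⟩, -⟩ := LocallyLipschitzOn.exists_forall_norm_fderiv_le hU hζ hK hKU
    refine MemLp.ae_eq (f := (fun y ↦ F' (f y) * ζ y * g i y) + fun y ↦
      F (f y) * fderiv ℝ ζ y (EuclideanSpace.single i 1)) ?_ (MemLp.add ?_ ?_)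
    · exact (ae_restrict_iff' hK.measurableSet).2
        (Eventually.of_forall fun y hy ↦ (hg' i y (hKU hy)).symm)
    · refine ((hf.memLp_deriv i K hKU hK).norm.const_mul (C * B)).mono'
        (((hF'm K hKU hK).mul (hζm K hKU hK)).mul
          (hf.memLp_deriv i K hKU hK).aestronglyMeasurable) ?_
      refine (ae_restrict_iff' hK.measurableSet).2 (Eventually.of_forall fun y hy ↦ ?_)
      rw [norm_mul, norm_mul]
      gcongr
      · exact hC _
      · exact hB y hy
    · refine ((hFf K hKU hK).norm.const_mul (D * ‖(EuclideanSpace.single i 1 :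
        EuclideanSpace ℝ (Fin m))‖)).mono' ((hFf K hKU hK).aestronglyMeasurable.mul
          (hdm _).aestronglyMeasurable) ?_
      refine (ae_restrict_iff' hK.measurableSet).2 (Eventually.of_forall fun y hy ↦ ?_)
      rw [norm_mul, mul_comm]
      gcongr
      exact ContinuousLinearMap.le_of_opNorm_le _ (hD y hy) _
  · set e : EuclideanSpace ℝ (Fin m) := EuclideanSpace.single i 1 with he
    set K := tsupport φ with hKdef
    have hK : IsCompact K := hφc
    have hKm : MeasurableSet K := hK.measurableSet
    have hφ1 : ContDiff ℝ 1 φ := hφ.of_le (by simp)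
    obtain ⟨L, hL⟩ := hφ1.lipschitzWith_of_hasCompactSupport hφc one_ne_zero
    -- The factor ζ is moved onto the test function: the chain rule is applied against the Lipschitz
    -- function ζφ, and ζ ∂φ = ∂(ζφ) - φ ∂ζ a.e. gives the product rule.
    set θ : EuclideanSpace ℝ (Fin m) → ℝ := fun y ↦ ζ y * φ y with hθdef
    have hθ0 : ∀ y, y ∉ K → θ y = 0 := fun y hy ↦ by
      simp [hθdef, image_eq_zero_of_notMem_tsupport hy]
    have hθc : HasCompactSupport θ := HasCompactSupport.intro hK hθ0
    have hθK : tsupport θ ⊆ K := closure_minimal (fun z hz ↦ by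
      by_contra h
      exact hz (hθ0 z h)) (isClosed_tsupport φ)
    obtain ⟨D, hD⟩ := exists_lipschitzWith_of_hasCompactSupport
      (LocallyLipschitzOn.locallyLipschitz_mul hU hζ hL hφU) hθc
    have hmain := hf.integral_comp_mul_lineDeriv hp hU hF hF' hC hD hθc (hθK.trans hφU) i
    rw [← he] at hmain
    obtain ⟨⟨D', hD'⟩, hdiff⟩ := LocallyLipschitzOn.exists_forall_norm_fderiv_le hU hζ hK hφU
    obtain ⟨B, hB⟩ := hζb K hφU hK
    obtain ⟨B', hB'⟩ := hφc.exists_bound_of_continuous hφ.continuous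
    have hfd0 : ∀ y, y ∉ K → fderiv ℝ φ y = 0 := fun y hy ↦
      image_eq_zero_of_notMem_tsupport (fun h ↦ hy (tsupport_fderiv_subset ℝ h))
    have hprod : ∀ᵐ y, lineDeriv ℝ θ y e = ζ y * fderiv ℝ φ y e + φ y * fderiv ℝ ζ y e := by
      filter_upwards [hdiff] with y hy
      by_cases hyK : y ∈ K
      · have h1 := (hy hyK).hasFDerivAt.mul ((hφ1.differentiable one_ne_zero) y).hasFDerivAt
        rw [show θ = ζ * φ from rfl, h1.differentiableAt.lineDeriv_eq_fderiv, h1.fderiv]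
        simp
      · have : θ =ᶠ[𝓝 y] fun _ ↦ (0 : ℝ) :=
          notMem_tsupport_iff_eventuallyEq.1 (fun h ↦ hyK (hθK h))
        rw [this.lineDeriv_eq, hfd0 y hyK, image_eq_zero_of_notMem_tsupport hyK]
        simp [lineDeriv]
    have hFi : IntegrableOn (fun y ↦ F (f y)) K :=
      integrableOn_of_memLp_restrict hp hK (hFf K hφU hK)
    have hgi : IntegrableOn (g i) K :=
      integrableOn_of_memLp_restrict hp hK (hf.memLp_deriv i K hφU hK)
    have I1 : Integrable fun y ↦ F (f y) * lineDeriv ℝ θ y e := by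
      refine integrable_mul_of_eq_zero_of_notMem hKm hFi
        (measurable_lineDeriv hD.continuous).aestronglyMeasurable
        (fun y _ ↦ norm_lineDeriv_le_of_lipschitz ℝ hD) (fun y hyK ↦ ?_)
      have : θ =ᶠ[𝓝 y] fun _ ↦ (0 : ℝ) :=
        notMem_tsupport_iff_eventuallyEq.1 (fun h ↦ hyK (hθK h))
      rw [this.lineDeriv_eq]
      simp [lineDeriv]
    have I2 : Integrable fun y ↦ F (f y) * (φ y * fderiv ℝ ζ y e) := by
      refine integrable_mul_of_eq_zero_of_notMem (B := B' * (D' * ‖e‖)) hKm hFi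
        (hφ.continuous.aestronglyMeasurable.mul (hdm e).aestronglyMeasurable)
        (fun y hy ↦ ?_) (fun y hy ↦ by simp [image_eq_zero_of_notMem_tsupport hy])
      rw [abs_mul]
      exact mul_le_mul (hB' y) (ContinuousLinearMap.le_of_opNorm_le _ (hD' y hy) _)
        (abs_nonneg _) ((norm_nonneg _).trans (hB' y))
    have I3 : Integrable fun y ↦ g i y * (F' (f y) * θ y) := by
      refine integrable_mul_of_eq_zero_of_notMem (B := C * (B * B')) hKm hgi
        ((hF'm K hφU hK).mul hD.continuous.aestronglyMeasurable) (fun y hy ↦ ?_)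
        (fun y hy ↦ by simp [hθ0 y hy])
      rw [abs_mul]
      refine mul_le_mul (hC _) ?_ (abs_nonneg _) C.2
      rw [hθdef, abs_mul]
      exact mul_le_mul (hB y hy) (hB' y) (abs_nonneg _) ((abs_nonneg _).trans (hB y hy))
    have e1 : ∫ y, f' y * fderiv ℝ φ y e =
        (∫ y, F (f y) * lineDeriv ℝ θ y e) - ∫ y, F (f y) * (φ y * fderiv ℝ ζ y e) := by
      rw [← integral_sub I1 I2]
      refine integral_congr_ae ?_
      filter_upwards [hprod] with y hy
      rw [hy]
      by_cases hyK : y ∈ K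
      · rw [hf' y (hφU hyK)]; ring
      · rw [hfd0 y hyK, image_eq_zero_of_notMem_tsupport hyK]; simp
    have e2 : ∫ y, g' i y * φ y =
        (∫ y, g i y * (F' (f y) * θ y)) + ∫ y, F (f y) * (φ y * fderiv ℝ ζ y e) := by
      rw [← integral_add I3 I2]
      congr 1 with y
      by_cases hyK : y ∈ K
      · rw [hg' i y (hφU hyK)]; simp only [hθdef]; ring
      · simp only [hθdef, image_eq_zero_of_notMem_tsupport hyK]; simp
    rw [e1, e2, hmain]
    have e3 : ∫ y, F' (f y) * g i y * θ y = ∫ y, g i y * (F' (f y) * θ y) := by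
      congr 1 with y; ring
    rw [e3]; ring

end

section

/-! ### Charts and the Riemannian distance -/

section Chart

variable {m : ℕ} {M : Type*} [MetricSpace M] [ChartedSpace (EuclideanSpace ℝ (Fin m)) M]
  {ψ : OpenPartialHomeomorph M (EuclideanSpace ℝ (Fin m))}

theorem chartVector_smul (c : ℝ) (y v : EuclideanSpace ℝ (Fin m)) :
    chartVector ψ y (c • v) = c • chartVector ψ y v :=
  map_smul (mfderiv (𝓡 m) (𝓡 m) ψ.symm y) c v

variable [RiemannianBundle (fun x : M ↦ TangentSpace (𝓡 m) x)]

/-- The distance between the images of two points of a chart is bounded by the length of the image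
of a segment. -/
theorem dist_chart_symm_le [IsRiemannianManifold (𝓡 m) M] (hψ : ψ ∈ smoothCharts m M) {y v : EuclideanSpace ℝ (Fin m)} {L : ℝ}
    (hL : 0 ≤ L) (ht : ∀ t ∈ Icc (0 : ℝ) 1, y + t • v ∈ ψ.target)
    (hb : ∀ t ∈ Icc (0 : ℝ) 1, ‖chartVector ψ (y + t • v) v‖ ≤ L) :
    dist (ψ.symm y) (ψ.symm (y + v)) ≤ L := by
  have h1 : ContMDiffOn (𝓡 m) (𝓡 m) ∞ ψ.symm ψ.target :=
    contMDiffOn_symm_of_mem_maximalAtlas hψ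
  set σ : ℝ → EuclideanSpace ℝ (Fin m) := fun t ↦ y + t • v with hσ
  have hσs : ContDiff ℝ 1 σ := by fun_prop
  have hγ : ContMDiffOn 𝓘(ℝ, ℝ) (𝓡 m) 1 (ψ.symm ∘ σ) (Icc 0 1) :=
    (h1.of_le (by simp)).comp hσs.contMDiff.contMDiffOn ht
  have h2 : riemannianEDist (𝓡 m) (ψ.symm y) (ψ.symm (y + v))
      ≤ pathELength (𝓡 m) (ψ.symm ∘ σ) 0 1 :=
    riemannianEDist_le_pathELength hγ (by simp [σ]) (by simp [σ]) zero_le_one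
  have h3 : pathELength (𝓡 m) (ψ.symm ∘ σ) 0 1 ≤ ENNReal.ofReal L := by
    rw [pathELength_eq_lintegral_mfderiv_Icc]
    calc _ ≤ ∫⁻ t in Icc (0 : ℝ) 1, ENNReal.ofReal L := by
          refine setLIntegral_mono' measurableSet_Icc fun t hts ↦ ?_
          have hd1 : MDifferentiableAt (𝓡 m) (𝓡 m) ψ.symm (σ t) :=
            ((h1 _ (ht t hts)).contMDiffAt (ψ.open_target.mem_nhds (ht t hts))).mdifferentiableAt
              (by simp)
          have hd2 : HasDerivAt σ v t := by
            have := ((hasDerivAt_id t).smul_const v).const_add y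
            rwa [one_smul] at this
          have hd3 : fderiv ℝ σ t 1 = v := by
            rw [hd2.hasFDerivAt.fderiv]
            simp
          have hd4 : mfderiv 𝓘(ℝ, ℝ) (𝓡 m) (ψ.symm ∘ σ) t =
              (mfderiv (𝓡 m) (𝓡 m) ψ.symm (σ t)).comp (mfderiv 𝓘(ℝ, ℝ) (𝓡 m) σ t) :=
            mfderiv_comp t hd1 hd2.differentiableAt.mdifferentiableAt
          have hd5 : mfderiv 𝓘(ℝ, ℝ) (𝓡 m) (ψ.symm ∘ σ) t 1 = chartVector ψ (σ t) v := by
            refine congr($hd4 1).trans ?_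
            rw [mfderiv_eq_fderiv]
            exact congrArg (mfderiv (𝓡 m) (𝓡 m) ψ.symm (σ t)) hd3
          rw [hd5, ← ofReal_norm]
          exact ENNReal.ofReal_le_ofReal (hb t hts)
      _ = ENNReal.ofReal L := by simp
  rw [dist_edist, IsRiemannianManifold.out (I := 𝓡 m)]
  exact ENNReal.toReal_le_of_le_ofReal hL (h2.trans h3)

variable [IsManifold (𝓡 m) ∞ M]
  [IsContMDiffRiemannianBundle (𝓡 m) ∞ (EuclideanSpace ℝ (Fin m))
      (fun x : M ↦ TangentSpace (𝓡 m) x)]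

/-- The vector is the image of (y, v) under the tangent map of the inverse chart, which is
continuous into the tangent bundle, and the metric is continuous there. Joint continuity in point
and vector is what the estimates along segments need. -/
theorem continuousOn_norm_chartVector (hψ : ψ ∈ smoothCharts m M) :
    ContinuousOn (fun q : EuclideanSpace ℝ (Fin m) × EuclideanSpace ℝ (Fin m) ↦
      ‖chartVector ψ q.1 q.2‖) (ψ.target ×ˢ univ) := by
  have h1 : ContMDiffOn (𝓡 m) (𝓡 m) ∞ ψ.symm ψ.target :=
    contMDiffOn_symm_of_mem_maximalAtlas hψ
  have h2 := h1.continuousOn_tangentMapWithin (by simp) ψ.open_target.uniqueMDiffOn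
  have h3 : ContinuousOn (fun q : EuclideanSpace ℝ (Fin m) × EuclideanSpace ℝ (Fin m) ↦
      (⟨ψ.symm q.1, chartVector ψ q.1 q.2⟩ : TangentBundle (𝓡 m) M)) (ψ.target ×ˢ univ) := by
    have h4 : Continuous (fun q : EuclideanSpace ℝ (Fin m) × EuclideanSpace ℝ (Fin m) ↦
        (⟨q.1, q.2⟩ : TangentBundle (𝓡 m) (EuclideanSpace ℝ (Fin m)))) :=
      (tangentBundleModelSpaceHomeomorph (𝓡 m)).symm.continuous
    refine (h2.comp h4.continuousOn (fun q hq ↦ hq.1)).congr (fun q hq ↦ ?_)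
    simp only [Function.comp_apply, tangentMapWithin, chartVector]
    rw [mfderivWithin_of_mem_nhds (ψ.open_target.mem_nhds hq.1)]
  have : IsContinuousRiemannianBundle (EuclideanSpace ℝ (Fin m))
      (fun x : M ↦ TangentSpace (𝓡 m) x) := by
    obtain ⟨g, hg, hg'⟩ := IsContMDiffRiemannianBundle.exists_contMDiff (IB := 𝓡 m) (n := ∞)
      (F := EuclideanSpace ℝ (Fin m)) (E := fun x : M ↦ TangentSpace (𝓡 m) x)
    exact ⟨g, hg.continuous, hg'⟩
  have h5 := (h3.inner_bundle h3).sqrt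
  refine h5.congr fun q _ ↦ ?_
  beta_reduce
  rw [real_inner_self_eq_norm_sq, Real.sqrt_sq (norm_nonneg _)]

variable [IsRiemannianManifold (𝓡 m) M]

/-- The inverse of a smooth chart is locally Lipschitz. -/
theorem locallyLipschitzOn_chart_symm (hψ : ψ ∈ smoothCharts m M) :
    LocallyLipschitzOn ψ.target ψ.symm := by
  intro y hy
  have hc := (continuousOn_norm_chartVector hψ).continuousAt (x := (y, 0))
    ((ψ.open_target.prod isOpen_univ).mem_nhds ⟨hy, mem_univ _⟩)
  have h0 : ‖chartVector ψ y (0 : EuclideanSpace ℝ (Fin m))‖ = 0 := by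
    rw [show (0 : EuclideanSpace ℝ (Fin m)) = (0 : ℝ) • 0 by simp, chartVector_smul]
    simp
  have hev : ∀ᶠ q in 𝓝 (y, (0 : EuclideanSpace ℝ (Fin m))), ‖chartVector ψ q.1 q.2‖ < 1 :=
    (tendsto_order.1 hc).2 1 (by simp [h0])
  rw [nhds_prod_eq] at hev
  obtain ⟨pa, hpa, pb, hpb, hab⟩ := eventually_prod_iff.1 hev
  obtain ⟨δ, hδ, hδp⟩ := Metric.eventually_nhds_iff_ball.1
    (hpa.and (ψ.open_target.mem_nhds hy))
  obtain ⟨ε, hε, hεp⟩ := Metric.eventually_nhds_iff_ball.1 hpb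
  -- Continuity at (y, 0) makes the norm less than 1 for base points δ-close to y and vectors
  -- shorter than ε; rescaling b - a to length ε/2 turns this into the constant 2/ε.
  refine ⟨⟨2 / ε, by positivity⟩, Metric.ball y δ,
    mem_nhdsWithin_of_mem_nhds (Metric.ball_mem_nhds y hδ),
    LipschitzOnWith.of_dist_le_mul fun a ha b hb ↦ ?_⟩
  have hseg : ∀ t ∈ Icc (0 : ℝ) 1, a + t • (b - a) ∈ Metric.ball y δ := fun t ht ↦
    (convex_ball y δ).add_smul_sub_mem ha hb ht
  have key := dist_chart_symm_le hψ (y := a) (v := b - a) (L := 2 / ε * ‖b - a‖) (by positivity)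
    (fun t ht ↦ (hδp _ (hseg t ht)).2) (fun t ht ↦ ?_)
  · rw [add_sub_cancel] at key
    rw [dist_eq_norm a b, norm_sub_rev]
    exact key
  · rcases eq_or_ne (b - a) 0 with h | h
    · rw [h, show (0 : EuclideanSpace ℝ (Fin m)) = (0 : ℝ) • 0 by simp, chartVector_smul]
      simp
    · have hn : 0 < ‖b - a‖ := norm_pos_iff.2 h
      have h3 : pb ((ε / (2 * ‖b - a‖)) • (b - a)) := by
        refine hεp _ ?_
        rw [mem_ball_zero_iff, norm_smul, Real.norm_of_nonneg (by positivity)]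
        field_simp
        linarith
      have h4 := hab (hδp _ (hseg t ht)).1 h3
      simp only at h4
      rw [chartVector_smul, norm_smul, Real.norm_of_nonneg (by positivity)] at h4
      have h5 : ‖chartVector ψ (a + t • (b - a)) (b - a)‖
          = (2 * ‖b - a‖ / ε) * (ε / (2 * ‖b - a‖) *
            ‖chartVector ψ (a + t • (b - a)) (b - a)‖) := by
        field_simp
      rw [h5]
      calc _ ≤ (2 * ‖b - a‖ / ε) * 1 := by gcongr
        _ = _ := by ring

/-- To first order, the distance is bounded by the Riemannian norm. -/
theorem eventually_dist_chart_symm_le (hψ : ψ ∈ smoothCharts m M) {y : EuclideanSpace ℝ (Fin m)}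
    (hy : y ∈ ψ.target) (v : EuclideanSpace ℝ (Fin m)) {ε : ℝ} (hε : 0 < ε) :
    ∀ᶠ t in 𝓝[>] (0 : ℝ),
      dist (ψ.symm y) (ψ.symm (y + t • v)) ≤ t * (‖chartVector ψ y v‖ + ε) := by
  have hc := (continuousOn_norm_chartVector hψ).continuousAt (x := (y, v))
    ((ψ.open_target.prod isOpen_univ).mem_nhds ⟨hy, mem_univ _⟩)
  have hc2 : Tendsto (fun t : ℝ ↦ (y + t • v, v)) (𝓝 0) (𝓝 (y, v)) := by
    have : Continuous fun t : ℝ ↦ (y + t • v, v) := by fun_prop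
    simpa using this.tendsto 0
  have hev : ∀ᶠ t in 𝓝 (0 : ℝ), ‖chartVector ψ (y + t • v) v‖ < ‖chartVector ψ y v‖ + ε :=
    hc2.eventually ((tendsto_order.1 hc).2 _ (by simpa using hε))
  have hev2 : ∀ᶠ t in 𝓝 (0 : ℝ), y + t • v ∈ ψ.target :=
    ((continuous_fst.tendsto _).comp hc2).eventually (ψ.open_target.mem_nhds hy)
  obtain ⟨δ, hδ, hδp⟩ := Metric.eventually_nhds_iff_ball.1 (hev.and hev2)
  filter_upwards [Ioo_mem_nhdsGT hδ] with t ht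
  have hst : ∀ s ∈ Icc (0 : ℝ) 1, s * t ∈ Metric.ball (0 : ℝ) δ := fun s hs ↦ by
    rw [mem_ball_zero_iff, Real.norm_of_nonneg (mul_nonneg hs.1 ht.1.le)]
    exact lt_of_le_of_lt (mul_le_of_le_one_left ht.1.le hs.2) ht.2
  have h0 : 0 ≤ t * (‖chartVector ψ y v‖ + ε) :=
    mul_nonneg ht.1.le (add_nonneg (norm_nonneg _) hε.le)
  refine dist_chart_symm_le hψ h0 (fun s hs ↦ ?_) (fun s hs ↦ ?_)
  · rw [smul_smul]; exact (hδp _ (hst s hs)).2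
  · rw [smul_smul, chartVector_smul, norm_smul, Real.norm_of_nonneg ht.1.le]
    exact mul_le_mul_of_nonneg_left (hδp _ (hst s hs)).1.le ht.1.le

end Chart

end

section

/-! ### Hopf–Rinow: completeness implies properness -/

section HopfRinow

/-- A complete locally compact length space is proper. -/
theorem properSpace_of_exists_dist_le {M : Type*} [MetricSpace M] [CompleteSpace M]
    [LocallyCompactSpace M]
    (h : ∀ (x y : M) (r s : ℝ), 0 ≤ r → 0 < s → dist x y < r + s →
      ∃ z, dist x z ≤ r ∧ dist z y < s) : ProperSpace M := by
  refine ⟨fun x R ↦ ?_⟩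
  rcases lt_or_ge R 0 with hR | hR
  · rw [Metric.closedBall_eq_empty.2 hR]; exact isCompact_empty
  set S : Set ℝ := {r | IsCompact (Metric.closedBall x r)} with hS
  have hdown : ∀ r ∈ S, ∀ r' ≤ r, r' ∈ S := fun r hr r' hr' ↦
    IsCompact.of_isClosed_subset hr Metric.isClosed_closedBall (Metric.closedBall_subset_closedBall hr')
  suffices hsub : Icc 0 R ⊆ S from hsub ⟨hR, le_rfl⟩
  -- Continuous induction on the radius. For closedness, a finite net of a slightly smaller compact
  -- ball serves the limiting ball. For openness to the right, a compact ball has a compact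
  -- thickening, which contains a larger ball.
  refine IsClosed.Icc_subset_of_forall_exists_gt ?_ ?_ ?_
  · refine isClosed_of_closure_subset fun r hr ↦ ?_
    have hrI : r ∈ Icc 0 R := by
      have := closure_mono inter_subset_right hr
      rwa [isClosed_Icc.closure_eq] at this
    refine ⟨?_, hrI⟩
    refine isCompact_iff_totallyBounded_isComplete.2
      ⟨?_, Metric.isClosed_closedBall.isComplete⟩
    rw [Metric.totallyBounded_iff]
    intro ε hε
    obtain ⟨r', hr', hd⟩ := Metric.mem_closure_iff.1 hr (ε / 4) (by positivity)
    have hr'r : r - ε / 4 < r' := by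
      rw [Real.dist_eq, abs_lt] at hd; linarith
    have hcomp : IsCompact (Metric.closedBall x r') := hr'.1
    obtain ⟨t, ht, hcov⟩ := Metric.totallyBounded_iff.1 hcomp.totallyBounded (ε / 2) (by positivity)
    refine ⟨t, ht, fun y hy ↦ ?_⟩
    have hy' : dist x y ≤ r := by rw [dist_comm]; exact hy
    obtain ⟨z, hz1, hz2⟩ := h x y r' (ε / 2) hr'.2.1 (by positivity) (by linarith)
    have hz : z ∈ ⋃ w ∈ t, Metric.ball w (ε / 2) :=
      hcov (by rw [Metric.mem_closedBall, dist_comm]; exact hz1)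
    simp only [mem_iUnion, Metric.mem_ball, exists_prop] at hz ⊢
    obtain ⟨w, hw, hzw⟩ := hz
    refine ⟨w, hw, ?_⟩
    have := dist_triangle y z w
    rw [dist_comm y z] at this
    linarith
  · simp [hS]
  · rintro r ⟨hr, hr0⟩ r' hr'
    obtain ⟨δ, hδ, hδc⟩ := (hr : IsCompact _).exists_isCompact_cthickening
    have h1 : r + δ / 2 ∈ S := by
      refine IsCompact.of_isClosed_subset hδc Metric.isClosed_closedBall fun y hy ↦ ?_
      have hy' : dist x y ≤ r + δ / 2 := by rw [dist_comm]; exact hy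
      obtain ⟨z, hz1, hz2⟩ := h x y r δ hr0.1 hδ (by linarith)
      exact Metric.mem_cthickening_of_dist_le y z δ _
        (by rw [Metric.mem_closedBall, dist_comm]; exact hz1) (by rw [dist_comm]; exact hz2.le)
    refine ⟨min (r + δ / 2) r', hdown _ h1 _ (min_le_left _ _), ?_, min_le_right _ _⟩
    exact lt_min (by linarith) hr'

variable {m : ℕ} {M : Type*} [MetricSpace M] [ChartedSpace (EuclideanSpace ℝ (Fin m)) M]
  [RiemannianBundle (fun x : M ↦ TangentSpace (𝓡 m) x)]

variable (m) in
-- Cut a path of length less than r + s at a time when its distance from x equals r: the initial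
-- piece has length at least r, so less than s is left for the rest.
theorem exists_dist_le_of_dist_lt_add [IsRiemannianManifold (𝓡 m) M] (x y : M) {r s : ℝ}
    (hr : 0 ≤ r) (hs : 0 < s) (hxy : dist x y < r + s) :
    ∃ z, dist x z ≤ r ∧ dist z y < s := by
  rcases le_or_gt (dist x y) r with hle | hlt
  · exact ⟨y, hle, by simpa using hs⟩
  have h1 : riemannianEDist (𝓡 m) x y < ENNReal.ofReal (r + s) := by
    rw [← IsRiemannianManifold.out (I := 𝓡 m), edist_dist]
    exact (ENNReal.ofReal_lt_ofReal_iff (by linarith)).2 hxy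
  obtain ⟨γ, hγ0, hγ1, hγ, hlen⟩ := exists_lt_of_riemannianEDist_lt h1
  have hcont : ContinuousOn (fun t ↦ dist x (γ t)) (Icc 0 1) :=
    (continuous_const.dist continuous_id).comp_continuousOn hγ.continuousOn
  obtain ⟨t, ht, htr⟩ : r ∈ (fun t ↦ dist x (γ t)) '' Icc 0 1 := by
    refine intermediate_value_Icc zero_le_one hcont ⟨?_, ?_⟩
    · simpa [hγ0] using hr
    · simpa [hγ1] using hlt.le
  replace htr : dist x (γ t) = r := htr
  refine ⟨γ t, htr.le, ?_⟩
  have h2 : edist x (γ t) ≤ pathELength (𝓡 m) γ 0 t := by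
    rw [IsRiemannianManifold.out (I := 𝓡 m)]
    exact riemannianEDist_le_pathELength (hγ.mono (Icc_subset_Icc_right ht.2)) hγ0 rfl ht.1
  have h3 : edist (γ t) y ≤ pathELength (𝓡 m) γ t 1 := by
    rw [IsRiemannianManifold.out (I := 𝓡 m)]
    exact riemannianEDist_le_pathELength (hγ.mono (Icc_subset_Icc_left ht.1)) rfl hγ1 ht.2
  rw [← pathELength_add ht.1 ht.2] at hlen
  have h4 := (add_le_add h2 h3).trans_lt hlen
  rw [edist_dist x, htr, edist_dist, ← ENNReal.ofReal_add hr dist_nonneg,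
    ENNReal.ofReal_lt_ofReal_iff (by linarith)] at h4
  linarith

variable (m) in
/-- The Hopf–Rinow theorem: a complete Riemannian manifold is proper. -/
theorem properSpace_of_isRiemannianManifold [IsRiemannianManifold (𝓡 m) M] [CompleteSpace M] :
    ProperSpace M := by
  have : LocallyCompactSpace M := ChartedSpace.locallyCompactSpace (EuclideanSpace ℝ (Fin m)) M
  exact properSpace_of_exists_dist_le fun x y r s hr hs hxy ↦
    exists_dist_le_of_dist_lt_add m x y hr hs hxy

end HopfRinow

/-! ### The gradient of a function and its local slope -/

section Gradient

variable {m : ℕ} {M : Type*} [MetricSpace M] [ChartedSpace (EuclideanSpace ℝ (Fin m)) M]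

theorem finiteDimensional_tangentSpace (x : M) : FiniteDimensional ℝ (TangentSpace (𝓡 m) x) :=
  inferInstanceAs (FiniteDimensional ℝ (EuclideanSpace ℝ (Fin m)))

variable {ψ : OpenPartialHomeomorph M (EuclideanSpace ℝ (Fin m))}

/-- The derivative of ψ is a left inverse, and the dimensions agree. Hence a tangent vector is
determined by its products with chart vectors. -/
theorem surjective_chartVector (hψ : ψ ∈ smoothCharts m M) {y : EuclideanSpace ℝ (Fin m)}
    (hy : y ∈ ψ.target) : Function.Surjective (chartVector ψ y) := by
  have hsrc : ψ.symm y ∈ ψ.source := ψ.map_target hy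
  have hd1 : MDifferentiableAt (𝓡 m) (𝓡 m) ψ.symm y :=
    (contMDiffAt_symm_of_mem_maximalAtlas hψ hy).mdifferentiableAt (by simp)
  have hd2 : MDifferentiableAt (𝓡 m) (𝓡 m) ψ (ψ.symm y) :=
    (contMDiffAt_of_mem_maximalAtlas hψ hsrc).mdifferentiableAt (by simp)
  have h1 := mfderiv_comp y hd2 hd1
  have h2 : mfderiv (𝓡 m) (𝓡 m) (ψ ∘ ψ.symm) y = mfderiv (𝓡 m) (𝓡 m) id y := by
    refine Filter.EventuallyEq.mfderiv_eq ?_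
    filter_upwards [ψ.open_target.mem_nhds hy] with z hz
    simp [ψ.right_inv hz]
  rw [mfderiv_id] at h2
  have hinj : Function.Injective (mfderiv (𝓡 m) (𝓡 m) ψ.symm y) := by
    refine Function.LeftInverse.injective (g := mfderiv (𝓡 m) (𝓡 m) ψ (ψ.symm y)) fun v ↦ ?_
    exact congr($(h1.symm.trans h2) v)
  have := finiteDimensional_tangentSpace (m := m) (ψ.symm y)
  have := finiteDimensional_tangentSpace (m := m) y
  exact (LinearMap.injective_iff_surjective_of_finrank_eq_finrank
    (f := (mfderiv (𝓡 m) (𝓡 m) ψ.symm y : EuclideanSpace ℝ (Fin m) →L[ℝ]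
      TangentSpace (𝓡 m) (ψ.symm y)).toLinearMap) rfl).1 hinj

variable [RiemannianBundle (fun x : M ↦ TangentSpace (𝓡 m) x)]

/-- The Riemannian gradient of a function (zero where it is not differentiable). -/
noncomputable def gradient (m : ℕ) {M : Type*} [MetricSpace M]
    [ChartedSpace (EuclideanSpace ℝ (Fin m)) M]
    [RiemannianBundle (fun x : M ↦ TangentSpace (𝓡 m) x)] (ζ : M → ℝ) (x : M) :
    TangentSpace (𝓡 m) x :=
  have := finiteDimensional_tangentSpace (m := m) x
  have : CompleteSpace (TangentSpace (𝓡 m) x) := FiniteDimensional.complete ℝ _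
  (InnerProductSpace.toDual ℝ (TangentSpace (𝓡 m) x)).symm
    (mfderiv (𝓡 m) 𝓘(ℝ, ℝ) ζ x : TangentSpace (𝓡 m) x →L[ℝ] ℝ)

theorem inner_gradient (ζ : M → ℝ) (x : M) (v : TangentSpace (𝓡 m) x) :
    ⟪gradient m ζ x, v⟫ = (mfderiv (𝓡 m) 𝓘(ℝ, ℝ) ζ x : TangentSpace (𝓡 m) x →L[ℝ] ℝ) v := by
  have := finiteDimensional_tangentSpace (m := m) x
  have : CompleteSpace (TangentSpace (𝓡 m) x) := FiniteDimensional.complete ℝ _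
  exact InnerProductSpace.toDual_symm_apply

/-- Differentiability on M and in the chart are equivalent, so at bad points both sides are 0. The
identity therefore holds at every point, with no exceptional null set to transport. -/
theorem inner_gradient_chartVector (hψ : ψ ∈ smoothCharts m M) (ζ : M → ℝ)
    {y : EuclideanSpace ℝ (Fin m)} (hy : y ∈ ψ.target) (v : EuclideanSpace ℝ (Fin m)) :
    ⟪gradient m ζ (ψ.symm y), chartVector ψ y v⟫ = fderiv ℝ (fun z ↦ ζ (ψ.symm z)) y v := by
  rw [inner_gradient]
  have hd1 : MDifferentiableAt (𝓡 m) (𝓡 m) ψ.symm y :=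
    (contMDiffAt_symm_of_mem_maximalAtlas hψ hy).mdifferentiableAt (by simp)
  by_cases hζ : MDifferentiableAt (𝓡 m) 𝓘(ℝ, ℝ) ζ (ψ.symm y)
  · have h1 := mfderiv_comp y hζ hd1
    rw [mfderiv_eq_fderiv] at h1
    exact congr($h1 v).symm
  · have h2 : ¬ DifferentiableAt ℝ (fun z ↦ ζ (ψ.symm z)) y := by
      intro hd
      apply hζ
      have hsrc : ψ.symm y ∈ ψ.source := ψ.map_target hy
      have hd2 : MDifferentiableAt (𝓡 m) (𝓡 m) ψ (ψ.symm y) :=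
        (contMDiffAt_of_mem_maximalAtlas hψ hsrc).mdifferentiableAt (by simp)
      have hd3 : MDifferentiableAt (𝓡 m) 𝓘(ℝ, ℝ) (fun z ↦ ζ (ψ.symm z)) (ψ (ψ.symm y)) := by
        rw [ψ.right_inv hy]; exact hd.mdifferentiableAt
      refine (hd3.comp _ hd2).congr_of_eventuallyEq ?_
      filter_upwards [ψ.open_source.mem_nhds hsrc] with z hz
      simp [ψ.left_inv hz]
    rw [fderiv_zero_of_not_differentiableAt h2, mfderiv_zero_of_not_mdifferentiableAt hζ]
    rfl

variable [IsManifold (𝓡 m) ∞ M] [IsContMDiffRiemannianBundle (𝓡 m) ∞ (EuclideanSpace ℝ (Fin m))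
      (fun x : M ↦ TangentSpace (𝓡 m) x)] [IsRiemannianManifold (𝓡 m) M]

/-- The norm of the gradient is at most the local slope. -/
theorem norm_gradient_le {ζ : M → ℝ} {x : M} {L : ℝ} (hL : 0 ≤ L)
    (hζ : ∀ ε > 0, ∀ᶠ z in 𝓝 x, |ζ z - ζ x| ≤ (L + ε) * dist x z) :
    ‖gradient m ζ x‖ ≤ L := by
  obtain ⟨ψ, hψ, y, hy, rfl⟩ : ∃ ψ ∈ smoothCharts m M, ∃ y ∈ ψ.target, ψ.symm y = x :=
    ⟨chartAt _ x, IsManifold.chart_mem_maximalAtlas x, chartAt _ x x,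
      mem_chart_target _ x, (chartAt _ x).left_inv (mem_chart_source _ x)⟩
  by_cases hd : DifferentiableAt ℝ (fun z ↦ ζ (ψ.symm z)) y
  swap
  · have h0 : ∀ w, ⟪gradient m ζ (ψ.symm y), w⟫ = 0 := by
      intro w
      obtain ⟨v, rfl⟩ := surjective_chartVector hψ hy w
      rw [inner_gradient_chartVector hψ ζ hy, fderiv_zero_of_not_differentiableAt hd]
      rfl
    have : gradient m ζ (ψ.symm y) = 0 := inner_self_eq_zero.1 (h0 _)
    rw [this, norm_zero]; exact hL
  -- Differentiate in the direction of the gradient w itself: the derivative is ‖w‖², while slope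
  -- and distance estimates bound it by L‖w‖.
  obtain ⟨v, hv⟩ := surjective_chartVector hψ hy (gradient m ζ (ψ.symm y))
  set w := gradient m ζ (ψ.symm y) with hw
  have h1 : fderiv ℝ (fun z ↦ ζ (ψ.symm z)) y v = ‖w‖ ^ 2 := by
    rw [← inner_gradient_chartVector hψ ζ hy, hv, real_inner_self_eq_norm_sq]
  have hline : Tendsto (fun t : ℝ ↦ t⁻¹ • (ζ (ψ.symm (y + t • v)) - ζ (ψ.symm y)))
      (𝓝[>] 0) (𝓝 (‖w‖ ^ 2)) := by
    have := (hd.hasFDerivAt.hasLineDerivAt v).tendsto_slope_zero_right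
    rwa [h1] at this
  have hcurve : Tendsto (fun t : ℝ ↦ ψ.symm (y + t • v)) (𝓝[>] 0) (𝓝 (ψ.symm y)) := by
    have h2 : Tendsto (fun t : ℝ ↦ y + t • v) (𝓝 0) (𝓝 y) := by
      have : Continuous fun t : ℝ ↦ y + t • v := by fun_prop
      simpa using this.tendsto 0
    have h3 : ContinuousAt ψ.symm y := ψ.continuousAt_symm hy
    exact (h3.tendsto.comp h2).mono_left nhdsWithin_le_nhds
  have key : ∀ ε > 0, ‖w‖ ^ 2 ≤ (L + ε) * (‖w‖ + ε) := by
    intro ε hε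
    refine le_of_tendsto hline ?_
    filter_upwards [hcurve.eventually (hζ ε hε), eventually_dist_chart_symm_le hψ hy v hε,
      self_mem_nhdsWithin] with t ht1 ht2 ht0
    have ht0' : 0 < t := ht0
    rw [hv] at ht2
    rw [smul_eq_mul, inv_mul_le_iff₀ ht0']
    calc _ ≤ |ζ (ψ.symm (y + t • v)) - ζ (ψ.symm y)| := le_abs_self _
      _ ≤ (L + ε) * (t * (‖w‖ + ε)) := ht1.trans (by gcongr)
      _ = _ := by ring
  have hlim : ‖w‖ ^ 2 ≤ L * ‖w‖ := by
    have hc : Tendsto (fun ε : ℝ ↦ (L + ε) * (‖w‖ + ε)) (𝓝[>] 0) (𝓝 (L * ‖w‖)) := by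
      have : Continuous fun ε : ℝ ↦ (L + ε) * (‖w‖ + ε) := by fun_prop
      have := this.tendsto 0
      simp only [add_zero] at this
      exact this.mono_left nhdsWithin_le_nhds
    refine ge_of_tendsto hc ?_
    filter_upwards [self_mem_nhdsWithin] with ε hε using key ε hε
  rcases (norm_nonneg w).eq_or_lt with h | h
  · rw [← h]; exact hL
  · nlinarith

end Gradient

end

section

/-! ### Null sets of the Riemannian volume and measurability of Sobolev functions -/

section Volume

variable {m : ℕ} {M : Type*} [MetricSpace M] [ChartedSpace (EuclideanSpace ℝ (Fin m)) M]
  [RiemannianBundle (fun x : M ↦ TangentSpace (𝓡 m) x)] [MeasurableSpace M]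

/-- The supremum runs over a possibly uncountable family, so nullness does not follow termwise. The
measure equal to ∞ times counting measure off N is an upper bound of all chart volumes and vanishes
on N. -/
theorem vol_eq_zero_of_forall_chartVolume_eq_zero {N : Set M} (hN : MeasurableSet N)
    (h : ∀ ψ ∈ smoothCharts m M, chartVolume ψ N = 0) : vol m M N = 0 := by
  have hle : vol m M ≤ (∞ : ℝ≥0∞) • Measure.count.restrict Nᶜ := by
    refine iSup₂_le fun ψ hψ ↦ Measure.le_iff.2 fun s hs ↦ ?_
    rcases (s ∩ Nᶜ).eq_empty_or_nonempty with h0 | h0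
    · have : s ⊆ N := by
        intro x hx
        by_contra hxN
        exact (h0 ▸ (⟨hx, hxN⟩ : x ∈ s ∩ Nᶜ) : x ∈ (∅ : Set M))
      rw [measure_mono_null this (h ψ hψ)]
      exact zero_le
    · rw [Measure.smul_apply, Measure.restrict_apply hs, smul_eq_mul,
        ENNReal.top_mul (Measure.count_ne_zero h0)]
      exact le_top
  refine le_antisymm ((hle N).trans ?_) zero_le
  simp [Measure.restrict_apply hN]

variable [BorelSpace M]

theorem chartVolume_eq_zero {ψ : OpenPartialHomeomorph M (EuclideanSpace ℝ (Fin m))} {N : Set M}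
    (hN : MeasurableSet N) (h : volume (ψ.target ∩ ψ.symm ⁻¹' N) = 0) : chartVolume ψ N = 0 := by
  have hm : AEMeasurable ψ.symm (volume.restrict ψ.target) :=
    ψ.continuousOn_symm.aemeasurable ψ.open_target.measurableSet
  have hac : (volume.restrict ψ.target).withDensity
      (fun y ↦ ENNReal.ofReal (chartDensity ψ y)) ≪ volume.restrict ψ.target :=
    withDensity_absolutelyContinuous _ _
  rw [chartVolume, Measure.map_apply_of_aemeasurable (hm.mono_ac hac) hN]
  refine hac ?_
  rw [Measure.restrict_apply' ψ.open_target.measurableSet, inter_comm]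
  exact h

/-- The preimage under a chart of a Lebesgue null set is a null set. -/
theorem vol_chart_preimage_eq_zero {φ : OpenPartialHomeomorph M (EuclideanSpace ℝ (Fin m))}
    (hφ : φ ∈ smoothCharts m M) {Z : Set (EuclideanSpace ℝ (Fin m))} (hZ : MeasurableSet Z)
    (hZ0 : volume Z = 0) : vol m M (φ.source ∩ φ ⁻¹' Z) = 0 := by
  have hN : MeasurableSet (φ.source ∩ φ ⁻¹' Z) := by
    have h1 : Measurable (φ.source.domRestrict φ) := φ.continuousOn.domRestrict.measurable
    have := φ.open_source.measurableSet.subtype_image (h1 hZ)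
    convert this using 1
    ext x
    simp only [mem_inter_iff, mem_preimage, mem_image, Subtype.exists, exists_and_right,
      exists_eq_right]
    exact ⟨fun h ↦ ⟨h.1, h.2⟩, fun ⟨h1, h2⟩ ↦ ⟨h1, h2⟩⟩
  refine vol_eq_zero_of_forall_chartVolume_eq_zero hN fun ψ hψ ↦ chartVolume_eq_zero hN ?_
  -- Seen in another chart ψ, the set lies in the image of Z under a transition map, and
  -- differentiable maps send Lebesgue null sets to null sets.
  have hd : DifferentiableOn ℝ (ψ ∘ φ.symm) (Z ∩ (φ.target ∩ φ.symm ⁻¹' ψ.source)) := by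
    have h1 : ContMDiffOn (𝓡 m) (𝓡 m) ∞ φ.symm φ.target := contMDiffOn_symm_of_mem_maximalAtlas hφ
    have h2 : ContMDiffOn (𝓡 m) (𝓡 m) ∞ ψ ψ.source := contMDiffOn_of_mem_maximalAtlas hψ
    have h3 := h2.comp' h1
    have h4 : ContDiffOn ℝ ∞ (ψ ∘ φ.symm) (φ.target ∩ φ.symm ⁻¹' ψ.source) :=
      contMDiffOn_iff_contDiffOn.1 h3
    exact (h4.differentiableOn (by simp)).mono inter_subset_right
  refine measure_mono_null ?_ (addHaar_image_eq_zero_of_differentiableOn_of_addHaar_eq_zero volume hd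
    (measure_mono_null inter_subset_left hZ0))
  rintro y ⟨hy, hy1, hy2⟩
  refine ⟨φ (ψ.symm y), ⟨hy2, φ.map_source hy1, ?_⟩, ?_⟩
  · rw [mem_preimage, φ.left_inv hy1]; exact ψ.map_target hy
  · simp only [Function.comp_apply]; rw [φ.left_inv hy1, ψ.right_inv hy]

/-- Measurability is local and known in each chart up to a Lebesgue null set; such sets pull back to
null sets, and countably many charts cover M. -/
theorem IsSobolevLoc.aemeasurable [IsManifold (𝓡 m) ∞ M] [SecondCountableTopology M] {p : ℝ}
    (hp : 1 ≤ p) {u : M → ℝ} {X : (x : M) → TangentSpace (𝓡 m) x} (hu : IsSobolevLoc p u X) :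
    AEMeasurable u (vol m M) := by
  have hchart : ∀ φ ∈ smoothCharts m M, AEMeasurable u ((vol m M).restrict φ.source) := by
    intro φ hφ
    have h1 : AEStronglyMeasurable (fun y ↦ u (φ.symm y)) (volume.restrict φ.target) := by
      refine LocallyIntegrableOn.aestronglyMeasurable ?_
      rw [locallyIntegrableOn_iff φ.open_target.isLocallyClosed]
      exact fun K hK hKc ↦ integrableOn_of_memLp_restrict hp hKc ((hu φ hφ).memLp K hK hKc)
    obtain ⟨v, hv, hvae⟩ := h1.aemeasurable
    rw [EventuallyEq, ae_restrict_iff' φ.open_target.measurableSet] at hvae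
    set Z := toMeasurable volume {y | ¬ (y ∈ φ.target → u (φ.symm y) = v y)} with hZ
    have hZ0 : volume Z = 0 := by rw [hZ, measure_toMeasurable]; exact hvae
    have hφm : AEMeasurable φ ((vol m M).restrict φ.source) :=
      φ.continuousOn.aemeasurable φ.open_source.measurableSet
    refine (hv.comp_aemeasurable hφm).congr ?_
    rw [EventuallyEq, ae_restrict_iff' φ.open_source.measurableSet]
    refine measure_mono_null ?_
      (vol_chart_preimage_eq_zero hφ (measurableSet_toMeasurable _ _) hZ0)
    intro x hx
    simp only [mem_compl_iff, mem_ofPred_eq, Classical.not_imp, Function.comp_apply] at hx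
    refine ⟨hx.1, subset_toMeasurable _ _ ?_⟩
    simp only [mem_ofPred_eq, Classical.not_imp, φ.left_inv hx.1]
    exact ⟨φ.map_source hx.1, fun h ↦ hx.2 h.symm⟩
  obtain ⟨s, hs, hcov⟩ := TopologicalSpace.countable_cover_nhds
    (fun x : M ↦ chart_source_mem_nhds (EuclideanSpace ℝ (Fin m)) x)
  have : Countable s := hs.to_subtype
  rw [← Measure.restrict_univ (μ := vol m M), ← hcov, biUnion_eq_iUnion]
  exact aemeasurable_iUnion_iff.2 fun x ↦ hchart _ (IsManifold.chart_mem_maximalAtlas _)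

end Volume

end

section

/-! ### Truncated powers and Young's inequality -/

section Truncation

/-- A continuous cutoff, equal to `0` on `t ≤ 1 / N` and to `1` on `t ≥ 2 / N`. -/
noncomputable def lowCutoff (N t : ℝ) : ℝ := max 0 (min 1 (N * t - 1))

/-- The derivative of `truncPow`. -/
noncomputable def truncPowDeriv (β N t : ℝ) : ℝ :=
  β * lowCutoff N t * min ((max t N⁻¹) ^ (β - 1)) N

/-- A `C¹` approximation of `t ↦ (max t 0) ^ β` with bounded derivative. -/
noncomputable def truncPow (β N t : ℝ) : ℝ := ∫ s in (0 : ℝ)..t, truncPowDeriv β N s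

variable {β N : ℝ}

theorem lowCutoff_nonneg (N t : ℝ) : 0 ≤ lowCutoff N t := le_max_left _ _

theorem lowCutoff_le_one (N t : ℝ) : lowCutoff N t ≤ 1 :=
  max_le zero_le_one (min_le_left _ _)

theorem lowCutoff_eq_zero (hN : 0 < N) {t : ℝ} (ht : t ≤ N⁻¹) : lowCutoff N t = 0 := by
  refine max_eq_left ((min_le_right _ _).trans ?_)
  have := mul_le_mul_of_nonneg_left ht hN.le
  rw [mul_inv_cancel₀ hN.ne'] at this
  linarith

theorem lowCutoff_mono (hN : 0 < N) : Monotone (lowCutoff N) := fun s t hst ↦ by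
  unfold lowCutoff; gcongr

theorem continuous_truncPowDeriv (hN : 0 < N) : Continuous (truncPowDeriv β N) := by
  unfold truncPowDeriv lowCutoff
  have h1 : Continuous fun t : ℝ ↦ (max t N⁻¹) ^ (β - 1) :=
    (continuous_id.max continuous_const).rpow_const
      fun t ↦ Or.inl (lt_of_lt_of_le (inv_pos.2 hN) (le_max_right _ _)).ne'
  fun_prop

theorem truncPowDeriv_nonneg (hβ : 0 < β) (hN : 0 < N) (t : ℝ) : 0 ≤ truncPowDeriv β N t := by
  have : 0 < max t N⁻¹ := lt_of_lt_of_le (inv_pos.2 hN) (le_max_right _ _)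
  exact mul_nonneg (mul_nonneg hβ.le (lowCutoff_nonneg _ _)) (le_min (by positivity) hN.le)

theorem truncPowDeriv_le (hβ : 0 < β) (hN : 0 < N) (t : ℝ) : truncPowDeriv β N t ≤ β * N := by
  have h1 := lowCutoff_nonneg N t
  have h2 := lowCutoff_le_one N t
  calc truncPowDeriv β N t ≤ β * lowCutoff N t * N := by
        unfold truncPowDeriv; gcongr; exact min_le_right _ _
    _ ≤ β * 1 * N := by gcongr
    _ = β * N := by ring

theorem truncPowDeriv_eq_zero (hN : 0 < N) {t : ℝ} (ht : t ≤ 0) : truncPowDeriv β N t = 0 := by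
  rw [truncPowDeriv, lowCutoff_eq_zero hN (ht.trans (inv_pos.2 hN).le)]; ring

theorem hasDerivAt_truncPow (hN : 0 < N) (t : ℝ) :
    HasDerivAt (truncPow β N) (truncPowDeriv β N t) t :=
  ((continuous_truncPowDeriv hN).integral_hasStrictDerivAt 0 t).hasDerivAt

theorem truncPow_eq_zero (hN : 0 < N) {t : ℝ} (ht : t ≤ 0) : truncPow β N t = 0 := by
  unfold truncPow
  rw [intervalIntegral.integral_congr (g := fun _ ↦ 0), intervalIntegral.integral_zero]
  intro s hs
  rw [uIcc_of_ge ht] at hs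
  exact truncPowDeriv_eq_zero hN hs.2

theorem truncPow_nonneg (hβ : 0 < β) (hN : 0 < N) (t : ℝ) : 0 ≤ truncPow β N t := by
  rcases le_total t 0 with ht | ht
  · rw [truncPow_eq_zero hN ht]
  · exact intervalIntegral.integral_nonneg ht fun s _ ↦ truncPowDeriv_nonneg hβ hN s

/-- Evaluating the monotone cutoff at the upper endpoint lets it leave the integral over s. The
factor must survive in bounds for `truncPow`, because it is compared with the same factor in
`truncPowDeriv`. -/
theorem truncPowDeriv_le_of_le (hβ : 0 < β) (hN : 0 < N) {s t : ℝ} (hs : 0 < s) (hst : s ≤ t) :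
    truncPowDeriv β N s ≤ lowCutoff N t * (β * s ^ (β - 1)) := by
  have h0 := lowCutoff_nonneg N t
  have h0' := lowCutoff_nonneg N s
  rcases le_total s N⁻¹ with h | h
  · rw [truncPowDeriv, lowCutoff_eq_zero hN h]
    have : 0 ≤ s ^ (β - 1) := by positivity
    simp only [mul_zero, zero_mul]; positivity
  · unfold truncPowDeriv
    rw [max_eq_left h]
    calc β * lowCutoff N s * min (s ^ (β - 1)) N ≤ β * lowCutoff N t * s ^ (β - 1) := by
          gcongr
          · exact lowCutoff_mono hN hst
          · exact min_le_left _ _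
      _ = _ := by ring

theorem integral_mul_rpow_sub_one (hβ : 0 < β) (t : ℝ) :
    ∫ s in (0 : ℝ)..t, β * s ^ (β - 1) = t ^ β := by
  rw [intervalIntegral.integral_const_mul, integral_rpow (Or.inl (by linarith))]
  rw [sub_add_cancel, Real.zero_rpow hβ.ne']
  field_simp
  ring

theorem truncPow_le_rpow (hβ : 0 < β) (hN : 0 < N) {t : ℝ} (ht : 0 ≤ t) :
    truncPow β N t ≤ lowCutoff N t * t ^ β := by
  rw [← integral_mul_rpow_sub_one hβ, ← intervalIntegral.integral_const_mul]
  refine intervalIntegral.integral_mono_on_of_le_Ioo ht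
    ((continuous_truncPowDeriv hN).intervalIntegrable _ _)
    (((intervalIntegral.intervalIntegrable_rpow' (by linarith)).const_mul _).const_mul _) ?_
  exact fun s hs ↦ truncPowDeriv_le_of_le hβ hN hs.1 hs.2.le

theorem truncPow_le_linear (hβ : 0 < β) (hN : 0 < N) {t : ℝ} (ht : 0 ≤ t) :
    truncPow β N t ≤ lowCutoff N t * (β * N) * t := by
  have : ∫ _ in (0 : ℝ)..t, lowCutoff N t * (β * N) = lowCutoff N t * (β * N) * t := by
    rw [intervalIntegral.integral_const, smul_eq_mul]; ring
  rw [← this]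
  refine intervalIntegral.integral_mono_on ht
    ((continuous_truncPowDeriv hN).intervalIntegrable _ _) (by simp) fun s hs ↦ ?_
  have h0 := lowCutoff_nonneg N t
  have h0' := lowCutoff_nonneg N s
  calc truncPowDeriv β N s ≤ β * lowCutoff N t * N := by
        unfold truncPowDeriv
        gcongr
        · exact lowCutoff_mono hN hs.2
        · exact min_le_right _ _
    _ = _ := by ring

/-- The function controlling `truncPow ^ p / truncPowDeriv ^ (p - 1)`. -/
noncomputable def truncBound (p β N t : ℝ) : ℝ :=
  if t ^ (β - 1) ≤ N then β ^ (1 - p) * t ^ (β + p - 1) else β * t ^ (β + p - 1)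

/-- Where the derivative is not capped, the cutoff enters as χ^p ≤ χ^(p-1) and the sharp constant
β^(1-p) appears. Where the cap N is active, only the linear bound is available and the constant is
β; for fixed t this case disappears as N grows. -/
theorem truncPow_rpow_le {p : ℝ} (hp : 1 < p) (hβ : 0 < β) (hN : 0 < N) {t : ℝ} (ht : 0 < t) :
    truncPow β N t ^ p ≤ truncBound p β N t * truncPowDeriv β N t ^ (p - 1) := by
  have hp1 : 0 < p - 1 := by linarith
  have hψ0 := truncPow_nonneg hβ hN t
  have hχ0 := lowCutoff_nonneg N t
  have hχ1 := lowCutoff_le_one N t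
  have hB : 0 ≤ truncBound p β N t := by unfold truncBound; split_ifs <;> positivity
  rcases hχ0.eq_or_lt with hχ | hχ
  · have h1 := truncPow_le_rpow hβ hN ht.le
    rw [← hχ, zero_mul] at h1
    rw [le_antisymm h1 hψ0, Real.zero_rpow (by linarith)]
    exact mul_nonneg hB (Real.rpow_nonneg (truncPowDeriv_nonneg hβ hN t) _)
  have htN : N⁻¹ ≤ t := by
    by_contra h
    exact hχ.ne' (lowCutoff_eq_zero hN (not_le.1 h).le)
  have hd : truncPowDeriv β N t = β * lowCutoff N t * min (t ^ (β - 1)) N := by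
    rw [truncPowDeriv, max_eq_left htN]
  unfold truncBound
  split_ifs with h
  · rw [hd, min_eq_left h]
    calc truncPow β N t ^ p ≤ (lowCutoff N t * t ^ β) ^ p := by
          gcongr; exact truncPow_le_rpow hβ hN ht.le
      _ = lowCutoff N t ^ p * t ^ (β * p) := by
          rw [Real.mul_rpow hχ0 (by positivity), ← Real.rpow_mul ht.le]
      _ ≤ lowCutoff N t ^ (p - 1) * t ^ (β * p) := by
          gcongr ?_ * _
          exact Real.rpow_le_rpow_of_exponent_ge hχ hχ1 (by linarith)
      _ = (β ^ (1 - p) * β ^ (p - 1)) * (lowCutoff N t ^ (p - 1) *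
            (t ^ (β + p - 1) * t ^ ((β - 1) * (p - 1)))) := by
          rw [← Real.rpow_add hβ, ← Real.rpow_add ht,
            show (1 - p) + (p - 1) = 0 by ring, Real.rpow_zero, one_mul,
            show β + p - 1 + (β - 1) * (p - 1) = β * p by ring]
      _ = _ := by
          rw [Real.mul_rpow (by positivity) (by positivity), Real.mul_rpow hβ.le hχ0,
            ← Real.rpow_mul ht.le]
          ring
  · rw [hd, min_eq_right (not_le.1 h).le]
    set D := β * lowCutoff N t * N with hD
    have hD0 : 0 < D := by positivity
    have hDb : D ≤ β * t ^ (β - 1) := by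
      calc D ≤ β * 1 * N := by rw [hD]; gcongr
        _ ≤ β * 1 * t ^ (β - 1) := by gcongr; exact (not_le.1 h).le
        _ = _ := by ring
    calc truncPow β N t ^ p ≤ (D * t) ^ p := by
          gcongr
          refine (truncPow_le_linear hβ hN ht.le).trans_eq ?_
          rw [hD]; ring
      _ = D * t ^ p * D ^ (p - 1) := by
          rw [Real.mul_rpow hD0.le ht.le, Real.rpow_sub_one hD0.ne']
          field_simp
      _ ≤ β * t ^ (β - 1) * t ^ p * D ^ (p - 1) := by gcongr
      _ = β * t ^ (β + p - 1) * D ^ (p - 1) := by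
          rw [mul_assoc β, ← Real.rpow_add ht, show β - 1 + p = β + p - 1 by ring]

theorem truncBound_nonneg {p : ℝ} (hβ : 0 < β) {t : ℝ} (ht : 0 ≤ t) :
    0 ≤ truncBound p β N t := by
  unfold truncBound; split_ifs <;> positivity

/-- The bound is uniform in N and serves only for domination; the sharp constant returns in the
pointwise limit. -/
theorem truncBound_le {p : ℝ} (hβ : 0 < β) {t : ℝ} (ht : 0 ≤ t) :
    truncBound p β N t ≤ (β ^ (1 - p) + β) * t ^ (β + p - 1) := by
  have h1 : 0 ≤ β ^ (1 - p) * t ^ (β + p - 1) := by positivity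
  have h2 : 0 ≤ β * t ^ (β + p - 1) := by positivity
  unfold truncBound; split_ifs <;> linarith

theorem measurable_truncBound (p β N : ℝ) : Measurable (truncBound p β N) := by
  unfold truncBound
  exact Measurable.ite (measurableSet_le (by fun_prop) measurable_const) (by fun_prop)
    (by fun_prop)

theorem tendsto_truncPow (hβ : 0 < β) {t : ℝ} (ht : 0 ≤ t) :
    Tendsto (fun n : ℕ ↦ truncPow β (n + 1) t) atTop (𝓝 (t ^ β)) := by
  rw [← integral_mul_rpow_sub_one hβ]
  refine intervalIntegral.tendsto_integral_filter_of_dominated_convergence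
    (fun s ↦ β * s ^ (β - 1)) ?_ ?_
    ((intervalIntegral.intervalIntegrable_rpow' (by linarith)).const_mul _) ?_
  · exact Eventually.of_forall fun n ↦
      (continuous_truncPowDeriv (by positivity)).aestronglyMeasurable
  · refine Eventually.of_forall fun n ↦ Eventually.of_forall fun s hs ↦ ?_
    rw [uIoc_of_le ht] at hs
    rw [Real.norm_of_nonneg (truncPowDeriv_nonneg hβ (by positivity) s)]
    have hs0 : 0 ≤ β * s ^ (β - 1) := by have := hs.1; positivity
    exact (truncPowDeriv_le_of_le hβ (by positivity) hs.1 hs.2).trans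
      (mul_le_of_le_one_left hs0 (lowCutoff_le_one _ _))
  · refine Eventually.of_forall fun s hs ↦ ?_
    rw [uIoc_of_le ht] at hs
    have hlarge : ∀ᶠ n : ℕ in atTop, max (2 / s) (s ^ (β - 1)) ≤ (n : ℝ) :=
      tendsto_natCast_atTop_atTop.eventually (eventually_ge_atTop _)
    refine tendsto_const_nhds.congr' ?_
    filter_upwards [hlarge] with n hn
    have h1 : 2 / s ≤ (n : ℝ) + 1 := by linarith [le_max_left (2 / s) (s ^ (β - 1))]
    have h2 : s ^ (β - 1) ≤ (n : ℝ) + 1 := by linarith [le_max_right (2 / s) (s ^ (β - 1))]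
    have hs0 := hs.1
    rw [div_le_iff₀ hs0] at h1
    have h3 : ((n : ℝ) + 1)⁻¹ ≤ s := by
      rw [inv_le_iff_one_le_mul₀ (by positivity)]; linarith
    rw [truncPowDeriv, max_eq_left h3, min_eq_left h2, lowCutoff, min_eq_left (by linarith),
      max_eq_right zero_le_one, mul_one]

theorem tendsto_truncBound (p β t : ℝ) :
    Tendsto (fun n : ℕ ↦ truncBound p β (n + 1) t) atTop
      (𝓝 (β ^ (1 - p) * t ^ (β + p - 1))) := by
  have hlarge : ∀ᶠ n : ℕ in atTop, t ^ (β - 1) ≤ (n : ℝ) :=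
    tendsto_natCast_atTop_atTop.eventually (eventually_ge_atTop _)
  refine tendsto_const_nhds.congr' ?_
  filter_upwards [hlarge] with n hn
  rw [truncBound, if_pos (by linarith)]

/-- Young's inequality, in the form used to absorb the gradient term. -/
theorem young_absorb {p k E ψ ψ' η g H : ℝ} (hp : 1 < p) (hk : 0 ≤ k) (hE : 0 ≤ E) (hψ : 0 ≤ ψ)
    (hψ' : 0 ≤ ψ') (hη : 0 ≤ η) (hg : 0 ≤ g) (hH : 0 ≤ H) (h : ψ ^ p ≤ H * ψ' ^ (p - 1)) :
    ψ * (k * E ^ ((p - 1) / p)) * (p * η ^ (p - 1) * g) ≤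
      ψ' * η ^ p * E + (p - 1) ^ (p - 1) * k ^ p * (H * g ^ p) := by
  have hp0 : 0 < p := by linarith
  have hp1 : 0 < p - 1 := by linarith
  have h1 : ψ ≤ H ^ (1 / p) * ψ' ^ ((p - 1) / p) := by
    have := Real.rpow_le_rpow (by positivity) h (by positivity : 0 ≤ 1 / p)
    rwa [← Real.rpow_mul hψ, mul_one_div_cancel hp0.ne', Real.rpow_one,
      Real.mul_rpow hH (by positivity), ← Real.rpow_mul hψ', mul_one_div] at this
  set z := ψ' * η ^ p * E with hz
  have hz0 : 0 ≤ z := by positivity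
  set c := k * g * H ^ (1 / p) with hc
  have hc0 : 0 ≤ c := by positivity
  have hzp : z ^ ((p - 1) / p) = ψ' ^ ((p - 1) / p) * η ^ (p - 1) * E ^ ((p - 1) / p) := by
    rw [hz, Real.mul_rpow (by positivity) hE, Real.mul_rpow hψ' (by positivity),
      ← Real.rpow_mul hη, mul_div_cancel₀ _ hp0.ne']
  have hcp : c ^ p = k ^ p * (H * g ^ p) := by
    rw [hc, Real.mul_rpow (by positivity) (by positivity), Real.mul_rpow hk hg,
      ← Real.rpow_mul hH, one_div_mul_cancel hp0.ne', Real.rpow_one]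
    ring
  have h2 : ψ * (k * E ^ ((p - 1) / p)) * (p * η ^ (p - 1) * g) ≤
      p * (c * z ^ ((p - 1) / p)) := by
    calc _ ≤ (H ^ (1 / p) * ψ' ^ ((p - 1) / p)) * (k * E ^ ((p - 1) / p)) *
          (p * η ^ (p - 1) * g) := by gcongr
      _ = _ := by rw [hzp, hc]; ring
  refine h2.trans ?_
  clear_value z c
  -- The two entries are scaled so that, after multiplication by p, the coefficient of z is exactly
  -- 1: the whole energy term is spent, which produces (p - 1)^(p - 1).
  have h3 := Real.geom_mean_le_arith_mean2_weighted (w₁ := (p - 1) / p) (w₂ := 1 / p)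
    (p₁ := z / (p - 1)) (p₂ := (p - 1) ^ (p - 1) * c ^ p) (by positivity) (by positivity)
    (by positivity) (by positivity) (by field_simp; ring)
  have h4 : (z / (p - 1)) ^ ((p - 1) / p) * ((p - 1) ^ (p - 1) * c ^ p) ^ (1 / p)
      = c * z ^ ((p - 1) / p) := by
    rw [Real.div_rpow hz0 hp1.le, Real.mul_rpow (by positivity) (by positivity),
      ← Real.rpow_mul hp1.le, ← Real.rpow_mul hc0, mul_one_div_cancel hp0.ne', Real.rpow_one,
      mul_one_div]
    have : (p - 1) ^ ((p - 1) / p) ≠ 0 := (Real.rpow_pos_of_pos hp1 _).ne'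
    field_simp
  rw [h4] at h3
  calc p * (c * z ^ ((p - 1) / p))
      ≤ p * ((p - 1) / p * (z / (p - 1)) + 1 / p * ((p - 1) ^ (p - 1) * c ^ p)) := by gcongr
    _ = z + (p - 1) ^ (p - 1) * c ^ p := by field_simp
    _ = _ := by rw [hcp]; ring

end Truncation

end

section

/-! ### Calculus of local slopes -/

section Slope

/-- The local slope of `f` at `x` is at most `L`. -/
def SlopeLE {α : Type*} [PseudoMetricSpace α] (f : α → ℝ) (x : α) (L : ℝ) : Prop :=
  ∀ ε > 0, ∀ᶠ z in 𝓝 x, |f z - f x| ≤ (L + ε) * dist x z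

variable {α : Type*} [PseudoMetricSpace α] {f f₁ f₂ : α → ℝ} {x : α} {L L₁ L₂ : ℝ}

theorem SlopeLE.mono (hf : SlopeLE f x L₁) (h : L₁ ≤ L₂) : SlopeLE f x L₂ := by
  intro ε hε
  filter_upwards [hf ε hε] with z hz
  exact hz.trans (by gcongr)

theorem SlopeLE.continuousAt (hf : SlopeLE f x L) : ContinuousAt f x := by
  rw [ContinuousAt, tendsto_iff_dist_tendsto_zero]
  have h1 : Tendsto (fun z ↦ (L + 1) * dist x z) (𝓝 x) (𝓝 0) := by
    have : Continuous fun z ↦ (L + 1) * dist x z := by fun_prop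
    simpa using this.tendsto x
  exact squeeze_zero' (Eventually.of_forall fun _ ↦ dist_nonneg) (hf 1 one_pos) h1

theorem slopeLE_of_eventuallyEq_const {c : ℝ} (hf : f =ᶠ[𝓝 x] fun _ ↦ c) : SlopeLE f x 0 := by
  intro ε hε
  filter_upwards [hf] with z hz
  rw [hz, hf.self_of_nhds, sub_self, abs_zero]
  have := dist_nonneg (x := x) (y := z)
  positivity

theorem slopeLE_of_lipschitzWith {K : ℝ≥0} (hf : LipschitzWith K f) : SlopeLE f x K := by
  intro ε hε
  filter_upwards with z
  have h1 := hf.dist_le_mul z x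
  rw [Real.dist_eq, dist_comm] at h1
  have := dist_nonneg (x := x) (y := z)
  nlinarith

theorem slopeLE_of_hasDerivAt {φ : ℝ → ℝ} {d t : ℝ} (h : HasDerivAt φ d t) :
    SlopeLE φ t |d| := by
  intro ε hε
  have h1 := (hasDerivAt_iff_isLittleO.1 h).def hε
  filter_upwards [h1] with z hz
  rw [Real.norm_eq_abs, Real.norm_eq_abs, smul_eq_mul] at hz
  rw [dist_comm, Real.dist_eq]
  calc |φ z - φ t| = |(φ z - φ t - (z - t) * d) + (z - t) * d| := by ring_nf
    _ ≤ |φ z - φ t - (z - t) * d| + |(z - t) * d| := abs_add_le _ _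
    _ ≤ ε * |z - t| + |z - t| * |d| := by rw [abs_mul]; gcongr
    _ = _ := by ring

/-- Combining slope bounds with margin δ gives an expression continuous in δ; a small δ brings it
within ε of the exact product, so no constant is lost. -/
theorem exists_pos_le_add {G : ℝ → ℝ} (hG : Continuous G) {ε : ℝ} (hε : 0 < ε) :
    ∃ δ > 0, G δ ≤ G 0 + ε := by
  have h1 : ∀ᶠ δ in 𝓝[>] (0 : ℝ), G δ ≤ G 0 + ε :=
    ((hG.tendsto 0).mono_left nhdsWithin_le_nhds).eventually (eventually_le_nhds (by linarith))
  obtain ⟨δ, h2, h3⟩ := (h1.and self_mem_nhdsWithin).exists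
  exact ⟨δ, h3, h2⟩

theorem SlopeLE.comp {φ : ℝ → ℝ} {D : ℝ} (hφ : SlopeLE φ (f x) D) (hD : 0 ≤ D)
    (hf : SlopeLE f x L) : SlopeLE (fun z ↦ φ (f z)) x (D * L) := by
  intro ε hε
  obtain ⟨δ, hδ, hδε⟩ := exists_pos_le_add (G := fun δ ↦ (D + δ) * (L + δ)) (by fun_prop) hε
  filter_upwards [hf δ hδ, hf.continuousAt.eventually (hφ δ hδ)] with z h1 h2
  rw [dist_comm, Real.dist_eq] at h2
  simp only [add_zero] at hδε
  calc |φ (f z) - φ (f x)| ≤ (D + δ) * |f z - f x| := h2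
    _ ≤ (D + δ) * ((L + δ) * dist x z) := by gcongr
    _ = ((D + δ) * (L + δ)) * dist x z := by ring
    _ ≤ _ := by gcongr

theorem SlopeLE.mul (h₁ : SlopeLE f₁ x L₁) (h₂ : SlopeLE f₂ x L₂) :
    SlopeLE (fun z ↦ f₁ z * f₂ z) x (|f₁ x| * L₂ + |f₂ x| * L₁) := by
  intro ε hε
  obtain ⟨δ, hδ, hδε⟩ := exists_pos_le_add
    (G := fun δ ↦ (|f₁ x| + δ) * (L₂ + δ) + |f₂ x| * (L₁ + δ)) (by fun_prop) hε
  have h3 : ∀ᶠ z in 𝓝 x, |f₁ z| ≤ |f₁ x| + δ :=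
    h₁.continuousAt.abs.eventually (eventually_le_nhds (by linarith))
  filter_upwards [h₁ δ hδ, h₂ δ hδ, h3] with z h1 h2 h3
  simp only [add_zero] at hδε
  calc |f₁ z * f₂ z - f₁ x * f₂ x| = |f₁ z * (f₂ z - f₂ x) + f₂ x * (f₁ z - f₁ x)| := by ring_nf
    _ ≤ |f₁ z| * |f₂ z - f₂ x| + |f₂ x| * |f₁ z - f₁ x| := by
        rw [← abs_mul, ← abs_mul]; exact abs_add_le _ _
    _ ≤ (|f₁ x| + δ) * ((L₂ + δ) * dist x z) + |f₂ x| * ((L₁ + δ) * dist x z) := by gcongr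
    _ = ((|f₁ x| + δ) * (L₂ + δ) + |f₂ x| * (L₁ + δ)) * dist x z := by ring
    _ ≤ _ := by gcongr

end Slope

/-! ### Caccioppoli and Hardy inequalities -/

section Hardy

variable {m : ℕ} {M : Type*} [MetricSpace M] [ChartedSpace (EuclideanSpace ℝ (Fin m)) M]
  [IsManifold (𝓡 m) ∞ M] [RiemannianBundle (fun x : M ↦ TangentSpace (𝓡 m) x)]
  [IsContMDiffRiemannianBundle (𝓡 m) ∞ (EuclideanSpace ℝ (Fin m))
      (fun x : M ↦ TangentSpace (𝓡 m) x)] [IsRiemannianManifold (𝓡 m) M]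
  [MeasurableSpace M]
  {p : ℝ} {u : M → ℝ} {X : (x : M) → TangentSpace (𝓡 m) x}

theorem locallyLipschitz_rpow_const (hp : 1 < p) : LocallyLipschitz fun t : ℝ ↦ t ^ p :=
  (Real.contDiff_rpow_const_of_le (n := 1) (by simpa using hp.le)).locallyLipschitz

/-- The bounded derivative of the truncation keeps the composition in W^{1,p}_loc for unbounded u,
its vanishing on t ≤ 0 confines it to {u > s₀}, and properness makes the support compact. -/
theorem isTestFunction_truncPow_mul [ProperSpace M] (hp : 1 < p) (hu : IsSobolevLoc p u X)
    {β N : ℝ} (hβ : 0 < β) (hN : 0 < N) (s₀ : ℝ) (x₀ : M) {h : ℝ → ℝ} (hh : LocallyLipschitz h)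
    (h0 : ∀ r, 0 ≤ h r) {R : ℝ} (hR : ∀ r, R ≤ r → h r = 0) :
    IsTestFunction p {x | s₀ < u x}
      (fun x ↦ truncPow β N (u x - s₀) * h (dist x x₀) ^ p)
      (fun x ↦ (truncPowDeriv β N (u x - s₀) * h (dist x x₀) ^ p) • X x +
        truncPow β N (u x - s₀) • gradient m (fun z ↦ h (dist z x₀) ^ p) x) := by
  have hp0 : p ≠ 0 := by linarith
  have hζ : LocallyLipschitz fun x : M ↦ h (dist x x₀) ^ p :=
    ((locallyLipschitz_rpow_const hp).comp hh).comp (LipschitzWith.dist_left x₀).locallyLipschitz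
  refine ⟨fun ψ hψ ↦ ?_, ?_, fun x ↦ ?_, Eventually.of_forall fun x hx ↦ ?_⟩
  · refine (hu ψ hψ).comp_mul hp.le ψ.open_target
      (F := fun t ↦ truncPow β N (t - s₀)) (F' := fun t ↦ truncPowDeriv β N (t - s₀))
      (C := ⟨β * N, by positivity⟩) (ζ := fun y ↦ h (dist (ψ.symm y) x₀) ^ p)
      (fun t ↦ ?_) ?_ (fun t ↦ ?_) ?_ (fun y _ ↦ rfl) (fun i y hy ↦ ?_)
    · exact (hasDerivAt_truncPow hN (t - s₀)).comp_sub_const t s₀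
    · exact (continuous_truncPowDeriv hN).comp (continuous_id.sub continuous_const)
    · rw [abs_of_nonneg (truncPowDeriv_nonneg hβ hN _)]
      exact truncPowDeriv_le hβ hN _
    · intro y hy
      obtain ⟨K₁, t₁, ht₁, hK₁⟩ := locallyLipschitzOn_chart_symm hψ hy
      obtain ⟨K₂, t₂, ht₂, hK₂⟩ := hζ (ψ.symm y)
      rw [ψ.open_target.nhdsWithin_eq hy] at ht₁ ⊢
      refine ⟨K₂ * K₁, t₁ ∩ ψ.symm ⁻¹' t₂,
        inter_mem ht₁ ((ψ.continuousAt_symm hy).preimage_mem_nhds ht₂), ?_⟩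
      exact hK₂.comp (hK₁.mono inter_subset_left) (fun z hz ↦ hz.2)
    · rw [inner_add_left, real_inner_smul_left, real_inner_smul_left, coordField,
        inner_gradient_chartVector hψ _ hy]
  · refine HasCompactSupport.intro (isCompact_closedBall x₀ R) fun x hx ↦ ?_
    rw [Metric.mem_closedBall, not_le] at hx
    rw [hR _ hx.le, Real.zero_rpow hp0, mul_zero]
  · exact mul_nonneg (truncPow_nonneg hβ hN _) (Real.rpow_nonneg (h0 _) _)
  · have hx' : u x - s₀ ≤ 0 := by
      have : ¬ s₀ < u x := hx
      linarith [not_lt.1 this]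
    rw [truncPow_eq_zero hN hx', truncPowDeriv_eq_zero hN hx']
    simp

/-- The Bochner integral is bounded below through a pointwise bound, without integrability. -/
theorem neg_integral_le_lintegral_of_le {α : Type*} [MeasurableSpace α] {μ : Measure α}
    {f G : α → ℝ} (h : ∀ x, - f x ≤ G x) :
    ((- ∫ x, f x ∂μ : ℝ) : EReal) ≤ ((∫⁻ x, ENNReal.ofReal (G x) ∂μ : ℝ≥0∞) : EReal) := by
  by_cases hf : Integrable f μ
  · have h1 : - ∫ x, f x ∂μ ≤ (∫⁻ x, ENNReal.ofReal (- f x) ∂μ).toReal := by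
      have h2 := integral_eq_lintegral_pos_part_sub_lintegral_neg_part hf.neg
      rw [integral_neg'] at h2
      rw [h2]
      exact sub_le_self _ ENNReal.toReal_nonneg
    have hfin : ∫⁻ x, ENNReal.ofReal (- f x) ∂μ ≠ ⊤ :=
      (hf.neg.lintegral_lt_top).ne
    calc ((- ∫ x, f x ∂μ : ℝ) : EReal)
        ≤ (((∫⁻ x, ENNReal.ofReal (- f x) ∂μ).toReal : ℝ) : EReal) := by exact_mod_cast h1
      _ = ((∫⁻ x, ENNReal.ofReal (- f x) ∂μ : ℝ≥0∞) : EReal) := EReal.coe_ennreal_toReal hfin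
      _ ≤ _ := by
        rw [EReal.coe_ennreal_le_coe_ennreal_iff]
        exact lintegral_mono fun x ↦ ENNReal.ofReal_le_ofReal (h x)
  -- A non-integrable integrand has integral 0 by convention, and the right side is nonnegative.
  · rw [integral_undef hf, neg_zero]
    exact EReal.coe_ennreal_nonneg _

/-- The Caccioppoli inequality for the truncated powers. -/
theorem lintegral_truncPow_le [ProperSpace M] (hp : 1 < p) {k : ℝ} (hk : 0 < k)
    {A : (x : M) → ℝ → TangentSpace (𝓡 m) x → TangentSpace (𝓡 m) x}
    (hA : IsWeaklyCoercive p k A) (hu : IsSobolevLoc p u X) {V : M → ℝ} (hV : ∀ x, 0 < V x)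
    {s₀ : ℝ} (hs₀ : 0 ≤ s₀)
    (hLu : WeakIneq p A u X (fun x ↦ ENNReal.ofReal (V x * u x ^ (p - 1))) s₀)
    {β N : ℝ} (hβ : 0 < β) (hN : 0 < N) (x₀ : M) {h g : ℝ → ℝ} (hh : LocallyLipschitz h)
    (h0 : ∀ r, 0 ≤ h r) (hg0 : ∀ r, 0 ≤ g r) (hg : ∀ r, SlopeLE h r (g r))
    {R : ℝ} (hR : ∀ r, R ≤ r → h r = 0) :
    ∫⁻ x, ENNReal.ofReal (V x * max (u x - s₀) 0 ^ (p - 1) * truncPow β N (max (u x - s₀) 0) *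
        h (dist x x₀) ^ p) ∂(vol m M) ≤
      ∫⁻ x, ENNReal.ofReal ((p - 1) ^ (p - 1) * k ^ p *
        (truncBound p β N (max (u x - s₀) 0) * g (dist x x₀) ^ p)) ∂(vol m M) := by
  have hp1 : 0 < p - 1 := by linarith
  have htest := isTestFunction_truncPow_mul hp hu hβ hN s₀ x₀ hh h0 hR
  have h1 := hLu _ _ htest
  have hmax : ∀ x, truncPow β N (max (u x - s₀) 0) = truncPow β N (u x - s₀) := by
    intro x
    rcases le_total (u x - s₀) 0 with hx | hx
    · rw [max_eq_right hx, truncPow_eq_zero hN hx, truncPow_eq_zero hN le_rfl]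
    · rw [max_eq_left hx]
  have hmax' : ∀ x, truncPowDeriv β N (max (u x - s₀) 0) = truncPowDeriv β N (u x - s₀) := by
    intro x
    rcases le_total (u x - s₀) 0 with hx | hx
    · rw [max_eq_right hx, truncPowDeriv_eq_zero hN hx, truncPowDeriv_eq_zero hN le_rfl]
    · rw [max_eq_left hx]
  rw [← EReal.coe_ennreal_le_coe_ennreal_iff]
  refine le_trans ?_ (h1.trans (neg_integral_le_lintegral_of_le fun x ↦ ?_))
  · rw [EReal.coe_ennreal_le_coe_ennreal_iff]
    refine lintegral_mono fun x ↦ ?_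
    have hφ0 : 0 ≤ truncPow β N (u x - s₀) * h (dist x x₀) ^ p :=
      mul_nonneg (truncPow_nonneg hβ hN _) (Real.rpow_nonneg (h0 _) _)
    rw [← ENNReal.ofReal_mul' hφ0]
    refine ENNReal.ofReal_le_ofReal ?_
    rw [hmax, mul_assoc]
    rcases le_total (u x - s₀) 0 with hx | hx
    · rw [truncPow_eq_zero hN hx]; simp
    -- Here s₀ ≥ 0 enters: 0 ≤ u - s₀ ≤ u allows u^(p-1) to be lowered to (u - s₀)^(p-1).
    · rw [max_eq_left hx]
      have := (hV x).le
      gcongr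
      linarith
  · set ζ : M → ℝ := fun z ↦ h (dist z x₀) ^ p
    set E := ⟪A x (u x) (X x), X x⟫ with hE
    have hE0 : 0 ≤ E := hA.nonneg x _ _
    have hη0 := h0 (dist x x₀)
    have hgrad : ‖gradient m ζ x‖ ≤ p * h (dist x x₀) ^ (p - 1) * g (dist x x₀) := by
      have hd : HasDerivAt (fun t : ℝ ↦ t ^ p) (p * h (dist x x₀) ^ (p - 1)) (h (dist x x₀)) :=
        Real.hasDerivAt_rpow_const (Or.inr hp.le)
      have hd0 : 0 ≤ p * h (dist x x₀) ^ (p - 1) := by positivity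
      have hs1 := slopeLE_of_hasDerivAt hd
      rw [abs_of_nonneg hd0] at hs1
      have hs2 : SlopeLE (fun z : M ↦ dist z x₀) x 1 := by
        simpa using slopeLE_of_lipschitzWith (LipschitzWith.dist_left x₀) (x := x)
      have hs3 : SlopeLE (fun z : M ↦ h (dist z x₀)) x (g (dist x x₀) * 1) :=
        SlopeLE.comp (f := fun z : M ↦ dist z x₀) (hg _) (hg0 _) hs2
      have hs4 : SlopeLE ζ x _ := SlopeLE.comp (f := fun z : M ↦ h (dist z x₀)) hs1 hd0 hs3
      rw [mul_one] at hs4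
      exact norm_gradient_le (mul_nonneg hd0 (hg0 _)) hs4
    rw [inner_add_right, real_inner_smul_right, real_inner_smul_right, ← hE]
    -- The energy term on the right cancels exactly against the part of ⟨A, ∇φ⟩ that contains ∇u.
    have hyoung : truncPow β N (u x - s₀) * (k * E ^ ((p - 1) / p)) *
        (p * h (dist x x₀) ^ (p - 1) * g (dist x x₀)) ≤
        truncPowDeriv β N (u x - s₀) * h (dist x x₀) ^ p * E +
        (p - 1) ^ (p - 1) * k ^ p * (truncBound p β N (max (u x - s₀) 0) *
          g (dist x x₀) ^ p) := by
      rw [← hmax, ← hmax']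
      refine young_absorb hp hk.le hE0 (truncPow_nonneg hβ hN _) (truncPowDeriv_nonneg hβ hN _) hη0
        (hg0 _) (truncBound_nonneg hβ (le_max_right _ _)) ?_
      rcases le_or_gt (u x - s₀) 0 with hx | hx
      · rw [max_eq_right hx, truncPow_eq_zero hN le_rfl, Real.zero_rpow (by linarith)]
        exact mul_nonneg (truncBound_nonneg hβ le_rfl)
          (Real.rpow_nonneg (truncPowDeriv_nonneg hβ hN _) _)
      · rw [max_eq_left hx.le]
        exact truncPow_rpow_le hp hβ hN hx
    have hinner : - ⟪A x (u x) (X x), gradient m ζ x⟫ ≤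
        (k * E ^ ((p - 1) / p)) * (p * h (dist x x₀) ^ (p - 1) * g (dist x x₀)) := by
      have h2 := abs_real_inner_le_norm (A x (u x) (X x)) (gradient m ζ x)
      refine (neg_le_abs _).trans (h2.trans ?_)
      exact mul_le_mul (hA.norm_le x _ _) hgrad (norm_nonneg _)
        (mul_nonneg hk.le (Real.rpow_nonneg hE0 _))
    have h3 := mul_le_mul_of_nonneg_left hinner (truncPow_nonneg hβ hN (u x - s₀))
    linarith

/-- A weighted Hardy inequality for radial functions. -/
theorem lintegral_rpow_le [ProperSpace M] [SecondCountableTopology M] [BorelSpace M]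
    (hp : 1 < p) {k : ℝ} (hk : 0 < k)
    {A : (x : M) → ℝ → TangentSpace (𝓡 m) x → TangentSpace (𝓡 m) x}
    (hA : IsWeaklyCoercive p k A) (hu : IsSobolevLoc p u X) {V : M → ℝ} (hVc : Continuous V)
    (hV : ∀ x, 0 < V x) {s₀ : ℝ} (hs₀ : 0 ≤ s₀)
    (hLu : WeakIneq p A u X (fun x ↦ ENNReal.ofReal (V x * u x ^ (p - 1))) s₀)
    {q : ℝ} (hq : p - 1 < q) (x₀ : M) {h g : ℝ → ℝ} (hh : LocallyLipschitz h)
    (h0 : ∀ r, 0 ≤ h r) (hg0 : ∀ r, 0 ≤ g r) (hg : ∀ r, SlopeLE h r (g r)) (hgm : Measurable g)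
    {R G : ℝ} (hR : ∀ r, R ≤ r → h r = 0) (hgR : ∀ r, R ≤ r → g r = 0) (hG : ∀ r, g r ≤ G)
    (hfin : ∫⁻ x in Metric.ball x₀ R, ENNReal.ofReal (max (u x - s₀) 0 ^ q) ∂(vol m M) ≠ ⊤) :
    ∫⁻ x, ENNReal.ofReal (V x * max (u x - s₀) 0 ^ q * h (dist x x₀) ^ p) ∂(vol m M) ≤
      ∫⁻ x, ENNReal.ofReal ((p - 1) ^ (p - 1) * k ^ p * (q - p + 1) ^ (1 - p) *
        max (u x - s₀) 0 ^ q * g (dist x x₀) ^ p) ∂(vol m M) := by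
  set β := q - p + 1 with hβdef
  have hβ : 0 < β := by linarith
  have hp0 : 0 < p := by linarith
  have hp1 : 0 < p - 1 := by linarith
  have hq0 : 0 < q := by linarith
  have hexp : β + p - 1 = q := by rw [hβdef]; ring
  have hum : AEMeasurable (fun x ↦ max (u x - s₀) 0) (vol m M) :=
    ((hu.aemeasurable hp.le).sub_const s₀).max aemeasurable_const
  have hdm : Measurable fun x : M ↦ dist x x₀ := by fun_prop
  have hw0 : ∀ x, 0 ≤ max (u x - s₀) 0 := fun x ↦ le_max_right _ _
  set K := (p - 1) ^ (p - 1) * k ^ p with hK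
  have hK0 : 0 < K := by positivity
  -- Fatou's lemma on the left
  have hleft : ∫⁻ x, ENNReal.ofReal (V x * max (u x - s₀) 0 ^ q * h (dist x x₀) ^ p) ∂(vol m M) ≤
      liminf (fun n : ℕ ↦ ∫⁻ x, ENNReal.ofReal (V x * max (u x - s₀) 0 ^ (p - 1) *
        truncPow β (n + 1) (max (u x - s₀) 0) * h (dist x x₀) ^ p) ∂(vol m M)) atTop := by
    refine le_trans (lintegral_mono fun x ↦ ?_) (lintegral_liminf_le' fun n ↦ ?_)
    · refine le_of_eq (Tendsto.liminf_eq ?_).symm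
      refine ENNReal.tendsto_ofReal (Tendsto.mul_const _ ?_)
      have h1 := ((tendsto_truncPow hβ (hw0 x)).const_mul (V x * max (u x - s₀) 0 ^ (p - 1)))
      convert h1 using 2
      rw [mul_assoc, ← Real.rpow_add_of_nonneg (hw0 x) hp1.le hβ.le]
      congr 2
      rw [hβdef]; ring
    · have hcont : Continuous (truncPow β ((n : ℝ) + 1)) :=
        continuous_iff_continuousAt.2 fun t ↦
          (hasDerivAt_truncPow (by positivity) t).continuousAt
      refine AEMeasurable.ennreal_ofReal ?_
      exact (((hVc.measurable.aemeasurable.mul (hum.pow_const _))).mul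
        (hcont.measurable.comp_aemeasurable hum)).mul
        ((hh.continuous.measurable.comp hdm).pow_const _).aemeasurable
  -- Dominated convergence on the right: g is bounded and vanishes outside the ball, where the
  -- integral of w^q is assumed finite.
  have hright : Tendsto (fun n : ℕ ↦ ∫⁻ x, ENNReal.ofReal (K *
      (truncBound p β (n + 1) (max (u x - s₀) 0) * g (dist x x₀) ^ p)) ∂(vol m M)) atTop
      (𝓝 (∫⁻ x, ENNReal.ofReal (K * β ^ (1 - p) * max (u x - s₀) 0 ^ q *
        g (dist x x₀) ^ p) ∂(vol m M))) := by
    refine tendsto_lintegral_of_dominated_convergence'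
      (fun x ↦ ENNReal.ofReal (K * (β ^ (1 - p) + β) * G ^ p) *
        (Metric.ball x₀ R).indicator (fun x ↦ ENNReal.ofReal (max (u x - s₀) 0 ^ q)) x)
      (fun n ↦ ?_) (fun n ↦ Eventually.of_forall fun x ↦ ?_) ?_
      (Eventually.of_forall fun x ↦ ?_)
    · refine AEMeasurable.ennreal_ofReal (AEMeasurable.const_mul ?_ _)
      exact ((measurable_truncBound p β _).comp_aemeasurable hum).mul
        ((hgm.comp hdm).pow_const _).aemeasurable
    · beta_reduce
      rcases lt_or_ge (dist x x₀) R with hx | hx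
      · rw [indicator_of_mem (show x ∈ Metric.ball x₀ R from hx),
          ← ENNReal.ofReal_mul' (Real.rpow_nonneg (hw0 x) _)]
        refine ENNReal.ofReal_le_ofReal ?_
        have h1 := truncBound_le (p := p) (N := (n : ℝ) + 1) hβ (hw0 x)
        rw [hexp] at h1
        have h2 : g (dist x x₀) ^ p ≤ G ^ p := Real.rpow_le_rpow (hg0 _) (hG _) hp0.le
        have h3 : 0 ≤ (β ^ (1 - p) + β) * max (u x - s₀) 0 ^ q :=
          mul_nonneg (by positivity) (Real.rpow_nonneg (hw0 x) _)
        calc K * (truncBound p β (n + 1) (max (u x - s₀) 0) * g (dist x x₀) ^ p)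
            ≤ K * ((β ^ (1 - p) + β) * max (u x - s₀) 0 ^ q * G ^ p) := by
              gcongr K * ?_
              exact mul_le_mul h1 h2 (Real.rpow_nonneg (hg0 _) _) h3
          _ = _ := by ring
      · rw [hgR _ hx, Real.zero_rpow hp0.ne']
        simp
    · rw [lintegral_const_mul' _ _ ENNReal.ofReal_ne_top,
        lintegral_indicator Metric.isOpen_ball.measurableSet]
      exact ENNReal.mul_ne_top ENNReal.ofReal_ne_top hfin
    · refine ENNReal.tendsto_ofReal ?_
      have h1 := ((tendsto_truncBound p β (max (u x - s₀) 0)).mul_const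
        (g (dist x x₀) ^ p)).const_mul K
      rw [hexp] at h1
      convert h1 using 2
      ring
  refine hleft.trans ?_
  rw [← hright.liminf_eq]
  refine liminf_le_liminf (Eventually.of_forall fun n ↦ ?_)
  exact lintegral_truncPow_le hp hk hA hu hV hs₀ hLu hβ (by positivity) x₀ hh h0 hg0 hg hR

end Hardy

end

section

/-! ### The radial test profile -/

section RadialProfile

/-- The decaying weight `exp (-c Φ)`, frozen below `R₀`. -/
noncomputable def decay (Φ : ℝ → ℝ) (c R₀ r : ℝ) : ℝ := Real.exp (-c * Φ (max r R₀))

/-- The cutoff equal to `1` on `r ≤ S` and to `0` on `r ≥ S + d`. -/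
noncomputable def highCutoff (S d r : ℝ) : ℝ := max 0 (min 1 ((S + d - r) / d))

/-- The slope of `decay * highCutoff`. -/
noncomputable def profileSlope (Φ : ℝ → ℝ) (σ c R₀ S d r : ℝ) : ℝ :=
  if r < R₀ then 0 else if r < S then c * r ^ (-σ) * decay Φ c R₀ r
  else if r ≤ S + d then decay Φ c R₀ r * (c * r ^ (-σ) + 1 / d) else 0

variable {Φ : ℝ → ℝ} {σ c R₀ S d : ℝ}

theorem decay_pos (Φ : ℝ → ℝ) (c R₀ r : ℝ) : 0 < decay Φ c R₀ r := Real.exp_pos _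

theorem highCutoff_nonneg (S d r : ℝ) : 0 ≤ highCutoff S d r := le_max_left _ _

theorem highCutoff_le_one (S d r : ℝ) : highCutoff S d r ≤ 1 :=
  max_le zero_le_one (min_le_left _ _)

theorem highCutoff_eq_one (hd : 0 < d) {r : ℝ} (hr : r ≤ S) : highCutoff S d r = 1 := by
  have : 1 ≤ (S + d - r) / d := by rw [le_div_iff₀ hd]; linarith
  rw [highCutoff, min_eq_left this, max_eq_right zero_le_one]

theorem highCutoff_eq_zero (hd : 0 < d) {r : ℝ} (hr : S + d ≤ r) : highCutoff S d r = 0 := by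
  have : (S + d - r) / d ≤ 0 := div_nonpos_of_nonpos_of_nonneg (by linarith) hd.le
  exact max_eq_left ((min_le_right _ _).trans this)

theorem lipschitzWith_highCutoff (S : ℝ) (hd : 0 < d) :
    LipschitzWith ⟨1 / d, by positivity⟩ (highCutoff S d) := by
  have h1 : LipschitzWith ⟨1 / d, by positivity⟩ fun r ↦ (S + d - r) / d := by
    refine LipschitzWith.of_dist_le_mul fun x y ↦ le_of_eq ?_
    rw [Real.dist_eq, Real.dist_eq,
      show (S + d - x) / d - (S + d - y) / d = (1 / d) * (-(x - y)) by ring, abs_mul, abs_neg,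
      abs_of_pos (by positivity : 0 < 1 / d)]
    rfl
  exact (h1.const_min 1).const_max 0

theorem decay_anti (hΦ : ∀ t, 0 < t → HasDerivAt Φ (t ^ (-σ)) t) (hc : 0 < c) (hR₀ : 1 ≤ R₀) :
    Antitone (decay Φ c R₀) := by
  intro r s hrs
  have hmono : MonotoneOn Φ (Ici R₀) := by
    refine monotoneOn_of_deriv_nonneg (convex_Ici R₀)
      (fun t ht ↦ (hΦ t (by linarith [mem_Ici.1 ht])).continuousAt.continuousWithinAt)
      (fun t ht ↦ ?_) (fun t ht ↦ ?_)
    all_goals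
      rw [interior_Ici, mem_Ioi] at ht
      have ht0 : 0 < t := by linarith
    · exact (hΦ t ht0).differentiableAt.differentiableWithinAt
    · rw [(hΦ t ht0).deriv]; positivity
  have := hmono (le_max_right r R₀) (le_max_right s R₀) (max_le_max_right R₀ hrs)
  unfold decay
  refine Real.exp_le_exp.2 ?_
  nlinarith

theorem hasDerivAt_exp_neg_mul (hΦ : ∀ t, 0 < t → HasDerivAt Φ (t ^ (-σ)) t) (c : ℝ) {t : ℝ}
    (ht : 0 < t) :
    HasDerivAt (fun t ↦ Real.exp (-c * Φ t)) (Real.exp (-c * Φ t) * (-c * t ^ (-σ))) t :=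
  ((hΦ t ht).const_mul (-c)).exp

theorem rpow_neg_le_one (hσ : 0 ≤ σ) {t : ℝ} (ht : 1 ≤ t) : t ^ (-σ) ≤ 1 :=
  Real.rpow_le_one_of_one_le_of_nonpos ht (by linarith)

theorem lipschitzWith_decay (hΦ : ∀ t, 0 < t → HasDerivAt Φ (t ^ (-σ)) t) (hσ : 0 ≤ σ)
    (hc : 0 < c) (hR₀ : 1 ≤ R₀) :
    LipschitzWith ⟨c * decay Φ c R₀ R₀, mul_nonneg hc.le (decay_pos _ _ _ _).le⟩
      (decay Φ c R₀) := by
  have h1 : LipschitzOnWith ⟨c * decay Φ c R₀ R₀, mul_nonneg hc.le (decay_pos _ _ _ _).le⟩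
      (fun t ↦ Real.exp (-c * Φ t)) (Ici R₀) := by
    refine (convex_Ici R₀).lipschitzOnWith_of_nnnorm_hasDerivWithin_le
      (fun t ht ↦ (hasDerivAt_exp_neg_mul hΦ c
        (by linarith [mem_Ici.1 ht])).hasDerivWithinAt) fun t ht ↦ ?_
    have ht1 : 1 ≤ t := hR₀.trans ht
    have ht0 : 0 < t := by linarith
    have h2 : Real.exp (-c * Φ t) ≤ decay Φ c R₀ R₀ := by
      have := decay_anti hΦ hc hR₀ (mem_Ici.1 ht)
      rwa [decay, max_eq_left (mem_Ici.1 ht)] at this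
    have h3 := rpow_neg_le_one hσ ht1
    have h4 := decay_pos Φ c R₀ R₀
    refine NNReal.coe_le_coe.1 ?_
    change |Real.exp (-c * Φ t) * (-c * t ^ (-σ))| ≤ c * decay Φ c R₀ R₀
    rw [abs_mul, abs_mul, abs_neg, abs_of_pos hc, abs_of_pos (Real.exp_pos _),
      abs_of_nonneg (by positivity)]
    calc Real.exp (-c * Φ t) * (c * t ^ (-σ)) ≤ decay Φ c R₀ R₀ * (c * 1) := by gcongr
      _ = c * decay Φ c R₀ R₀ := by ring
  have h2 : LipschitzWith 1 fun r : ℝ ↦ max r R₀ := LipschitzWith.id.max_const R₀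
  have h3 := h1.comp (h2.lipschitzOnWith (s := univ)) (fun r _ ↦ mem_Ici.2 (le_max_right _ _))
  exact (lipschitzOnWith_univ.1 h3).weaken (mul_one (M := ℝ≥0) _).le

theorem slopeLE_decay (hΦ : ∀ t, 0 < t → HasDerivAt Φ (t ^ (-σ)) t) (hc : 0 < c) (hR₀ : 1 ≤ R₀)
    {r : ℝ} (hr : R₀ ≤ r) : SlopeLE (decay Φ c R₀) r (c * r ^ (-σ) * decay Φ c R₀ r) := by
  have hr0 : 0 < r := by linarith
  have hmax : max r R₀ = r := max_eq_left hr
  have h1 := slopeLE_of_hasDerivAt (hasDerivAt_exp_neg_mul hΦ c hr0)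
  rw [← hmax] at h1
  have h2 : SlopeLE (fun s : ℝ ↦ max s R₀) r 1 := by
    simpa using slopeLE_of_lipschitzWith (LipschitzWith.id.max_const R₀) (x := r)
  have h3 := SlopeLE.comp (f := fun s : ℝ ↦ max s R₀) h1 (abs_nonneg _) h2
  rw [mul_one, hmax, abs_mul, abs_mul, abs_neg, abs_of_pos hc, abs_of_pos (Real.exp_pos _),
    abs_of_nonneg (by positivity : 0 ≤ r ^ (-σ))] at h3
  have h4 : c * r ^ (-σ) * decay Φ c R₀ r = Real.exp (-c * Φ r) * (c * r ^ (-σ)) := by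
    rw [decay, hmax]; ring
  rw [h4]
  exact h3

theorem profileSlope_nonneg (hc : 0 < c) (hR₀ : 1 ≤ R₀) (hd : 0 < d) (r : ℝ) :
    0 ≤ profileSlope Φ σ c R₀ S d r := by
  unfold profileSlope
  have h1 := decay_pos Φ c R₀ r
  split_ifs with h2 h3 h4
  · exact le_rfl
  all_goals try exact le_rfl
  all_goals
    have hr : 0 < r := by linarith
    positivity

/-- The bound must hold at every r, kinks included. This dictates the strict and non-strict
inequalities in `profileSlope`: at R₀, S and S + d the larger of the two adjacent formulas is used.
-/
theorem slopeLE_profile (hΦ : ∀ t, 0 < t → HasDerivAt Φ (t ^ (-σ)) t) (hc : 0 < c)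
    (hR₀ : 1 ≤ R₀) (hS : R₀ ≤ S) (hd : 0 < d) (r : ℝ) :
    SlopeLE (fun r ↦ decay Φ c R₀ r * highCutoff S d r) r (profileSlope Φ σ c R₀ S d r) := by
  have he := decay_pos Φ c R₀ r
  have hcut0 : r < S → SlopeLE (highCutoff S d) r 0 := fun h ↦ by
    refine slopeLE_of_eventuallyEq_const (c := 1) ?_
    filter_upwards [Iio_mem_nhds h] with s hs using highCutoff_eq_one hd (le_of_lt hs)
  unfold profileSlope
  split_ifs with h1 h2 h3
  · have h2 : SlopeLE (decay Φ c R₀) r 0 := by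
      refine slopeLE_of_eventuallyEq_const (c := decay Φ c R₀ R₀) ?_
      filter_upwards [Iio_mem_nhds h1] with s hs
      rw [decay, decay, max_eq_right (le_of_lt hs), max_self]
    have := h2.mul (hcut0 (by linarith))
    simpa using this
  · have := (slopeLE_decay hΦ hc hR₀ (not_lt.1 h1)).mul (hcut0 h2)
    rw [highCutoff_eq_one hd h2.le] at this
    simpa using this
  · have h4 : SlopeLE (highCutoff S d) r (1 / d) :=
      slopeLE_of_lipschitzWith (lipschitzWith_highCutoff S hd)
    have h5 := (slopeLE_decay hΦ hc hR₀ (not_lt.1 h1)).mul h4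
    refine h5.mono ?_
    rw [abs_of_pos he, abs_of_nonneg (highCutoff_nonneg _ _ _)]
    have hr : 0 < r := by linarith
    have h6 : highCutoff S d r * (c * r ^ (-σ) * decay Φ c R₀ r) ≤
        1 * (c * r ^ (-σ) * decay Φ c R₀ r) := by
      gcongr
      exact highCutoff_le_one _ _ _
    linarith
  · refine slopeLE_of_eventuallyEq_const (c := 0) ?_
    filter_upwards [Ioi_mem_nhds (not_le.1 h3)] with s hs
    rw [highCutoff_eq_zero hd (le_of_lt hs), mul_zero]

theorem measurable_profileSlope (hΦ : ∀ t, 0 < t → HasDerivAt Φ (t ^ (-σ)) t) (hσ : 0 ≤ σ)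
    (hc : 0 < c) (hR₀ : 1 ≤ R₀) : Measurable (profileSlope Φ σ c R₀ S d) := by
  have h1 : Measurable (decay Φ c R₀) :=
    (lipschitzWith_decay hΦ hσ hc hR₀).continuous.measurable
  unfold profileSlope
  refine Measurable.ite measurableSet_Iio measurable_const ?_
  refine Measurable.ite measurableSet_Iio (by fun_prop) ?_
  exact Measurable.ite measurableSet_Iic (by fun_prop) measurable_const

theorem profileSlope_le (hΦ : ∀ t, 0 < t → HasDerivAt Φ (t ^ (-σ)) t) (hσ : 0 ≤ σ) (hc : 0 < c)
    (hR₀ : 1 ≤ R₀) (hd : 0 < d) (r : ℝ) :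
    profileSlope Φ σ c R₀ S d r ≤ decay Φ c R₀ R₀ * (c + 1 / d) := by
  have h0 := decay_pos Φ c R₀ r
  have h0' := decay_pos Φ c R₀ R₀
  unfold profileSlope
  split_ifs with h1 h2 h3
  · positivity
  · have hr : R₀ ≤ r := not_lt.1 h1
    have h4 := decay_anti hΦ hc hR₀ hr
    have h5 := rpow_neg_le_one hσ (hR₀.trans hr)
    calc c * r ^ (-σ) * decay Φ c R₀ r ≤ c * 1 * decay Φ c R₀ R₀ := by gcongr
      _ ≤ decay Φ c R₀ R₀ * (c + 1 / d) := by
        have : 0 ≤ decay Φ c R₀ R₀ * (1 / d) := by positivity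
        linarith
  · have hr : R₀ ≤ r := not_lt.1 h1
    have h4 := decay_anti hΦ hc hR₀ hr
    have h5 := rpow_neg_le_one hσ (hR₀.trans hr)
    have : 0 ≤ r ^ (-σ) := Real.rpow_nonneg (by linarith) _
    calc decay Φ c R₀ r * (c * r ^ (-σ) + 1 / d) ≤ decay Φ c R₀ R₀ * (c * 1 + 1 / d) := by gcongr
      _ = _ := by ring
  · positivity

/-- Both the weight and r^(-σ) decrease, so their values at S control the annulus. This is the small
factor that the integral over the ball has to compensate. -/
theorem profileSlope_le_of_le (hΦ : ∀ t, 0 < t → HasDerivAt Φ (t ^ (-σ)) t) (hσ : 0 ≤ σ)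
    (hc : 0 < c) (hR₀ : 1 ≤ R₀) (hS : R₀ ≤ S) (hd : 0 < d) {r : ℝ} (hr : S ≤ r) :
    profileSlope Φ σ c R₀ S d r ≤ decay Φ c R₀ S * (c * S ^ (-σ) + 1 / d) := by
  have h0 := decay_pos Φ c R₀ r
  have h0' := decay_pos Φ c R₀ S
  have hS0 : 0 < S := by linarith
  have h4 := decay_anti hΦ hc hR₀ hr
  have h5 : r ^ (-σ) ≤ S ^ (-σ) := Real.rpow_le_rpow_of_nonpos hS0 hr (by linarith)
  unfold profileSlope
  rw [if_neg (by linarith), if_neg (by linarith)]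
  split_ifs
  · have : 0 ≤ r ^ (-σ) := Real.rpow_nonneg (by linarith) _
    gcongr
  · positivity

end RadialProfile

/-! ### The growth estimate over balls -/

section Growth

/-- A density that is positive on a non-null set has positive integral on some ball. -/
theorem exists_setLIntegral_ball_ne_zero {M : Type*} [MetricSpace M] [MeasurableSpace M]
    [BorelSpace M] {ν : Measure M} {u : M → ℝ} {s₀ : ℝ}
    (hs : (s₀ : EReal) < essSup (fun x ↦ (u x : EReal)) ν) {f : M → ℝ≥0∞}
    (hf : AEMeasurable f ν) (hpos : ∀ x, s₀ < u x → f x ≠ 0) (x₀ : M) :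
    ∃ R, ∫⁻ x in Metric.ball x₀ R, f x ∂ν ≠ 0 := by
  by_contra! hzero
  refine hs.not_ge (essSup_le_of_ae_le _ ?_)
  have h : ∀ n : ℕ, ∀ᵐ x ∂ν, x ∈ Metric.ball x₀ n → f x = 0 := fun n ↦ by
    have h1 := (lintegral_eq_zero_iff' hf.restrict).1 (hzero n)
    exact (ae_restrict_iff' Metric.isOpen_ball.measurableSet).1 h1
  filter_upwards [ae_all_iff.2 h] with x hx
  obtain ⟨n, hn⟩ := exists_nat_gt (dist x x₀)
  refine EReal.coe_le_coe_iff.2 (not_lt.1 fun hux ↦ hpos x hux (hx n hn))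

variable {m : ℕ} {M : Type*} [MetricSpace M] [ChartedSpace (EuclideanSpace ℝ (Fin m)) M]
  [IsManifold (𝓡 m) ∞ M] [RiemannianBundle (fun x : M ↦ TangentSpace (𝓡 m) x)]
  [IsContMDiffRiemannianBundle (𝓡 m) ∞ (EuclideanSpace ℝ (Fin m))
      (fun x : M ↦ TangentSpace (𝓡 m) x)] [IsRiemannianManifold (𝓡 m) M]
  [MeasurableSpace M] [BorelSpace M] [SecondCountableTopology M] [ProperSpace M]
  {p : ℝ} {u : M → ℝ} {X : (x : M) → TangentSpace (𝓡 m) x}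

/-- A lower bound for the growth of the integral over balls. -/
theorem exists_le_mul_lintegral_ball (hp : 1 < p) {k : ℝ} (hk : 0 < k)
    {A : (x : M) → ℝ → TangentSpace (𝓡 m) x → TangentSpace (𝓡 m) x}
    (hA : IsWeaklyCoercive p k A) (hu : IsSobolevLoc p u X) {V : M → ℝ} (hVc : Continuous V)
    (hV : ∀ x, 0 < V x) {s₀ : ℝ} (hs₀ : 0 ≤ s₀)
    (hs₀u : (s₀ : EReal) < essSup (fun x ↦ (u x : EReal)) (vol m M))
    (hLu : WeakIneq p A u X (fun x ↦ ENNReal.ofReal (V x * u x ^ (p - 1))) s₀)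
    {q : ℝ} (hq : p - 1 < q) (x₀ : M) {Φ : ℝ → ℝ} {σ c R₀ : ℝ}
    (hΦ : ∀ t, 0 < t → HasDerivAt Φ (t ^ (-σ)) t) (hσ : 0 ≤ σ) (hc : 0 < c) (hR₀ : 1 ≤ R₀)
    (hVR : ∀ x, R₀ ≤ dist x x₀ →
      (p - 1) ^ (p - 1) * k ^ p * (q - p + 1) ^ (1 - p) * c ^ p < dist x x₀ ^ (σ * p) * V x) :
    ∃ D > 0, ∃ R₂, ∀ S d, 0 < d → R₂ ≤ S →
      ENNReal.ofReal D ≤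
        ENNReal.ofReal ((Real.exp (-c * Φ S) * (c * S ^ (-σ) + 1 / d)) ^ p) *
          ∫⁻ x in Metric.ball x₀ (S + 2 * d), ENNReal.ofReal (max (u x - s₀) 0 ^ q)
            ∂(vol m M) := by
  have hβ : 0 < q - p + 1 := by linarith
  have hp0 : 0 < p := by linarith
  have hp1 : 0 < p - 1 := by linarith
  have hum : AEMeasurable u (vol m M) := hu.aemeasurable hp.le
  have hwm : AEMeasurable (fun x ↦ max (u x - s₀) 0 ^ q) (vol m M) :=
    ((hum.sub_const s₀).max aemeasurable_const).pow_const q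
  have hdm : Measurable fun x : M ↦ dist x x₀ := by fun_prop
  have hw0 : ∀ x, 0 ≤ max (u x - s₀) 0 ^ q := fun x ↦ Real.rpow_nonneg (le_max_right _ _) _
  set K := (p - 1) ^ (p - 1) * k ^ p * (q - p + 1) ^ (1 - p) with hK
  have hK0 : 0 < K := by positivity
  have hem : Measurable (decay Φ c R₀) :=
    (lipschitzWith_decay hΦ hσ hc hR₀).continuous.measurable
  set ρ : ℝ → ℝ := fun r ↦ if r < R₀ then 0 else c * r ^ (-σ) with hρ
  have hρm : Measurable ρ := Measurable.ite measurableSet_Iio measurable_const (by fun_prop)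
  have hρ0 : ∀ r, 0 ≤ ρ r := fun r ↦ by
    simp only [hρ]
    split_ifs with h
    · exact le_rfl
    · have : 0 < r := by linarith
      positivity
  -- The surplus V h^p - K g^p before the cutoff. It is positive because the frozen weight has zero
  -- slope below R₀ and `hVR` applies beyond; it does not involve S or d.
  set Q : M → ℝ := fun x ↦ (V x - K * ρ (dist x x₀) ^ p) * decay Φ c R₀ (dist x x₀) ^ p with hQ
  have hQ0 : ∀ x, 0 < Q x := fun x ↦ by
    refine mul_pos ?_ (Real.rpow_pos_of_pos (decay_pos _ _ _ _) _)
    simp only [hρ]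
    split_ifs with h
    · rw [Real.zero_rpow hp0.ne', mul_zero, sub_zero]; exact hV x
    · have hr : 0 < dist x x₀ := by linarith
      have h1 := hVR x (not_lt.1 h)
      have h2 : 0 < dist x x₀ ^ (σ * p) := by positivity
      rw [Real.mul_rpow hc.le (by positivity), ← Real.rpow_mul hr.le, neg_mul,
        Real.rpow_neg hr.le, sub_pos, ← mul_assoc, mul_inv_lt_iff₀ h2]
      linarith
  have hQm : Measurable Q :=
    (hVc.measurable.sub (((hρm.comp hdm).pow_const p).const_mul K)).mul
      ((hem.comp hdm).pow_const p)
  have hfm : AEMeasurable (fun x ↦ ENNReal.ofReal (Q x * max (u x - s₀) 0 ^ q)) (vol m M) :=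
    (hQm.aemeasurable.mul hwm).ennreal_ofReal
  obtain ⟨R', hR'⟩ := exists_setLIntegral_ball_ne_zero hs₀u hfm (fun x hx ↦ by
    have h1 : 0 < max (u x - s₀) 0 := lt_max_of_lt_left (by linarith)
    have := hQ0 x
    simp only [ne_eq, ENNReal.ofReal_eq_zero, not_le]
    positivity) x₀
  set J := ∫⁻ x in Metric.ball x₀ R', ENNReal.ofReal (Q x * max (u x - s₀) 0 ^ q) ∂(vol m M)
    with hJ
  have hJ0 : J ≠ 0 := hR'
  -- J could be infinite; the minimum with 1 supplies a positive real constant in either case.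
  have hmin0 : min J 1 ≠ 0 := (lt_min (pos_iff_ne_zero.2 hJ0) one_pos).ne'
  have hminT : min J 1 ≠ ⊤ := ne_top_of_le_ne_top ENNReal.one_ne_top (min_le_right _ _)
  refine ⟨(min J 1).toReal / K, div_pos (ENNReal.toReal_pos hmin0 hminT) hK0, max R₀ R',
    fun S d hd hS ↦ ?_⟩
  have hSR₀ : R₀ ≤ S := (le_max_left _ _).trans hS
  have hS0 : 0 < S := by linarith
  have hSR' : R' ≤ S := (le_max_right _ _).trans hS
  set I := ∫⁻ x in Metric.ball x₀ (S + 2 * d), ENNReal.ofReal (max (u x - s₀) 0 ^ q) ∂(vol m M)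
    with hI
  set B := Real.exp (-c * Φ S) * (c * S ^ (-σ) + 1 / d) with hB
  have hB0 : 0 < B := by positivity
  have heS : decay Φ c R₀ S = Real.exp (-c * Φ S) := by rw [decay, max_eq_left hSR₀]
  by_cases hfin : I = ⊤
  · rw [hfin, ENNReal.mul_top (by simpa using Real.rpow_pos_of_pos hB0 p)]
    exact le_top
  set h : ℝ → ℝ := fun r ↦ decay Φ c R₀ r * highCutoff S d r with hh
  set g := profileSlope Φ σ c R₀ S d with hg
  have hhL : LocallyLipschitz h :=
    LocallyLipschitzOn.locallyLipschitz_mul isOpen_univ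
      (lipschitzWith_decay hΦ hσ hc hR₀).locallyLipschitz.locallyLipschitzOn
      (lipschitzWith_highCutoff S hd) (subset_univ _)
  have hgm : Measurable g := measurable_profileSlope hΦ hσ hc hR₀
  have hg0 : ∀ r, 0 ≤ g r := profileSlope_nonneg hc hR₀ hd
  -- The slope bound is nonzero at r = S + d itself, hence the larger radius S + 2d.
  have hgz : ∀ r, S + 2 * d ≤ r → g r = 0 := fun r hr ↦ by
    rw [hg, profileSlope, if_neg (by linarith), if_neg (by linarith), if_neg (by linarith)]
  have hardy := lintegral_rpow_le hp hk hA hu hVc hV hs₀ hLu hq x₀ hhL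
    (fun r ↦ mul_nonneg (decay_pos _ _ _ _).le (highCutoff_nonneg _ _ _)) hg0
    (slopeLE_profile hΦ hc hR₀ hSR₀ hd) hgm (R := S + 2 * d)
    (fun r hr ↦ by rw [hh]; simp only; rw [highCutoff_eq_zero hd (by linarith), mul_zero])
    hgz (profileSlope_le hΦ hσ hc hR₀ hd) hfin
  rw [← hK] at hardy
  have hballm : MeasurableSet (Metric.ball x₀ S) := Metric.isOpen_ball.measurableSet
  have hgint : AEMeasurable (fun x ↦ ENNReal.ofReal
      (K * max (u x - s₀) 0 ^ q * g (dist x x₀) ^ p)) (vol m M) :=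
    ((hwm.const_mul K).mul ((hgm.comp hdm).pow_const p).aemeasurable).ennreal_ofReal
  -- on the inner ball the two densities differ by `Q`
  have hsplit : ∀ x ∈ Metric.ball x₀ S,
      ENNReal.ofReal (V x * max (u x - s₀) 0 ^ q * h (dist x x₀) ^ p) =
      ENNReal.ofReal (Q x * max (u x - s₀) 0 ^ q) +
        ENNReal.ofReal (K * max (u x - s₀) 0 ^ q * g (dist x x₀) ^ p) := by
    intro x hx
    have hx' : dist x x₀ < S := hx
    have hgx : g (dist x x₀) = ρ (dist x x₀) * decay Φ c R₀ (dist x x₀) := by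
      rw [hg, profileSlope, hρ]
      simp only
      split_ifs
      · rw [zero_mul]
      · rfl
    have hhx : h (dist x x₀) = decay Φ c R₀ (dist x x₀) := by
      simp only [hh]; rw [highCutoff_eq_one hd hx'.le, mul_one]
    rw [← ENNReal.ofReal_add (mul_nonneg (hQ0 x).le (hw0 x))
      (mul_nonneg (mul_nonneg hK0.le (hw0 x)) (Real.rpow_nonneg (hg0 _) _)), hgx, hhx,
      Real.mul_rpow (hρ0 _) (decay_pos _ _ _ _).le]
    simp only [hQ]
    ring_nf
  have hin : ∫⁻ x in Metric.ball x₀ S, ENNReal.ofReal (Q x * max (u x - s₀) 0 ^ q) ∂(vol m M) +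
      ∫⁻ x in Metric.ball x₀ S, ENNReal.ofReal (K * max (u x - s₀) 0 ^ q * g (dist x x₀) ^ p)
        ∂(vol m M) ≤
      ∫⁻ x in (Metric.ball x₀ S)ᶜ, ENNReal.ofReal (K * max (u x - s₀) 0 ^ q *
        g (dist x x₀) ^ p) ∂(vol m M) +
      ∫⁻ x in Metric.ball x₀ S, ENNReal.ofReal (K * max (u x - s₀) 0 ^ q * g (dist x x₀) ^ p)
        ∂(vol m M) := by
    rw [← lintegral_add_right' _ hgint.restrict, ← setLIntegral_congr_fun hballm hsplit,
      add_comm, lintegral_add_compl _ hballm]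
    exact (setLIntegral_le_lintegral _ _).trans hardy
  -- Cancelling the inner slope integral in [0, ∞] requires its finiteness, which comes from that of
  -- I.
  have hGfin : ∫⁻ x in Metric.ball x₀ S, ENNReal.ofReal
      (K * max (u x - s₀) 0 ^ q * g (dist x x₀) ^ p) ∂(vol m M) ≠ ⊤ := by
    set G := decay Φ c R₀ R₀ * (c + 1 / d)
    have hle : ∫⁻ x in Metric.ball x₀ S, ENNReal.ofReal
        (K * max (u x - s₀) 0 ^ q * g (dist x x₀) ^ p) ∂(vol m M) ≤
        ENNReal.ofReal (K * G ^ p) * I := by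
      rw [hI, ← lintegral_const_mul' _ _ ENNReal.ofReal_ne_top]
      refine (lintegral_mono fun x ↦ ?_).trans
        (lintegral_mono_set (Metric.ball_subset_ball (by linarith)))
      rw [← ENNReal.ofReal_mul' (hw0 x)]
      refine ENNReal.ofReal_le_ofReal ?_
      have h1 : g (dist x x₀) ^ p ≤ G ^ p :=
        Real.rpow_le_rpow (hg0 _) (profileSlope_le hΦ hσ hc hR₀ hd _) hp0.le
      calc K * max (u x - s₀) 0 ^ q * g (dist x x₀) ^ p
          ≤ K * max (u x - s₀) 0 ^ q * G ^ p :=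
            mul_le_mul_of_nonneg_left h1 (mul_nonneg hK0.le (hw0 x))
        _ = _ := by ring
    exact ne_top_of_le_ne_top (ENNReal.mul_ne_top ENNReal.ofReal_ne_top hfin) hle
  have hcancel := (ENNReal.add_le_add_iff_right hGfin).1 hin
  have hout : ∫⁻ x in (Metric.ball x₀ S)ᶜ, ENNReal.ofReal (K * max (u x - s₀) 0 ^ q *
        g (dist x x₀) ^ p) ∂(vol m M) ≤ ENNReal.ofReal (K * B ^ p) * I := by
    rw [hI, ← lintegral_const_mul' _ _ ENNReal.ofReal_ne_top,
      ← lintegral_indicator Metric.isOpen_ball.measurableSet]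
    refine le_trans (setLIntegral_mono' hballm.compl fun x hx ↦ ?_)
      (setLIntegral_le_lintegral _ _)
    have hx' : S ≤ dist x x₀ := not_lt.1 hx
    rcases lt_or_ge (dist x x₀) (S + 2 * d) with h1 | h1
    · rw [indicator_of_mem (show x ∈ Metric.ball x₀ (S + 2 * d) from h1),
        ← ENNReal.ofReal_mul' (hw0 x)]
      refine ENNReal.ofReal_le_ofReal ?_
      have h2 := profileSlope_le_of_le hΦ hσ hc hR₀ hSR₀ hd hx'
      rw [heS] at h2
      have h3 : g (dist x x₀) ^ p ≤ B ^ p := Real.rpow_le_rpow (hg0 _) h2 hp0.le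
      calc K * max (u x - s₀) 0 ^ q * g (dist x x₀) ^ p
          ≤ K * max (u x - s₀) 0 ^ q * B ^ p :=
            mul_le_mul_of_nonneg_left h3 (mul_nonneg hK0.le (hw0 x))
        _ = _ := by ring
    · rw [hgz _ h1, Real.zero_rpow hp0.ne', mul_zero, ENNReal.ofReal_zero]
      exact zero_le
  have hJle : min J 1 ≤ ENNReal.ofReal (K * B ^ p) * I :=
    (min_le_left _ _).trans ((lintegral_mono_set (Metric.ball_subset_ball hSR')).trans
      (hcancel.trans hout))
  rw [ENNReal.ofReal_div_of_pos hK0, ENNReal.ofReal_toReal hminT]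
  refine ENNReal.div_le_of_le_mul ?_
  refine hJle.trans_eq ?_
  rw [ENNReal.ofReal_mul hK0.le]
  ring

end Growth

end

section

/-! ### The potential bound and the growth constants -/

section Constants

/-- The potential bound does not depend on the base point. -/
theorem PotentialBound.exists_lt {M : Type*} [MetricSpace M] [ProperSpace M] {V : M → ℝ}
    {lam μ : ℝ} (hV : PotentialBound V lam μ) (hVpos : ∀ x, 0 < V x) (hμ : 0 ≤ μ) (x₀ : M)
    {a : ℝ} (ha : a < lam) :
    ∃ R₀, 1 ≤ R₀ ∧ ∀ x, R₀ ≤ dist x x₀ → a < dist x x₀ ^ μ * V x := by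
  rcases hμ.eq_or_lt with rfl | hμ
  · refine ⟨1, le_rfl, fun x _ ↦ ?_⟩
    rw [Real.rpow_zero, one_mul]
    exact ha.trans_le (hV.1 rfl x)
  obtain ⟨o, ho⟩ := hV.2 hμ
  obtain ⟨b, hab, hb⟩ := exists_between ha
  have hev := eventually_lt_of_lt_liminf ((EReal.coe_lt_coe_iff.2 hb).trans_le ho)
  rw [← Metric.cobounded_eq_cocompact, ← Metric.comap_dist_right_atTop x₀, eventually_comap] at hev
  -- By the triangle inequality, changing the base point costs at most the factor (r / (r + dist x₀
  -- o))^μ, which tends to 1; the room between a and b absorbs it.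
  have hlim : Tendsto (fun r : ℝ ↦ (1 - dist x₀ o / (r + dist x₀ o)) ^ μ * b) atTop
      (𝓝 ((1 - 0) ^ μ * b)) := by
    refine Tendsto.mul_const _ (Tendsto.rpow_const (tendsto_const_nhds.sub ?_) (Or.inr hμ.le))
    exact tendsto_const_nhds.div_atTop (tendsto_atTop_add_const_right _ _ tendsto_id)
  rw [sub_zero, Real.one_rpow, one_mul] at hlim
  obtain ⟨R₁, hR₁⟩ := eventually_atTop.1 (hev.and (hlim.eventually (lt_mem_nhds hab)))
  refine ⟨max 1 R₁, le_max_left _ _, fun x hx ↦ ?_⟩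
  have hr : 0 < dist x x₀ := zero_lt_one.trans_le ((le_max_left _ _).trans hx)
  obtain ⟨h1, h2⟩ := hR₁ _ ((le_max_right _ _).trans hx)
  have h3 : b < dist x o ^ μ * V x := EReal.coe_lt_coe_iff.1 (h1 x rfl)
  have h4 : 0 < dist x x₀ + dist x₀ o := by positivity
  have h5 : 1 - dist x₀ o / (dist x x₀ + dist x₀ o) =
      dist x x₀ / (dist x x₀ + dist x₀ o) := by field_simp; ring
  rw [h5, Real.div_rpow hr.le h4.le] at h2
  have h6 : dist x o ^ μ ≤ (dist x x₀ + dist x₀ o) ^ μ :=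
    Real.rpow_le_rpow dist_nonneg (dist_triangle _ _ _) hμ.le
  have h7 : b < (dist x x₀ + dist x₀ o) ^ μ * V x :=
    h3.trans_le (mul_le_mul_of_nonneg_right h6 (hVpos x).le)
  have h8 : 0 < dist x x₀ ^ μ / (dist x x₀ + dist x₀ o) ^ μ := by positivity
  calc a < dist x x₀ ^ μ / (dist x x₀ + dist x₀ o) ^ μ * b := h2
    _ < dist x x₀ ^ μ / (dist x x₀ + dist x₀ o) ^ μ *
        ((dist x x₀ + dist x₀ o) ^ μ * V x) := mul_lt_mul_of_pos_left h7 h8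
    _ = dist x x₀ ^ μ * V x := by
      have : (dist x x₀ + dist x₀ o) ^ μ ≠ 0 := by positivity
      field_simp

variable {p q lam k : ℝ}

theorem one_div_conjExponent (p : ℝ) : 1 / p.conjExponent = (p - 1) / p := by
  rw [Real.conjExponent, one_div_div]

theorem growthConst_pos (hp : 1 < p) (hk : 0 < k) (hlam : 0 < lam) (hq : p - 1 < q) :
    0 < growthConst p q lam k := by
  have h1 : 0 < p - 1 := by linarith
  have h2 : 0 < q - p + 1 := by linarith
  unfold growthConst
  positivity

/-- This identifies the threshold for the decay rate: every c < C₀/p leaves a strict gap below λ. -/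
theorem mul_growthConst_div_rpow (hp : 1 < p) (hk : 0 < k) (hlam : 0 < lam) (hq : p - 1 < q) :
    (p - 1) ^ (p - 1) * k ^ p * (q - p + 1) ^ (1 - p) * (growthConst p q lam k / p) ^ p =
      lam := by
  have hp0 : 0 < p := by linarith
  have h1 : 0 < p - 1 := by linarith
  have h2 : 0 < q - p + 1 := by linarith
  have h3 : growthConst p q lam k / p =
      (q - p + 1) ^ ((p - 1) / p) * lam ^ (1 / p) / ((p - 1) ^ ((p - 1) / p) * k) := by
    rw [growthConst, one_div_conjExponent]
    field_simp
  have h4 : ∀ {x : ℝ} (s : ℝ), 0 < x → (x ^ (s / p)) ^ p = x ^ s := fun s hx ↦ by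
    rw [← Real.rpow_mul hx.le, div_mul_cancel₀ _ hp0.ne']
  rw [h3, Real.div_rpow (by positivity) (by positivity), Real.mul_rpow (by positivity)
    (by positivity), Real.mul_rpow (by positivity) hk.le, h4 _ h2, h4 _ hlam, h4 _ h1,
    Real.rpow_one, show 1 - p = -(p - 1) by ring, Real.rpow_neg h2.le]
  field_simp

theorem strictMonoOn_rpow_mul_rpow (hp : 1 < p) :
    StrictMonoOn (fun x : ℝ ↦ x ^ (1 / p) * (x - p) ^ (1 / p.conjExponent)) (Ici p) := by
  intro x hx y hy hxy
  have hx' : p ≤ x := hx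
  have hb : 0 < 1 / p.conjExponent := by
    rw [one_div_conjExponent]; exact div_pos (by linarith) (by linarith)
  have ha : 0 < 1 / p := by positivity
  have h1 : x ^ (1 / p) < y ^ (1 / p) := Real.rpow_lt_rpow (by linarith) hxy ha
  have h2 : (x - p) ^ (1 / p.conjExponent) < (y - p) ^ (1 / p.conjExponent) :=
    Real.rpow_lt_rpow (by linarith) (by linarith) hb
  exact mul_lt_mul'' h1 h2 (Real.rpow_nonneg (by linarith) _) (Real.rpow_nonneg (by linarith) _)

/-- Write C = C^(1/p) C^(1/p') and enlarge the first base. This gives the upper endpoint for the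
intermediate value theorem and, by monotonicity, C₁ ≤ C₀ + p. -/
theorem le_rpow_mul_rpow (hp : 1 < p) {C : ℝ} (hC : 0 < C) :
    C ≤ (C + p) ^ (1 / p) * (C + p - p) ^ (1 / p.conjExponent) := by
  have hp0 : 0 < p := by linarith
  rw [add_sub_cancel_right, one_div_conjExponent]
  calc C = C ^ (1 / p) * C ^ ((p - 1) / p) := by
        rw [← Real.rpow_add hC, ← add_div, add_sub_cancel, div_self hp0.ne', Real.rpow_one]
    _ ≤ _ := by gcongr; linarith

theorem existsUnique_rpow_mul_rpow_eq (hp : 1 < p) {C : ℝ} (hC : 0 < C) :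
    ∃! x : ℝ, p < x ∧ x ^ (1 / p) * (x - p) ^ (1 / p.conjExponent) = C := by
  have hp0 : 0 < p := by linarith
  have hb : 0 < 1 / p.conjExponent := by
    rw [one_div_conjExponent]; exact div_pos (by linarith) hp0
  have hcont : ContinuousOn (fun x : ℝ ↦ x ^ (1 / p) * (x - p) ^ (1 / p.conjExponent))
      (Icc p (C + p)) :=
    ((Real.continuous_rpow_const (by positivity)).mul
      ((Real.continuous_rpow_const hb.le).comp (continuous_sub_right p))).continuousOn
  have hzero : (fun x : ℝ ↦ x ^ (1 / p) * (x - p) ^ (1 / p.conjExponent)) p = 0 := by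
    simp only [sub_self]
    rw [Real.zero_rpow hb.ne', mul_zero]
  obtain ⟨x, hx, hxC⟩ := intermediate_value_Icc (by linarith) hcont
    ⟨hzero.le.trans hC.le, le_rpow_mul_rpow hp hC⟩
  refine ⟨x, ⟨hx.1.lt_of_ne ?_, hxC⟩, fun y hy ↦ ?_⟩
  · rintro rfl
    exact hC.ne (hzero.symm.trans hxC)
  · exact (strictMonoOn_rpow_mul_rpow hp).injOn hy.1.le hx.1 (hy.2.trans hxC.symm)

theorem le_add_of_rpow_mul_rpow_eq (hp : 1 < p) {C x : ℝ} (hC : 0 < C) (hx : p < x)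
    (hxC : x ^ (1 / p) * (x - p) ^ (1 / p.conjExponent) = C) : x ≤ C + p := by
  by_contra! h
  have h1 := strictMonoOn_rpow_mul_rpow hp (mem_Ici.2 (by linarith)) hx.le h
  have h2 := le_rpow_mul_rpow hp hC
  simp only at h1
  linarith

end Constants

/-! ### Passing to lower limits in the extended reals -/

section ExtendedReal

theorem coe_le_liminf_of_tendsto {f : ℝ → ℝ} {ℓ : ℝ} {F : ℝ → EReal}
    (hf : Tendsto f atTop (𝓝 ℓ)) (h : ∀ᶠ R in atTop, (f R : EReal) ≤ F R) :
    (ℓ : EReal) ≤ liminf F atTop := by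
  rw [← ((continuous_coe_real_ereal.tendsto ℓ).comp hf).liminf_eq]
  exact liminf_le_liminf h

theorem log_sub_log_le_ennreal_log {D B : ℝ} (hD : 0 < D) (hB : 0 < B) {I : ℝ≥0∞}
    (h : ENNReal.ofReal D ≤ ENNReal.ofReal B * I) :
    ((Real.log D - Real.log B : ℝ) : EReal) ≤ ENNReal.log I := by
  rw [← Real.log_div hD.ne' hB.ne', ← ENNReal.log_ofReal_of_pos (by positivity)]
  refine ENNReal.log_le_log ?_
  rw [ENNReal.ofReal_div_of_pos hB]
  exact ENNReal.div_le_of_le_mul' h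

theorem add_le_of_forall_lt {p C e : ℝ} (hp : 0 < p) (hC : 0 < C) {L : EReal}
    (h : ∀ c, 0 < c → c < C / p → ((p * c + e : ℝ) : EReal) ≤ L) : ((C + e : ℝ) : EReal) ≤ L := by
  have hlim : Tendsto (fun c : ℝ ↦ ((p * c + e : ℝ) : EReal)) (𝓝[<] (C / p))
      (𝓝 ((p * (C / p) + e : ℝ) : EReal)) :=
    ((continuous_coe_real_ereal.comp (by fun_prop : Continuous fun c : ℝ ↦ p * c + e)).tendsto
      _).mono_left nhdsWithin_le_nhds
  rw [mul_div_cancel₀ _ hp.ne'] at hlim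
  refine le_of_tendsto hlim ?_
  filter_upwards [Ioo_mem_nhdsLT (div_pos hC hp)] with c hc using h c hc.1 hc.2

end ExtendedReal

/-! ### The two lower limits -/

section Liminf

variable {m : ℕ} {M : Type*} [MetricSpace M] [ChartedSpace (EuclideanSpace ℝ (Fin m)) M]
  [IsManifold (𝓡 m) ∞ M] [RiemannianBundle (fun x : M ↦ TangentSpace (𝓡 m) x)]
  [IsContMDiffRiemannianBundle (𝓡 m) ∞ (EuclideanSpace ℝ (Fin m))
      (fun x : M ↦ TangentSpace (𝓡 m) x)] [IsRiemannianManifold (𝓡 m) M]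
  [MeasurableSpace M] [BorelSpace M] [SecondCountableTopology M] [ProperSpace M]
  {p : ℝ} {u : M → ℝ} {X : (x : M) → TangentSpace (𝓡 m) x}

/-- The logarithmic form of `exists_le_mul_lintegral_ball`. -/
theorem exists_log_le_logBallIntegral (hp : 1 < p) {k : ℝ} (hk : 0 < k)
    {A : (x : M) → ℝ → TangentSpace (𝓡 m) x → TangentSpace (𝓡 m) x}
    (hA : IsWeaklyCoercive p k A) (hu : IsSobolevLoc p u X) {V : M → ℝ} (hVc : Continuous V)
    (hVpos : ∀ x, 0 < V x) {lam σ : ℝ} (hlam : 0 < lam) (hσ : 0 ≤ σ)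
    (hV : PotentialBound V lam (σ * p)) {s₀ : ℝ} (hs₀ : 0 ≤ s₀)
    (hs₀u : (s₀ : EReal) < essSup (fun x ↦ (u x : EReal)) (vol m M))
    (hLu : WeakIneq p A u X (fun x ↦ ENNReal.ofReal (V x * u x ^ (p - 1))) s₀)
    {q : ℝ} (hq : p - 1 < q) (x₀ : M) {Φ : ℝ → ℝ} {c : ℝ}
    (hΦ : ∀ t, 0 < t → HasDerivAt Φ (t ^ (-σ)) t) (hc : 0 < c)
    (hcC : c < growthConst p q lam k / p) :
    ∃ E R₂ : ℝ, 0 < R₂ ∧ ∀ S d, 0 < d → R₂ ≤ S →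
      ((E + p * (c * Φ S - Real.log (c * S ^ (-σ) + 1 / d)) : ℝ) : EReal) ≤
        logBallIntegral m u s₀ q x₀ (S + 2 * d) := by
  have hp0 : 0 < p := by linarith
  have hp1 : 0 < p - 1 := by linarith
  have hβ : 0 < q - p + 1 := by linarith
  have hlt : (p - 1) ^ (p - 1) * k ^ p * (q - p + 1) ^ (1 - p) * c ^ p < lam := by
    rw [← mul_growthConst_div_rpow hp hk hlam hq]
    gcongr
  obtain ⟨R₀, hR₀, hVR⟩ := hV.exists_lt hVpos (by positivity) x₀ hlt
  obtain ⟨D, hD, R₂, hR₂⟩ := exists_le_mul_lintegral_ball hp hk hA hu hVc hVpos hs₀ hs₀u hLu hq x₀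
    hΦ hσ hc hR₀ hVR
  refine ⟨Real.log D, max R₂ 1, lt_max_of_lt_right one_pos, fun S d hd hS ↦ ?_⟩
  have hS0 : 0 < S := one_pos.trans_le ((le_max_right _ _).trans hS)
  have h1 : 0 < c * S ^ (-σ) + 1 / d := by positivity
  have h := log_sub_log_le_ennreal_log hD (by positivity)
    (hR₂ S d hd ((le_max_left _ _).trans hS))
  rw [Real.log_rpow (by positivity), Real.log_mul (Real.exp_pos _).ne' h1.ne', Real.log_exp] at h
  refine le_trans (EReal.coe_le_coe_iff.2 (le_of_eq ?_)) h
  ring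

/-- Take Φ(t) = t^κ/κ with κ = 1 - μ/p, and an annulus of fixed width d = 1 with S = R - 2. The
logarithm of the annulus factor is bounded above, hence negligible after division by R^κ, and
Φ(S)/Φ(R) → 1. -/
theorem growthConst_le_liminf_of_lt (hp : 1 < p) {k : ℝ} (hk : 0 < k)
    {A : (x : M) → ℝ → TangentSpace (𝓡 m) x → TangentSpace (𝓡 m) x}
    (hA : IsWeaklyCoercive p k A) (hu : IsSobolevLoc p u X) {V : M → ℝ} (hVc : Continuous V)
    (hVpos : ∀ x, 0 < V x) {lam μ : ℝ} (hlam : 0 < lam) (hμ : 0 ≤ μ) (hμp : μ < p)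
    (hV : PotentialBound V lam μ) {s₀ : ℝ} (hs₀ : 0 ≤ s₀)
    (hs₀u : (s₀ : EReal) < essSup (fun x ↦ (u x : EReal)) (vol m M))
    (hLu : WeakIneq p A u X (fun x ↦ ENNReal.ofReal (V x * u x ^ (p - 1))) s₀)
    {q : ℝ} (hq : p - 1 < q) (x₀ : M) :
    (growthConst p q lam k : EReal) ≤
      liminf (fun R : ℝ ↦ (((1 - μ / p) / R ^ (1 - μ / p) : ℝ) : EReal) *
        logBallIntegral m u s₀ q x₀ R) atTop := by
  have hp0 : 0 < p := by linarith
  set κ := 1 - μ / p with hκ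
  have hκ0 : 0 < κ := by rw [hκ, sub_pos, div_lt_one hp0]; exact hμp
  have hσ : 0 ≤ μ / p := by positivity
  have hΦ : ∀ t : ℝ, 0 < t → HasDerivAt (fun t : ℝ ↦ t ^ κ / κ) (t ^ (-(μ / p))) t := by
    intro t ht
    have h := (Real.hasDerivAt_rpow_const (x := t) (p := κ) (Or.inl ht.ne')).div_const κ
    rwa [mul_div_cancel_left₀ _ hκ0.ne', show κ - 1 = -(μ / p) by rw [hκ]; ring] at h
  rw [← add_zero (growthConst p q lam k)]
  refine add_le_of_forall_lt hp0 (growthConst_pos hp hk hlam hq) fun c hc hcC ↦ ?_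
  obtain ⟨E, R₂, hR₂, h⟩ := exists_log_le_logBallIntegral (σ := μ / p) hp hk hA hu hVc hVpos hlam hσ
    (by rwa [div_mul_cancel₀ _ hp0.ne']) hs₀ hs₀u hLu hq x₀ hΦ hc hcC
  have hlim : Tendsto (fun R : ℝ ↦ p * c * (1 - 2 / R) ^ κ +
      κ * (E - p * Real.log (c + 1)) / R ^ κ) atTop (𝓝 (p * c * (1 - 0) ^ κ + 0)) := by
    refine Tendsto.add (Tendsto.const_mul _ (Tendsto.rpow_const (tendsto_const_nhds.sub ?_)
      (Or.inr hκ0.le))) (tendsto_const_nhds.div_atTop (tendsto_rpow_atTop hκ0))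
    exact tendsto_const_nhds.div_atTop tendsto_id
  rw [sub_zero, Real.one_rpow, mul_one] at hlim
  refine coe_le_liminf_of_tendsto hlim ?_
  filter_upwards [eventually_ge_atTop (R₂ + 3)] with R hR
  have hR0 : 0 < R := by linarith
  have h1 := h (R - 2) 1 one_pos (by linarith)
  rw [show R - 2 + 2 * 1 = R by ring] at h1
  have h2 : (R - 2) ^ (-(μ / p)) ≤ 1 := rpow_neg_le_one hσ (by linarith)
  have h3 : Real.log (c * (R - 2) ^ (-(μ / p)) + 1 / 1) ≤ Real.log (c + 1) := by
    have : 0 < R - 2 := by linarith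
    refine Real.log_le_log (by positivity) ?_
    nlinarith
  have h4 : (1 - 2 / R) ^ κ = (R - 2) ^ κ / R ^ κ := by
    rw [← Real.div_rpow (by linarith) hR0.le, sub_div, div_self hR0.ne']
  have h5 : 0 < R ^ κ := by positivity
  refine le_trans ?_ (mul_le_mul_of_nonneg_left h1 (EReal.coe_nonneg.2 (by positivity)))
  rw [← EReal.coe_mul, EReal.coe_le_coe_iff, h4]
  calc p * c * ((R - 2) ^ κ / R ^ κ) + κ * (E - p * Real.log (c + 1)) / R ^ κ
      = κ / R ^ κ * (E + p * (c * ((R - 2) ^ κ / κ) - Real.log (c + 1))) := by field_simp; ring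
    _ ≤ _ := by gcongr

/-- Now Φ = log, and the annulus width is taken proportional to R. Both c/S and 1/d are then of
order 1/R, and this additional decay, raised to the power p, is the source of the summand p. -/
theorem growthConst_add_le_liminf (hp : 1 < p) {k : ℝ} (hk : 0 < k)
    {A : (x : M) → ℝ → TangentSpace (𝓡 m) x → TangentSpace (𝓡 m) x}
    (hA : IsWeaklyCoercive p k A) (hu : IsSobolevLoc p u X) {V : M → ℝ} (hVc : Continuous V)
    (hVpos : ∀ x, 0 < V x) {lam : ℝ} (hlam : 0 < lam)
    (hV : PotentialBound V lam p) {s₀ : ℝ} (hs₀ : 0 ≤ s₀)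
    (hs₀u : (s₀ : EReal) < essSup (fun x ↦ (u x : EReal)) (vol m M))
    (hLu : WeakIneq p A u X (fun x ↦ ENNReal.ofReal (V x * u x ^ (p - 1))) s₀)
    {q : ℝ} (hq : p - 1 < q) (x₀ : M) :
    ((growthConst p q lam k + p : ℝ) : EReal) ≤
      liminf (fun R : ℝ ↦ ((1 / Real.log R : ℝ) : EReal) *
        logBallIntegral m u s₀ q x₀ R) atTop := by
  have hp0 : 0 < p := by linarith
  have hΦ : ∀ t : ℝ, 0 < t → HasDerivAt Real.log (t ^ (-1 : ℝ)) t := by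
    intro t ht
    rw [Real.rpow_neg_one]
    exact Real.hasDerivAt_log ht.ne'
  refine add_le_of_forall_lt hp0 (growthConst_pos hp hk hlam hq) fun c hc hcC ↦ ?_
  obtain ⟨E, R₂, hR₂, h⟩ := exists_log_le_logBallIntegral (σ := 1) hp hk hA hu hVc hVpos hlam
    zero_le_one (by rwa [one_mul]) hs₀ hs₀u hLu hq x₀ hΦ hc hcC
  set E' := E - p * (c * Real.log 2 + Real.log (2 * c + 4)) with hE'
  have hlim : Tendsto (fun R : ℝ ↦ p * c + p + E' / Real.log R) atTop (𝓝 (p * c + p + 0)) :=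
    tendsto_const_nhds.add (tendsto_const_nhds.div_atTop Real.tendsto_log_atTop)
  rw [add_zero] at hlim
  refine coe_le_liminf_of_tendsto hlim ?_
  filter_upwards [eventually_ge_atTop (2 * R₂), eventually_gt_atTop 1] with R hR hR1
  have hR0 : 0 < R := by linarith
  have hlog : 0 < Real.log R := Real.log_pos hR1
  -- With S = R/2 and d = R/4 the ball has radius S + 2d = R; the fixed ratios only affect the
  -- constant E'.
  have h1 := h (R / 2) (R / 4) (by positivity) (by linarith)
  have h2 : c * (R / 2) ^ (-1 : ℝ) + 1 / (R / 4) = (2 * c + 4) / R := by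
    rw [Real.rpow_neg_one]; field_simp
  rw [show R / 2 + 2 * (R / 4) = R by ring, h2, Real.log_div (by positivity) hR0.ne',
    Real.log_div hR0.ne' two_ne_zero] at h1
  refine le_trans ?_ (mul_le_mul_of_nonneg_left h1 (EReal.coe_nonneg.2 (by positivity)))
  rw [← EReal.coe_mul, EReal.coe_le_coe_iff]
  refine le_of_eq ?_
  rw [hE']
  field_simp
  ring

end Liminf

end

end RiemannianGrowth

end

theorem theorem3 {m : ℕ} {M : Type*} [MetricSpace M] [ConnectedSpace M] [CompleteSpace M]
    [SecondCountableTopology M] [MeasurableSpace M] [BorelSpace M]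
    [ChartedSpace (EuclideanSpace ℝ (Fin m)) M] [IsManifold (𝓡 m) ∞ M]
    [RiemannianBundle (fun x : M ↦ TangentSpace (𝓡 m) x)]
    [IsContMDiffRiemannianBundle (𝓡 m) ∞ (EuclideanSpace ℝ (Fin m))
      (fun x : M ↦ TangentSpace (𝓡 m) x)]
    [IsRiemannianManifold (𝓡 m) M]
    (p k lam μ : ℝ) (hp : 1 < p) (hk : 0 < k) (hlam : 0 < lam) (hμ₀ : 0 ≤ μ) (hμp : μ ≤ p)
    (A : (x : M) → ℝ → TangentSpace (𝓡 m) x → TangentSpace (𝓡 m) x)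
    (hA : IsWeaklyCoercive p k A)
    (V : M → ℝ) (hVcont : Continuous V) (hVpos : ∀ x, 0 < V x) (hV : PotentialBound V lam μ)
    (u : M → ℝ) (gradu : (x : M) → TangentSpace (𝓡 m) x) (hu : IsSobolevLoc p u gradu)
    (s₀ : ℝ) (hs₀ : 0 ≤ s₀) (hs₀u : (s₀ : EReal) < essSup (fun x ↦ (u x : EReal)) (vol m M))
    (hLu : WeakIneq p A u gradu (fun x ↦ ENNReal.ofReal (V x * u x ^ (p - 1))) s₀)
    (x₀ : M) (q : ℝ) (hq : p - 1 < q) :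
    0 < growthConst p q lam k ∧
    (μ < p →
      (growthConst p q lam k : EReal) ≤
        liminf (fun R : ℝ ↦ (((1 - μ / p) / R ^ (1 - μ / p) : ℝ) : EReal) *
          logBallIntegral m u s₀ q x₀ R) atTop) ∧
    (μ = p →
      (∃! C₁ : ℝ, p < C₁ ∧
        C₁ ^ (1 / p) * (C₁ - p) ^ (1 / p.conjExponent) = growthConst p q lam k) ∧
      (∀ C₁ : ℝ, p < C₁ →
        C₁ ^ (1 / p) * (C₁ - p) ^ (1 / p.conjExponent) = growthConst p q lam k →
        (C₁ : EReal) ≤ liminf (fun R : ℝ ↦ ((1 / Real.log R : ℝ) : EReal) *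
          logBallIntegral m u s₀ q x₀ R) atTop) ∧
      (∀ ℓ : EReal,
        Tendsto (fun R : ℝ ↦ ((1 / Real.log R : ℝ) : EReal) *
          logBallIntegral m u s₀ q x₀ R) atTop (𝓝 ℓ) →
        ((growthConst p q lam k + p : ℝ) : EReal) ≤ ℓ)) := by
  have : ProperSpace M := properSpace_of_isRiemannianManifold m
  have hC := growthConst_pos hp hk hlam hq
  refine ⟨hC, fun hμ ↦ growthConst_le_liminf_of_lt hp hk hA hu hVcont hVpos hlam hμ₀ hμ hV hs₀
    hs₀u hLu hq x₀, ?_⟩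
  rintro rfl
  -- This bound on the lower limit serves both remaining growth claims: C₁ ≤ C₀ + p gives one, and a
  -- limit, when it exists, equals the lower limit.
  have hle := growthConst_add_le_liminf hp hk hA hu hVcont hVpos hlam hV hs₀ hs₀u hLu hq x₀
  refine ⟨existsUnique_rpow_mul_rpow_eq hp hC, fun C₁ hC₁ hC₁C ↦ ?_, fun ℓ hℓ ↦ ?_⟩
  · exact (EReal.coe_le_coe_iff.2 (le_add_of_rpow_mul_rpow_eq hp hC hC₁ hC₁C)).trans hle
  · rwa [hℓ.liminf_eq] at hle
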